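/- **Setting.** Let $\mathbb{K}$ be the function field of a smooth projective geometrically connected curve over $\mathbb{F}_q$ (characteristic $p$), $\infty$ a closed point of degree $d_\infty$, $A\subset\mathbb{K}$ the ring of functions regular outside $\infty$, $|a|_\infty=q^{-d_\infty v_\infty(a)}$, $\mathbb{K}_\infty$ the completion of $\mathbb{K}$, and $\mathbf{C}_\infty$ the completion of an algebraic closure of $\mathbb{K}_\infty$. A ($1$-dimensional) $\mathbb{K}$-lattice is a pair $L=(\Lambda,\phi)$ of a nonzero fractional ideal $\Lambda\subset\mathbb{K}$ of $A$ and an $A$-module homomorphism $\phi:\mathbb{K}/A\to\mathbb{K}/\Lambda$; it is invertible if $\phi$ is an isomorphism. An element $\gamma\in\mathbb{K}^*$ acts by $\gamma(\Lambda,\phi)=(\gamma\Lambda,\gamma\phi)$. Write $(\Lambda,\phi)\sim(\Lambda',\phi')$ (commensurable) if $\phi=\phi'$ modulo $\Lambda+\Lambda'$, and $c(L)=\{L' : L'\sim L\}$. For a nonzero ideal $J\subset A$ put $J^{-1}L=(J^{-1}\Lambda,\ \phi \bmod J^{-1}\Lambda)$. The set of $\mathbb{K}$-lattices is topologized as the disjoint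 union over $\Lambda$ of the groups $\mathrm{Hom}_A(\mathbb{K}/A,\mathbb{K}/\Lambda)$ with pointwise convergence ($\mathbb{K}/\Lambda$ discrete), and the groupoid of pairs $L\sim L'$ modulo simultaneous scaling by $\mathbb{K}^*$ carries the quotient of the subspace topology. The convolution algebra $\mathcal{A}=\mathcal{A}(\mathcal{L}_{\mathbb{K},1})$ consists of the continuous compactly supported functions $f(L,L')$ on this groupoid with values in $\mathbf{C}_\infty$, with $$(f_1*f_2)(L,L')=\sum_{L\sim L''\sim L'}f_1(L,L'')f_2(L'',L').$$ Its unit is the indicator function of the diagonal. For a given $L$, it is normed by $\|f\|_{\pi_L}=\sup_{\xi\ne0}\|\pi_L(f)\xi\|/\|\xi\|$, where $\pi_L(f)\xi(L')=\sum_{L''\in c(L)}f(L',L'')\xi(L'')$ for finitely supported $\xi:c(L)\to\mathbf{C}_\infty$, with the sup norm. Fix a uniformizer $u_\infty$ of $\mathbb{K}_\infty$. For a fractional ideal $I$ and $s=(x,y)\in S_\infty=\mathbf{C}_\infty^*\times\mathbb{Z}_p$ put $I^s=x^{\deg I}\langle I\rangle^y$, where $\deg$ is the degree of fractional ideals ($\deg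 J=\dim_{\mathbb{F}_q}A/J$ for a nonzero ideal $J\subset A$), $\langle\cdot\rangle$ is the unique extension to a homomorphism from fractional ideals to the $1$-units of $\mathbf{C}_\infty$ of $(a)\mapsto a\,u_\infty^{-v_\infty(a)}$, for $a\in\mathbb{K}^*$ such that $a\,u_\infty^{-v_\infty(a)}$ is a $1$-unit, and $w^y=\sum_{j\ge0}\binom{y}{j}(w-1)^j$. The time evolution is $$(\sigma_sf)(L,L')=\frac{\Lambda^s}{\Lambda'^s}f(L,L'),\qquad L=(\Lambda,\phi),\ L'=(\Lambda',\phi').$$ Write $I^{x}=I^{(x,0)}$, $I^{-x}=I^{(x^{-1},0)}$ and $\sigma_x=\sigma_{(x,0)}$. **Theorem 4.9.** Let $L$ be an invertible $1$-dimensional $\mathbb{K}$-lattice and let $x\in\mathbf{C}_\infty^*$ with $|x|_\infty>q$. Then $Z(x)=\sum_{0\ne J\subset A}J^{-x}$ converges and is nonzero, $\|f\|_{\pi_L}<\infty$ for $f\in\mathcal{A}$, the series below converges for every $f\in\mathcal{A}$, and $$\varphi_{x,L}(f)=Z(x)^{-1}\sum_{0\ne J\subset A}f(J^{-1}L,J^{-1}L)\,J^{-x}$$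 is a KMS$_x$ functional on $\mathcal{A}$: it is $\mathbf{C}_\infty$-linear and continuous for $\|\cdot\|_{\pi_L}$; $1\in\mathcal{A}$ and $\varphi_{x,L}(1)=1$; and for all $f_1,f_2\in\mathcal{A}$ the functions $\sigma_x(f_2)$, $f_1*\sigma_x(f_2)$ and $f_2*f_1$ lie in $\mathcal{A}$ and $$\varphi_{x,L}(f_1*\sigma_x(f_2))=\varphi_{x,L}(f_2*f_1).$$ -/

import Mathlib

open scoped WithZero NNReal ENNReal nonZeroDivisors

noncomputable section

namespace FunctionFieldQSM

/-! ### Function fields and places -/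

/-- `K` is the function field of a smooth projective geometrically connected curve over `Fq`:
a finite extension of a rational function field `Fq(t)` in which `Fq` is algebraically closed. -/
structure IsCurveFunctionField (Fq K : Type*) [Field Fq] [Field K] [Algebra Fq K] : Prop where
  exists_finite : ∃ t : K, Transcendental Fq t ∧
    FiniteDimensional (IntermediateField.adjoin Fq {t}) K
  constants : algebraicClosure Fq K = ⊥

/-- A place (closed point of the curve): a normalized discrete valuation of `K` with finite
residue field. Such a valuation is automatically trivial on a finite field of constants.
Written multiplicatively, `val a = exp (-v(a))`. -/
@[ext]
structure Place (K : Type*) [Field K] where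
  val : Valuation K ℤᵐ⁰
  surjective : Function.Surjective val
  finite_residue : Finite (IsLocalRing.ResidueField val.valuationSubring)

variable {p : ℕ} [Fact p.Prime] {Fq K : Type*} [Field Fq] [Finite Fq] [CharP Fq p]
  [Field K] [Algebra Fq K]

/-- An element of a finite field of constants is integral at every place. -/
theorem Place.val_algebraMap_le_one (P : Place K) (c : Fq) : P.val (algebraMap Fq K c) ≤ 1 := by
  rcases eq_or_ne c 0 with rfl | hc
  · simp
  · have hn : Nat.card Fqˣ ≠ 0 := Nat.card_pos.ne'
    have h : c ^ Nat.card Fqˣ = 1 := by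
      have h0 : (Units.mk0 c hc) ^ Nat.card Fqˣ = 1 := pow_card_eq_one'
      rw [← Units.val_mk0 hc, ← Units.val_pow_eq_pow_val, h0, Units.val_one]
    have h2 : (P.val (algebraMap Fq K c)) ^ Nat.card Fqˣ = 1 := by
      rw [← map_pow, ← map_pow, h, map_one, map_one]
    exact (pow_le_one_iff hn).1 h2.le

variable (Fq) in
/-- The ring `A` of functions regular outside `∞`. -/
def ringA (P : Place K) : Subalgebra Fq K where
  carrier := {a | ∀ w : Place K, w ≠ P → w.val a ≤ 1}
  mul_mem' ha hb w hw := by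
    rw [map_mul]; exact mul_le_one' (ha w hw) (hb w hw)
  add_mem' ha hb w hw := (w.val.map_add _ _).trans (max_le (ha w hw) (hb w hw))
  algebraMap_mem' c w _ := w.val_algebraMap_le_one c

/-! ### The fields `K_∞` and `C_∞` -/

namespace Place

/-- The number `q ^ d_∞` of elements of the residue field. -/
def residueCard (P : Place K) : ℕ := Nat.card (IsLocalRing.ResidueField P.val.valuationSubring)

theorem one_lt_residueCard (P : Place K) : (1 : ℝ≥0) < P.residueCard := by
  have := P.finite_residue
  exact_mod_cast Finite.one_lt_card (α := IsLocalRing.ResidueField P.val.valuationSubring)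

/-- The normalized absolute value `|a|_∞ = (q ^ d_∞) ^ (-v_∞(a))`. -/
def absInf (P : Place K) : AbsoluteValue K ℝ where
  toFun a := (WithZeroMulInt.toNNReal P.one_lt_residueCard.ne_zero (P.val a) : ℝ≥0)
  map_mul' a b := by simp
  nonneg' a := NNReal.coe_nonneg _
  eq_zero' a := by simp
  add_le' a b := by
    have hm := (WithZeroMulInt.toNNReal_strictMono P.one_lt_residueCard).monotone
    have h := hm (P.val.map_add a b)
    rw [hm.map_max] at h
    exact_mod_cast h.trans (max_le_add_of_nonneg zero_le zero_le)

theorem absInf_add_le_max (P : Place K) (a b : K) :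
    P.absInf (a + b) ≤ max (P.absInf a) (P.absInf b) := by
  have hm := (WithZeroMulInt.toNNReal_strictMono P.one_lt_residueCard).monotone
  have h := hm (P.val.map_add a b)
  rw [hm.map_max] at h
  exact_mod_cast h

end Place

/-- `K_∞`, the completion of `K` for `|·|_∞`. -/
abbrev KInf (P : Place K) : Type _ := P.absInf.Completion

/-- The embedding of `K` in `K_∞`. -/
def toKInf (P : Place K) (a : K) : KInf P := ((WithAbs.toAbs P.absInf a : WithAbs P.absInf) : _)

theorem norm_toKInf (P : Place K) (a : K) : ‖toKInf P a‖ = P.absInf a := by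
  simp only [toKInf, UniformSpace.Completion.norm_coe]
  rfl

instance (P : Place K) : IsUltrametricDist (KInf P) :=
  IsUltrametricDist.isUltrametricDist_of_forall_norm_add_le_max_norm fun a b => by
    induction a, b using UniformSpace.Completion.induction_on₂ with
    | hp => exact isClosed_le (by fun_prop) (by fun_prop)
    | ih a b =>
      rw [← UniformSpace.Completion.coe_add]
      simp only [UniformSpace.Completion.norm_coe]
      exact P.absInf_add_le_max a.ofAbs b.ofAbs

instance (P : Place K) : NontriviallyNormedField (KInf P) where
  non_trivial := by
    obtain ⟨a, ha⟩ := P.surjective (WithZero.exp 1)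
    refine ⟨toKInf P a, ?_⟩
    rw [norm_toKInf]
    have h := WithZeroMulInt.toNNReal_strictMono P.one_lt_residueCard
      (show (1 : ℤᵐ⁰) < P.val a by rw [ha, ← WithZero.exp_zero]; exact WithZero.exp_lt_exp.2 one_pos)
    rw [map_one] at h
    exact_mod_cast h

/-- A fixed algebraic closure of `K_∞`, with the canonical extension of `|·|_∞`. -/
abbrev KInfBar (P : Place K) : Type _ := AlgebraicClosure (KInf P)

instance (P : Place K) : NormedField (KInfBar P) := spectralNorm.normedField (KInf P) (KInfBar P)

/-- `C_∞`, the completion of the algebraic closure of `K_∞`. -/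
abbrev CInf (P : Place K) : Type _ := UniformSpace.Completion (KInfBar P)

/-- The embedding of `K_∞` in `C_∞`. -/
def toCInf (P : Place K) (a : KInf P) : CInf P :=
  ((algebraMap (KInf P) (KInfBar P) a : KInfBar P) : CInf P)

/-! ### Lattices and `K`-rational lattices of rank one -/

variable (Fq) in
/-- A rank one lattice in `K`, that is, a nonzero fractional ideal of `A`. -/
@[ext]
structure Lattice (P : Place K) where
  carrier : Submodule (ringA Fq P) K
  ne_bot : carrier ≠ ⊥
  isFractional : IsFractional (ringA Fq P)⁰ carrier

variable {P : Place K}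

variable (Fq P) in
/-- A `1`-dimensional `K`-rational lattice: a rank one lattice `Λ` together with an `A`-module
homomorphism `φ : K / A → KΛ / Λ = K / Λ`. -/
structure KLattice where
  lat : Lattice Fq P
  φ : (K ⧸ (1 : Submodule (ringA Fq P) K)) →ₗ[ringA Fq P] (K ⧸ lat.carrier)

namespace KLattice

/-- A `K`-lattice is invertible if `φ` is an isomorphism. -/
def IsInvertible (L : KLattice Fq P) : Prop := Function.Bijective L.φ

/-- `(Λ, φ)` and `(Λ', φ')` are commensurable if `φ = φ'` modulo `Λ + Λ'`. -/
def Commens (L L' : KLattice Fq P) : Prop :=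
  ∀ z, Submodule.factor (le_sup_left : L.lat.carrier ≤ L.lat.carrier ⊔ L'.lat.carrier) (L.φ z) =
    Submodule.factor (le_sup_right : L'.lat.carrier ≤ L.lat.carrier ⊔ L'.lat.carrier) (L'.φ z)

theorem Commens.refl (L : KLattice Fq P) : Commens L L := fun _ => rfl

/-- `L' = γ L`, that is, `Λ' = γ Λ` and `φ' = γ φ`. -/
def IsScaling (γ : Kˣ) (L L' : KLattice Fq P) : Prop :=
  (∀ w : K, (γ : K) * w ∈ L'.lat.carrier ↔ w ∈ L.lat.carrier) ∧
  ∀ z (w : K), L.φ z = Submodule.Quotient.mk w → L'.φ z = Submodule.Quotient.mk ((γ : K) * w)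

/-- The topology on the set of `K`-lattices: the disjoint union over all lattices `Λ` of the
compact groups `Hom_A(K/A, K/Λ) ≅ Λ ⊗ R` (`R` the ring of finite integral adeles), each with the
topology of pointwise convergence, where `K/Λ` is discrete. Its quotient by scaling is the
topology of `R ×_{R^*} (𝔸_{K,f}^* / K^*)` on the set of isomorphism classes. -/
instance : TopologicalSpace (KLattice Fq P) :=
  ⨆ Λ : Lattice Fq P, TopologicalSpace.coinduced
    (fun φ : (K ⧸ (1 : Submodule (ringA Fq P) K)) →ₗ[ringA Fq P] (K ⧸ Λ.carrier) =>
      (⟨Λ, φ⟩ : KLattice Fq P))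
    (⨅ z, TopologicalSpace.induced (fun φ => φ z) ⊥)

end KLattice

/-! ### The groupoid of commensurability and its convolution algebra -/

open KLattice

variable (Fq P) in
/-- Pairs of commensurable `K`-lattices. -/
abbrev CommPair : Type _ := {Q : KLattice Fq P × KLattice Fq P // Commens Q.1 Q.2}

variable (Fq P) in
/-- The groupoid of the commensurability relation on `K`-lattices up to isomorphism: pairs of
commensurable `K`-lattices up to simultaneous scaling by `Kˣ`, with the quotient topology. -/
abbrev CommGroupoid : Type _ :=
  Quot fun Q Q' : CommPair Fq P =>
    ∃ γ : Kˣ, IsScaling γ Q.1.1 Q'.1.1 ∧ IsScaling γ Q.1.2 Q'.1.2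

variable (Fq P) in
/-- The underlying vector space of the convolution algebra: continuous compactly supported
`C_∞`-valued functions on the groupoid, viewed as functions `f(L, L')` of pairs of commensurable
`K`-lattices. -/
def algA : Submodule (CInf P) (CommPair Fq P → CInf P) where
  carrier := {f | ∃ g : CommGroupoid Fq P → CInf P,
    Continuous g ∧ HasCompactSupport g ∧ ∀ Q, f Q = g (Quot.mk _ Q)}
  zero_mem' := ⟨0, continuous_zero, HasCompactSupport.zero, fun _ => rfl⟩
  add_mem' := by
    rintro f f' ⟨g, hg, hc, h⟩ ⟨g', hg', hc', h'⟩
    exact ⟨g + g', hg.add hg', hc.add hc', fun Q => by simp [h, h']⟩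
  smul_mem' := by
    rintro c f ⟨g, hg, hc, h⟩
    refine ⟨fun a => c * g a, continuous_const.mul hg, hc.mul_left, fun Q => by simp [h]⟩

open Classical in
/-- The value `f(L, L')`, extended by zero to pairs that are not commensurable. -/
def ev (f : CommPair Fq P → CInf P) (L L' : KLattice Fq P) : CInf P :=
  if h : Commens L L' then f ⟨(L, L'), h⟩ else 0

/-- The convolution product `(f₁ * f₂)(L, L') = ∑_{L ∼ L'' ∼ L'} f₁(L, L'') f₂(L'', L')`. -/
def conv (f₁ f₂ : CommPair Fq P → CInf P) : CommPair Fq P → CInf P := fun Q =>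
  ∑ᶠ L'' : {L'' : KLattice Fq P // Commens Q.1.1 L''}, ev f₁ Q.1.1 L'' * ev f₂ L'' Q.1.2

open Classical in
variable (Fq P) in
/-- The unit of the convolution algebra, the indicator function of the diagonal. -/
def convOne : CommPair Fq P → CInf P := fun Q => if Q.1.1 = Q.1.2 then 1 else 0

/-- The commensurability class of `L`. -/
abbrev CommClass (L : KLattice Fq P) : Type _ := {L' : KLattice Fq P // Commens L L'}

/-- The representation `(π_L(f) ξ)(L') = ∑_{L'' ∈ c(L)} f(L', L'') ξ(L'')` on the finitely
supported functions on `c(L)`. -/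
def piRep (L : KLattice Fq P) (f : CommPair Fq P → CInf P) (ξ : CommClass L →₀ CInf P) :
    CommClass L → CInf P := fun L' =>
  ξ.sum fun L'' z => ev f L' L'' * z

/-- The operator norm of `π_L(f)` for the supremum norm on functions on `c(L)`. -/
def piNorm (L : KLattice Fq P) (f : CommPair Fq P → CInf P) : ℝ≥0∞ :=
  ⨆ (ξ : CommClass L →₀ CInf P) (_ : ξ ≠ 0), (⨆ L', ‖piRep L f ξ L'‖ₑ) / (⨆ L', ‖ξ L'‖ₑ)

/-! ### Exponentiation of ideals and the time evolution -/

/-- The dimension over `Fq` of `M / (M ∩ N)`. -/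
def relDim (M N : Submodule (ringA Fq P) K) : ℕ :=
  Module.finrank Fq (M ⧸ N.submoduleOf M)

/-- The degree of a fractional ideal: `dim A/(A ∩ Λ) - dim Λ/(A ∩ Λ)`; it is `dim_{Fq} A/J` for a
nonzero ideal `J` of `A`, and `deg (a) = -d_∞ v_∞(a)`. -/
def Lattice.deg (Λ : Lattice Fq P) : ℤ :=
  (relDim 1 Λ.carrier : ℤ) - relDim Λ.carrier 1

/-- `u` is a uniformizer of `K_∞`. -/
def IsUniformizer (u : KInf P) : Prop := ‖u‖ = (P.residueCard : ℝ)⁻¹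

/-- `Λ ↦ g(Λ)` is a homomorphism from fractional ideals to the `1`-units of `C_∞` with
`g((a)) = ⟨a⟩` for every positive `a`. For the sign function attached to the uniformizer `u`,
an element `a` is positive if and only if `a u ^ (-m)` is a `1`-unit for some integer `m`
(necessarily `m = v_∞(a)`), and then `⟨a⟩ = a u ^ (-m)`. -/
structure IsAngleMap (u : KInf P) (g : Lattice Fq P → CInf P) : Prop where
  one_unit : ∀ Λ, ‖g Λ - 1‖ < 1
  mul : ∀ Λ₁ Λ₂ Λ₃ : Lattice Fq P, Λ₃.carrier = Λ₁.carrier * Λ₂.carrier → g Λ₃ = g Λ₁ * g Λ₂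
  principal : ∀ (Λ : Lattice Fq P) (a : K) (m : ℤ), Λ.carrier = Submodule.span _ {a} →
    ‖toKInf P a * u ^ (-m) - 1‖ < 1 → g Λ = toCInf P (toKInf P a * u ^ (-m))

/-- `⟨Λ⟩`, the unique extension of `a ↦ ⟨a⟩` from positive principal ideals to fractional ideals
(it exists and is unique since the class group is finite and the group of `1`-units of `C_∞` is
uniquely divisible). -/
def angle (u : KInf P) : Lattice Fq P → CInf P := Classical.epsilon (IsAngleMap u)

variable (p) in
/-- `w ^ y = ∑_j (y choose j) (w - 1) ^ j` for a `1`-unit `w` and `y ∈ ℤ_p`. -/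
def oneUnitPow (w : CInf P) (y : ℤ_[p]) : CInf P :=
  ∑' j : ℕ, ((PadicInt.toZMod (Ring.choose y j)).val : CInf P) * (w - 1) ^ j

/-- `Λ ^ s = x ^ deg(Λ) ⟨Λ⟩ ^ y` for `s = (x, y) ∈ S_∞ = C_∞^* × ℤ_p`. -/
def Lattice.idealPow (u : KInf P) (Λ : Lattice Fq P) (s : (CInf P)ˣ × ℤ_[p]) : CInf P :=
  (s.1 : CInf P) ^ Λ.deg * oneUnitPow p (angle u Λ) s.2

/-- The time evolution `(σ_s f)(L, L') = (Λ ^ s / Λ' ^ s) f(L, L')`, `s ∈ S_∞`. -/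
def timeEvolution (u : KInf P) (s : (CInf P)ˣ × ℤ_[p]) (f : CommPair Fq P → CInf P) :
    CommPair Fq P → CInf P := fun Q =>
  Q.1.1.lat.idealPow u s / Q.1.2.lat.idealPow u s * f Q

/-! ### KMS functionals -/

variable (p) in
/-- A KMS functional at inverse temperature `x` on the convolution algebra, for the time evolution
given by exponentiation of ideals, the algebra being normed by the operator norm in `π_L`.
Here `σ_x = σ_s` with `s = (x, 0)`. The conditions include that `σ_x` and the convolution product
preserve the algebra, and that it is unital. -/
structure IsKMSFunctional (u : KInf P) (L : KLattice Fq P) (x : (CInf P)ˣ)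
    (Φ : algA Fq P →ₗ[CInf P] CInf P) : Prop where
  continuous : ∃ C : ℝ≥0, ∀ f : algA Fq P, ‖Φ f‖ₑ ≤ C * piNorm L f
  normalized : ∃ h : convOne Fq P ∈ algA Fq P, Φ ⟨convOne Fq P, h⟩ = 1
  time_mem : ∀ f : algA Fq P, timeEvolution u (x, (0 : ℤ_[p])) f ∈ algA Fq P
  kms : ∀ f₁ f₂ : algA Fq P,
    ∃ (h : conv f₁ (timeEvolution u (x, (0 : ℤ_[p])) f₂) ∈ algA Fq P)
      (h' : conv f₂ f₁ ∈ algA Fq P), Φ ⟨_, h⟩ = Φ ⟨_, h'⟩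

variable (Fq P) in
/-- The nonzero ideals of `A`. -/
abbrev NonzeroIdeal : Type _ := {J : Ideal (ringA Fq P) // J ≠ ⊥}

/-- A nonzero ideal of `A` as a lattice in `K`. -/
def NonzeroIdeal.toLattice (J : NonzeroIdeal Fq P) : Lattice Fq P where
  carrier := Submodule.map (Algebra.linearMap (ringA Fq P) K) J.1
  ne_bot h := J.2 <| by
    rw [Submodule.eq_bot_iff] at h ⊢
    exact fun b hb => Subtype.val_injective (h _ ⟨b, hb, rfl⟩)
  isFractional := ⟨1, Submonoid.one_mem _, by
    rintro _ ⟨b, _, rfl⟩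
    exact ⟨b, by simp⟩⟩

theorem NonzeroIdeal.one_mem_inv (J : NonzeroIdeal Fq P) :
    (1 : K) ∈ (1 : Submodule (ringA Fq P) K) / J.toLattice.carrier := by
  rw [Submodule.mem_div_iff_forall_mul_mem]
  rintro _ ⟨b, _, rfl⟩
  rw [one_mul]
  exact Submodule.mem_one.2 ⟨b, rfl⟩

/-- The lattice `J⁻¹ Λ`, where `J⁻¹ = {c ∈ K | c J ⊆ A}`. -/
def NonzeroIdeal.invMul (J : NonzeroIdeal Fq P) (Λ : Lattice Fq P) : Lattice Fq P where
  carrier := (1 / J.toLattice.carrier) * Λ.carrier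
  ne_bot h := Λ.ne_bot <| by
    rw [Submodule.eq_bot_iff] at h ⊢
    intro w hw
    exact h w (by simpa using Submodule.mul_mem_mul J.one_mem_inv hw)
  isFractional := by
    obtain ⟨a, ha, hΛ⟩ := Λ.isFractional
    obtain ⟨b, hb, hb0⟩ := Submodule.exists_mem_ne_zero_of_ne_bot J.2
    refine ⟨a * b, mul_mem ha (mem_nonZeroDivisors_of_ne_zero hb0), fun y hy => ?_⟩
    induction hy using Submodule.mul_induction_on' with
    | mem_mul_mem c hc w hw =>
      have h1 : c * (b : K) ∈ (1 : Submodule (ringA Fq P) K) :=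
        Submodule.mem_div_iff_forall_mul_mem.1 hc _ ⟨b, hb, rfl⟩
      obtain ⟨d, hd⟩ := Submodule.mem_one.1 h1
      obtain ⟨e, he⟩ := hΛ w hw
      refine ⟨d * e, ?_⟩
      rw [map_mul, hd, he]
      simp only [Algebra.smul_def, map_mul]
      change c * (b : K) * ((a : K) * w) = (a : K) * (b : K) * (c * w)
      ring
    | add y₁ _ y₂ _ h₁ h₂ =>
      rw [smul_add]
      exact IsLocalization.isInteger_add h₁ h₂

theorem NonzeroIdeal.le_invMul (J : NonzeroIdeal Fq P) (Λ : Lattice Fq P) :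
    Λ.carrier ≤ (J.invMul Λ).carrier := fun w hw => by
  have h := Submodule.mul_mem_mul J.one_mem_inv hw
  rwa [one_mul] at h

/-- The `K`-lattice `J⁻¹ L = (J⁻¹ Λ, φ mod J⁻¹ Λ)`. -/
def NonzeroIdeal.invMulKLattice (J : NonzeroIdeal Fq P) (L : KLattice Fq P) : KLattice Fq P where
  lat := J.invMul L.lat
  φ := (Submodule.factor (J.le_invMul L.lat)).comp L.φ

/-- `J ^ (-x) = J ^ s` with `s = -(x, 0) = (x⁻¹, 0)` in the group `S_∞`. -/
def NonzeroIdeal.powNeg (p : ℕ) [Fact p.Prime] (u : KInf P) (J : NonzeroIdeal Fq P)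
    (x : (CInf P)ˣ) : CInf P :=
  J.toLattice.idealPow u (x⁻¹, (0 : ℤ_[p]))

variable (Fq) in
/-- The partition function `Z(x) = ∑_{J ⊆ A} J ^ (-x)`. -/
def partitionZ (p : ℕ) [Fact p.Prime] (u : KInf P) (x : (CInf P)ˣ) : CInf P :=
  ∑' J : NonzeroIdeal Fq P, J.powNeg p u x

end FunctionFieldQSM

end

/-!
# The KMS functionals of an invertible `K`-lattice

Let `L = (Λ, φ)` be invertible. Every `K`-lattice commensurable with `L` is `J⁻¹ L` for exactly one
nonzero ideal `J` of `A` (`KLattice.IsInvertible.exists_eq_invMul`): invertibility forces `Λ ⊆ Λ'`,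
and a commensurable `K`-lattice is determined by its underlying lattice. So in the representation
`π_L` an element `f` of the algebra is a matrix with entries `f(J⁻¹ L, J'⁻¹ L)`, convolution is
the matrix product, and the functional is the trace of this matrix weighted by `x ^ (- deg J)`.
As `deg(J⁻¹ Λ) = deg Λ - deg J`, the time evolution `σ_x` conjugates by the matrix of weights, and
the KMS condition is the cyclicity of the trace: both sides are the sum of
`f₁(J⁻¹ L, J'⁻¹ L) f₂(J'⁻¹ L, J⁻¹ L) x ^ (- deg J')` over all pairs `(J, J')`, taken in the two
orders (`tsum_conv_timeEvolution`).

Convergence is nonarchimedean: it is enough that the terms tend to `0`, which holds because there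
are finitely many ideals of bounded degree, `|x| > 1`, and the elements of the algebra are bounded
functions. The term for `J = A` is `1` and dominates `Z(x)`, so `Z(x) ≠ 0`. Diagonal matrix entries
are bounded by the operator norm, which gives the continuity of the functional.

That the algebra is closed under convolution and time evolution rests on a description of its
elements (`mem_algA_iff`): they are the continuous functions on pairs that are invariant under
scaling and supported on finitely many orbits of pairs of lattices `(Λ, Λ')`. This uses that
`Hom(K/A, K/Λ)` is compact and that the set of pairs over given lattices is open. For continuity of
a convolution product, the key point is that modulo `Λ + Λ''` a homomorphism to `K/Λ` lifts to
`K/Λ''` if and only if finitely many of its values are restricted (`KLattice.hasLift_iff`), and the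
lift depends continuously on it. The unit lies in the algebra because the class number is finite.

All this needs that `A` is a Dedekind domain with fraction field `K`, finite quotients and finite
class number, for `A` defined through places. The basic estimate is
`[O : s O] ≤ q ^ [K : Fq(s)]` for each `Fq`-subalgebra `O` of `K` that contains `s`
(`relIndex_smul_subalgebra`). It shows that such rings have finite quotients, that a transcendental
function has a pole but only finitely many of them, and, with weak approximation, Riemann's
inequality for the multiples of `∞` (`IsCurveFunctionField.exists_le_card_sections`). The latter
yields a nonconstant function in `A` and, by the pigeonhole principle, a small element in every
ideal, hence the finiteness of the class number.
-/

open scoped WithZero NNReal ENNReal nonZeroDivisors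

noncomputable section

namespace FunctionFieldQSM

/-! ### Linear independence over `Fq(s)` and the index of `s O` in `O` -/

section

open scoped IntermediateField.algebraAdjoinAdjoin

open Polynomial in
/-- It suffices to test linear independence over `Fq(s)` on polynomials in `s`, by clearing
denominators. -/
theorem linearIndependent_of_forall_polynomial {Fq K ι : Type*} [Field Fq] [Field K] [Algebra Fq K]
    (s : K) (x : ι → K)
    (h : ∀ (S : Finset ι) (f : ι → Fq[X]), ∑ i ∈ S, aeval s (f i) * x i = 0 → ∀ i ∈ S, f i = 0) :
    LinearIndependent (IntermediateField.adjoin Fq {s}) x := by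
  have h1 : LinearIndependent (Algebra.adjoin Fq {s}) x := by
    rw [linearIndependent_iff']
    intro S g hg i hi
    have hex : ∀ j, ∃ f : Fq[X], aeval s f = (g j : K) := fun j => by
      have h2 : (g j : K) ∈ (aeval s : Fq[X] →ₐ[Fq] K).range :=
        Algebra.adjoin_singleton_eq_range_aeval Fq s ▸ (g j).2
      exact h2
    choose f hf using hex
    have := h S f (by simp only [hf]; exact hg) i hi
    exact Subtype.ext (by rw [← hf, this, map_zero]; rfl)
  exact h1.localization (IntermediateField.adjoin Fq {s}) (nonZeroDivisors (Algebra.adjoin Fq {s}))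

section
variable {Fq K : Type*} [Field Fq] [Field K] [Algebra Fq K]

/-- `K` is finite over `Fq(s)` for every transcendental `s`, not only for the one in the
definition. -/
theorem IsCurveFunctionField.finiteDimensional_adjoin (hK : IsCurveFunctionField Fq K) {s : K}
    (hs : Transcendental Fq s) : FiniteDimensional (IntermediateField.adjoin Fq {s}) K := by
  obtain ⟨t, ht, hfin⟩ := hK.exists_finite
  have htb : IsTranscendenceBasis Fq (fun _ : Unit => t) := by
    rw [isTranscendenceBasis_iff_algebraicIndependent_isAlgebraic]
    refine ⟨algebraicIndependent_unique_type_iff.2 ht, ?_⟩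
    have h1 : Algebra.IsAlgebraic (IntermediateField.adjoin Fq {t}) K := inferInstance
    rw [Set.range_const]
    exact (IsFractionRing.comap_isAlgebraic_iff (A := Algebra.adjoin Fq {t})
      (K := IntermediateField.adjoin Fq {t}) (C := K)).2 h1
  have hsb : IsTranscendenceBasis Fq (fun _ : Unit => s) := by
    refine AlgebraicIndependent.isTranscendenceBasis_of_lift_trdeg_le_of_finite
      (algebraicIndependent_unique_type_iff.2 hs) ?_
    rw [← htb.lift_cardinalMk_eq_trdeg]
  have halg : Algebra.IsAlgebraic (IntermediateField.adjoin Fq {s}) K := by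
    have := hsb.isAlgebraic_field
    rwa [Set.range_const] at this
  have hess : Algebra.EssFiniteType Fq K := by
    have : Algebra.EssFiniteType Fq (IntermediateField.adjoin Fq {t}) :=
      IntermediateField.essFiniteType_iff.2 ⟨{t}, by simp⟩
    have : Algebra.EssFiniteType (IntermediateField.adjoin Fq {t}) K := inferInstance
    exact Algebra.EssFiniteType.comp Fq (IntermediateField.adjoin Fq {t}) K
  have : Algebra.EssFiniteType (IntermediateField.adjoin Fq {s}) K :=
    Algebra.EssFiniteType.of_comp Fq _ K
  exact Algebra.finite_of_essFiniteType_of_isAlgebraic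

open Polynomial in
/-- Elements of a subalgebra `O` that are linearly independent modulo `s O` over the constants are
linearly independent over the field generated by `s`. -/
theorem linearIndependent_adjoin_of_quotient {s : K} (hs0 : s ≠ 0) (O : Subalgebra Fq K)
    (hsO : s ∈ O) {ι : Type*} (x : ι → K) (hx : ∀ i, x i ∈ O)
    (h : ∀ (S : Finset ι) (c : ι → Fq), (∃ y ∈ O, ∑ i ∈ S, c i • x i = s * y) → ∀ i ∈ S, c i = 0) :
    LinearIndependent (IntermediateField.adjoin Fq {s}) x := by
  refine linearIndependent_of_forall_polynomial s x fun S => ?_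
  have key : ∀ (n : ℕ) (f : ι → Fq[X]), (∀ i ∈ S, (f i).natDegree < n) →
      ∑ i ∈ S, aeval s (f i) * x i = 0 → ∀ i ∈ S, f i = 0 := by
    intro n
    induction n with
    | zero => intro f hf _ i hi; exact absurd (hf i hi) (by simp)
    | succ n ih =>
      intro f hf hsum
      have hdec : ∀ i, aeval s (f i) * x i =
          s * (aeval s (f i).divX * x i) + (f i).coeff 0 • x i := fun i => by
        conv_lhs => rw [← X_mul_divX_add (f i)]
        simp only [map_add, map_mul, aeval_X, aeval_C, Algebra.smul_def]
        ring
      have hsum' : s * ∑ i ∈ S, aeval s (f i).divX * x i + ∑ i ∈ S, (f i).coeff 0 • x i = 0 := by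
        rw [Finset.mul_sum, ← Finset.sum_add_distrib, ← hsum]
        exact Finset.sum_congr rfl fun i _ => (hdec i).symm
      have hc := h S (fun i => (f i).coeff 0) ⟨-∑ i ∈ S, aeval s (f i).divX * x i,
        O.neg_mem (O.sum_mem fun i _ => O.mul_mem
          (Algebra.adjoin_le (Set.singleton_subset_iff.2 hsO)
            (aeval_mem_adjoin_singleton _ _)) (hx i)),
        by linear_combination hsum'⟩
      have hz : ∑ i ∈ S, (f i).coeff 0 • x i = 0 :=
        Finset.sum_eq_zero fun i hi => by rw [hc i hi, zero_smul]
      rw [hz, add_zero, mul_eq_zero, or_iff_right hs0] at hsum'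
      by_cases hn : n = 0
      · intro i hi
        have h0 := hf i hi
        rw [hn, zero_add, Nat.lt_one_iff] at h0
        rw [eq_C_of_natDegree_eq_zero h0, hc i hi, C_0]
      have hd := ih (fun i => (f i).divX) (fun i hi => by
        have := hf i hi
        have h2 := natDegree_divX_eq_natDegree_tsub_one (p := f i)
        omega) hsum'
      intro i hi
      rw [← X_mul_divX_add (f i), hd i hi, hc i hi, C_0, mul_zero, add_zero]
  intro f hf
  exact key (S.sup (fun i => (f i).natDegree) + 1) f
    (fun i hi => Nat.lt_succ_of_le (Finset.le_sup (f := fun i => (f i).natDegree) hi)) hf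

/-- The multiple `c M` of a subgroup `M` of a field. -/
def dilate (c : K) (M : AddSubgroup K) : AddSubgroup K := M.map (AddMonoidHom.mulLeft c)

theorem mem_dilate {c : K} {M : AddSubgroup K} {y : K} :
    y ∈ dilate c M ↔ ∃ m ∈ M, c * m = y := Iff.rfl

theorem mem_dilate_iff_inv_mul_mem {c : K} (hc : c ≠ 0) {M : AddSubgroup K} {y : K} :
    y ∈ dilate c M ↔ c⁻¹ * y ∈ M := by
  rw [mem_dilate]
  constructor
  · rintro ⟨m, hm, rfl⟩
    rwa [inv_mul_cancel_left₀ hc]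
  · exact fun h => ⟨_, h, mul_inv_cancel_left₀ hc y⟩

theorem relIndex_dilate {c : K} (hc : c ≠ 0) (M N : AddSubgroup K) :
    (dilate c M).relIndex (dilate c N) = M.relIndex N :=
  AddSubgroup.relIndex_map_map_of_injective _ _ fun _ _ h => mul_left_cancel₀ hc h

/-- The index of `s O` in a subalgebra `O` containing `s` is at most `q ^ [K : Fq(s)]`. -/
theorem relIndex_smul_subalgebra [Finite Fq] {s : K} (hs0 : s ≠ 0)
    [FiniteDimensional (IntermediateField.adjoin Fq {s}) K]
    (O : Subalgebra Fq K) (hsO : s ∈ O) :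
    (dilate s (Subalgebra.toSubmodule O).toAddSubgroup).relIndex
        (Subalgebra.toSubmodule O).toAddSubgroup ≠ 0 ∧
    (dilate s (Subalgebra.toSubmodule O).toAddSubgroup).relIndex
        (Subalgebra.toSubmodule O).toAddSubgroup ≤
      Nat.card Fq ^ Module.finrank (IntermediateField.adjoin Fq {s}) K := by
  set N := Module.finrank (IntermediateField.adjoin Fq {s}) K
  set M := Subalgebra.toSubmodule O
  let H : Submodule Fq K := M.map (LinearMap.mulLeft Fq s)
  have hH : dilate s M.toAddSubgroup = H.toAddSubgroup := by
    ext y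
    exact Iff.rfl
  have hidx : (dilate s M.toAddSubgroup).relIndex M.toAddSubgroup =
      Nat.card (M ⧸ H.submoduleOf M) := by
    rw [hH]; rfl
  have hrank : Module.rank Fq (M ⧸ H.submoduleOf M) ≤ N := by
    refine rank_le fun S hS => ?_
    have hex : ∀ v : M ⧸ H.submoduleOf M, ∃ m : M, Submodule.Quotient.mk m = v :=
      Submodule.Quotient.mk_surjective _
    choose r hr using hex
    have hli : LinearIndependent (IntermediateField.adjoin Fq {s})
        (fun v : S => ((r v : M) : K)) := by
      refine linearIndependent_adjoin_of_quotient hs0 O hsO _ (fun v => (r v).2) ?_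
      rintro T c ⟨y, hy, hsum⟩
      refine linearIndependent_iff'.1 hS T c ?_
      have : ∑ v ∈ T, c v • (v : M ⧸ H.submoduleOf M) =
          Submodule.Quotient.mk (∑ v ∈ T, c v • r v) := by
        rw [← Submodule.mkQ_apply, map_sum]
        refine Finset.sum_congr rfl fun v _ => ?_
        rw [map_smul, Submodule.mkQ_apply, hr]
      rw [this, Submodule.Quotient.mk_eq_zero]
      change ((∑ v ∈ T, c v • r v : M) : K) ∈ H
      refine ⟨y, hy, ?_⟩
      rw [LinearMap.mulLeft_apply, ← hsum]
      simp
    have := hli.fintype_card_le_finrank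
    simpa using this
  have hfin : Module.Finite Fq (M ⧸ H.submoduleOf M) :=
    Module.rank_lt_aleph0_iff.1 (hrank.trans_lt (Cardinal.natCast_lt_aleph0))
  have : Finite (M ⧸ H.submoduleOf M) := Module.finite_of_finite Fq
  rw [hidx]
  refine ⟨Nat.card_pos.ne', ?_⟩
  rw [Module.natCard_eq_pow_finrank (K := Fq)]
  exact Nat.pow_le_pow_right Nat.card_pos (Module.finrank_le_of_rank_le hrank)

end

end

/-! ### Finite quotients, places and weak approximation -/

section

variable {Fq K : Type*} [Field Fq] [Finite Fq] [Field K] [Algebra Fq K]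

theorem exists_pow_eq_one_of_isAlgebraic {a : K} (ha : IsAlgebraic Fq a) (ha0 : a ≠ 0) :
    ∃ n : ℕ, n ≠ 0 ∧ a ^ n = 1 := by
  have : FiniteDimensional Fq (IntermediateField.adjoin Fq {a}) :=
    IntermediateField.adjoin.finiteDimensional ha.isIntegral
  have : Finite (IntermediateField.adjoin Fq {a}) := Module.finite_of_finite Fq
  have h0 : (⟨a, IntermediateField.mem_adjoin_simple_self Fq a⟩ :
      IntermediateField.adjoin Fq {a}) ≠ 0 := fun h => ha0 (congrArg Subtype.val h)
  have h1 : (Units.mk0 _ h0) ^ Nat.card (IntermediateField.adjoin Fq {a})ˣ = 1 := pow_card_eq_one'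
  refine ⟨Nat.card (IntermediateField.adjoin Fq {a})ˣ, Nat.card_pos.ne', ?_⟩
  have := congrArg (fun z : (IntermediateField.adjoin Fq {a})ˣ =>
    ((z : IntermediateField.adjoin Fq {a}) : K)) h1
  simpa only [Units.val_pow_eq_pow_val, Units.val_mk0, Units.val_one, SubmonoidClass.coe_pow,
    OneMemClass.coe_one] using this

theorem Place.val_eq_one_of_isAlgebraic (P : Place K) {a : K} (ha : IsAlgebraic Fq a)
    (ha0 : a ≠ 0) : P.val a = 1 := by
  obtain ⟨n, hn, h⟩ := exists_pow_eq_one_of_isAlgebraic ha ha0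
  have : (P.val a) ^ n = 1 := by rw [← map_pow, h, map_one]
  exact le_antisymm ((pow_le_one_iff hn).1 this.le) ((one_le_pow_iff hn).1 this.ge)

/-- Every ring between `Fq` and `K` has finite quotients, since `O / s O` has at most
`q ^ [K : Fq(s)]` elements. -/
theorem IsCurveFunctionField.hasFiniteQuotients (hK : IsCurveFunctionField Fq K)
    (O : Subalgebra Fq K) : Ring.HasFiniteQuotients O := by
  refine ⟨fun {I} hI => ?_⟩
  obtain ⟨x, hxI, hx0⟩ := Submodule.exists_mem_ne_zero_of_ne_bot hI
  have hxK : (x : K) ≠ 0 := fun h => hx0 (Subtype.ext h)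
  suffices Finite (O ⧸ Ideal.span {x}) from
    Finite.of_surjective _ (Ideal.Quotient.factor_surjective
      ((Ideal.span_singleton_le_iff_mem I).2 hxI))
  by_cases halg : IsAlgebraic Fq (x : K)
  · obtain ⟨n, hn, h⟩ := exists_pow_eq_one_of_isAlgebraic halg hxK
    have hu : IsUnit x := IsUnit.of_pow_eq_one (n := n) (Subtype.ext (by simpa using h)) hn
    rw [Ideal.span_singleton_eq_top.2 hu]
    infer_instance
  · have := hK.finiteDimensional_adjoin halg
    have h := (relIndex_smul_subalgebra hxK O x.2).1
    have e : Nat.card (O ⧸ Ideal.span {x}) ≠ 0 := by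
      convert h using 1
      change (Submodule.toAddSubgroup (Ideal.span {x})).index = AddSubgroup.index _
      congr 1
      ext y
      change y ∈ Ideal.span {x} ↔ (y : K) ∈ dilate (x : K) _
      rw [Ideal.mem_span_singleton', mem_dilate]
      constructor
      · rintro ⟨a, rfl⟩
        exact ⟨a, a.2, by simp [mul_comm]⟩
      · rintro ⟨m, hm, h⟩
        exact ⟨⟨m, hm⟩, Subtype.ext (by simpa [mul_comm] using h)⟩
    exact Nat.finite_of_card_ne_zero e

/-- A discrete valuation ring of `K` with finite residue field defines a place. -/
theorem exists_place_of_valuationSubring (V : ValuationSubring K) [Ring.HasFiniteQuotients V]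
    (hV : V ≠ ⊤) : ∃ w : Place K, w.val.valuationSubring = V := by
  have : IsPrincipalIdealRing V := inferInstance
  have hfld : ¬ IsField V := by
    intro h
    apply hV
    rw [eq_top_iff]
    intro y _
    by_cases hy : y = 0
    · rw [hy]; exact V.zero_mem
    rcases V.mem_or_inv_mem y with h1 | h1
    · exact h1
    · obtain ⟨z, hz⟩ := h.mul_inv_cancel (a := ⟨y⁻¹, h1⟩)
        (fun h0 => hy (inv_eq_zero.1 (congrArg Subtype.val h0)))
      have hz' : y⁻¹ * (z : K) = 1 := congrArg Subtype.val hz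
      have : (z : K) = y := by field_simp at hz'; exact hz'
      exact this ▸ z.2
  have hm : IsLocalRing.maximalIdeal V ≠ ⊥ := fun h =>
    hfld (IsLocalRing.isField_iff_maximalIdeal_eq.2 h)
  let v : IsDedekindDomain.HeightOneSpectrum V := ⟨IsLocalRing.maximalIdeal V, inferInstance, hm⟩
  have hval : (v.valuation K).valuationSubring = V := by
    ext y
    rw [Valuation.mem_valuationSubring_iff]
    constructor
    · intro hy
      obtain ⟨z, hz⟩ := IsDedekindDomain.HeightOneSpectrum.mem_integers_of_valuation_le_one
        (R := V) K y (fun v' => by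
          have : v' = v := IsDedekindDomain.HeightOneSpectrum.ext
            (IsLocalRing.eq_maximalIdeal v'.isMaximal)
          rwa [this])
      exact hz ▸ z.2
    · intro hy
      exact v.valuation_le_one (⟨y, hy⟩ : V)
  refine ⟨⟨v.valuation K, v.valuation_surjective K, ?_⟩, hval⟩
  rw [hval]
  exact Ring.HasFiniteQuotients.finiteQuotient hm

/-- Every transcendental function `b` has a pole: a valuation ring dominating `Fq[b⁻¹]` at `b⁻¹`
has finite quotients and is therefore discrete. -/
theorem IsCurveFunctionField.exists_place_one_lt (hK : IsCurveFunctionField Fq K) {b : K}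
    (hb : Transcendental Fq b) : ∃ w : Place K, 1 < w.val b := by
  have hb0 : b ≠ 0 := fun h => hb (h ▸ isAlgebraic_zero)
  have hs : Transcendental Fq b⁻¹ := fun h => hb (by simpa using h.inv)
  let A := (Algebra.adjoin Fq {b⁻¹}).toSubring
  have hbA : b⁻¹ ∈ A := Algebra.self_mem_adjoin_singleton Fq b⁻¹
  have hI : Ideal.span {(⟨b⁻¹, hbA⟩ : A)} ≠ ⊤ := by
    rw [Ne, Ideal.span_singleton_eq_top]
    rintro h
    obtain ⟨⟨z, hz⟩, h1⟩ := h.exists_right_inv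
    have hzb : b⁻¹ * z = 1 := congrArg Subtype.val h1
    have hz' : z ∈ (Polynomial.aeval b⁻¹ : Polynomial Fq →ₐ[Fq] K).range :=
        Algebra.adjoin_singleton_eq_range_aeval Fq b⁻¹ ▸ hz
    obtain ⟨f, rfl⟩ := hz'
    refine hs ⟨Polynomial.X * f - 1, ?_, ?_⟩
    · intro h0
      have := congrArg (Polynomial.eval 0) h0
      simp at this
    · change b⁻¹ * Polynomial.aeval b⁻¹ f = 1 at hzb
      simp [hzb]
  obtain ⟨V, hAV, hVn⟩ := Ideal.image_subset_nonunits_valuationSubring _ hI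
  have hbn : b⁻¹ ∈ V.nonunits := hVn ⟨⟨b⁻¹, hbA⟩, Ideal.mem_span_singleton_self _, rfl⟩
  have hbV : b ∉ V := by
    rw [ValuationSubring.mem_nonunits_iff] at hbn
    rw [← ValuationSubring.valuation_le_one_iff, not_le, ← inv_lt_one₀, ← map_inv₀]
    · exact hbn
    · rw [zero_lt_iff]; simpa using hb0
  let O : Subalgebra Fq K := { V.toSubring with
    algebraMap_mem' := fun c => hAV ((Algebra.adjoin Fq {b⁻¹}).algebraMap_mem c) }
  have hO := hK.hasFiniteQuotients O
  have : Ring.HasFiniteQuotients V := ⟨fun {I} hI => hO.finiteQuotient (I := I) hI⟩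
  obtain ⟨w, hw⟩ := exists_place_of_valuationSubring V
    (fun h => hbV (h ▸ ValuationSubring.mem_top b))
  refine ⟨w, ?_⟩
  rw [← hw, Valuation.mem_valuationSubring_iff, not_le] at hbV
  exact hbV

/-- A place is determined by its valuation ring, since the valuation is normalized. -/
theorem Place.ext_of_forall_le_one {P Q : Place K} (h : ∀ a, P.val a ≤ 1 ↔ Q.val a ≤ 1) :
    P = Q := by
  have h1 : ∀ a, P.val a = 1 → Q.val a = 1 := fun a ha => by
    refine le_antisymm ((h a).1 ha.le) ?_
    have ha0 : Q.val a ≠ 0 := by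
      have : P.val a ≠ 0 := by rw [ha]; exact one_ne_zero
      rw [Valuation.ne_zero_iff] at this ⊢
      exact this
    rw [← inv_le_one₀ (zero_lt_iff.2 ha0), ← map_inv₀]
    exact (h _).1 (by rw [map_inv₀, ha, inv_one])
  obtain ⟨t, ht⟩ := P.surjective (WithZero.exp 1)
  have ht0 : t ≠ 0 := by
    rintro rfl
    rw [map_zero] at ht
    exact WithZero.exp_ne_zero ht.symm
  have hQt : Q.val t ≠ 0 := by simpa using ht0
  -- the value of `Q` at an element is determined by the value of `P`
  have key : ∀ a : K, ∀ k : ℤ, P.val a = WithZero.exp k → Q.val a = Q.val t ^ k := by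
    intro a k ha
    have h2 := h1 (a / t ^ k) (by
      rw [map_div₀, map_zpow₀, ha, ht, ← WithZero.exp_zsmul]
      simp)
    rw [map_div₀, map_zpow₀, div_eq_one_iff_eq (zpow_ne_zero _ hQt)] at h2
    exact h2
  have hlt : 1 < Q.val t := by
    rw [← not_le, ← h, ht, not_le, ← WithZero.exp_zero]
    exact WithZero.exp_lt_exp.2 one_pos
  obtain ⟨m, hm⟩ : ∃ m : ℤ, Q.val t = WithZero.exp m := ⟨_, (WithZero.exp_log hQt).symm⟩
  have hm0 : 0 < m := by
    rw [hm, ← WithZero.exp_zero] at hlt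
    exact WithZero.exp_lt_exp.1 hlt
  have hm1 : m = 1 := by
    obtain ⟨r, hr⟩ := Q.surjective (WithZero.exp 1)
    have hr0 : r ≠ 0 := by
      rintro rfl
      rw [map_zero] at hr
      exact WithZero.exp_ne_zero hr.symm
    have hPr : P.val r ≠ 0 := by simpa using hr0
    have := key r (WithZero.log (P.val r)) (WithZero.exp_log hPr).symm
    rw [hr, hm, ← WithZero.exp_zsmul, WithZero.exp_inj] at this
    simp at this
    exact Int.eq_one_of_mul_eq_one_left hm0.le this.symm
  apply Place.ext
  ext a
  by_cases ha : a = 0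
  · simp [ha]
  · have hPa : P.val a ≠ 0 := by simpa using ha
    rw [key a _ (WithZero.exp_log hPa).symm, hm, hm1, ← WithZero.exp_zsmul]
    simp [WithZero.exp_log hPa]

theorem Place.absInf_le_one_iff (P : Place K) (a : K) : P.absInf a ≤ 1 ↔ P.val a ≤ 1 := by
  have h := (WithZeroMulInt.toNNReal_strictMono P.one_lt_residueCard).le_iff_le
    (a := P.val a) (b := 1)
  rw [map_one] at h
  rw [← h, ← NNReal.coe_le_coe]
  rfl

theorem Place.absInf_lt_one_iff (P : Place K) (a : K) : P.absInf a < 1 ↔ P.val a < 1 := by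
  have h := (WithZeroMulInt.toNNReal_strictMono P.one_lt_residueCard).lt_iff_lt
    (a := P.val a) (b := 1)
  rw [map_one] at h
  rw [← h, ← NNReal.coe_lt_coe]
  rfl

theorem Place.exists_one_lt_lt_one (P : Place K) (T : Finset (Place K)) (hT : P ∉ T) :
    ∃ y : K, 1 < P.val y ∧ ∀ w ∈ T, w.val y < 1 := by
  classical
  let ι := {w : Place K // w ∈ insert P T}
  have := AbsoluteValue.exists_one_lt_lt_one_pi_of_not_isEquiv (v := fun w : ι => w.1.absInf)
    (fun w => by
      obtain ⟨a, ha⟩ := w.1.surjective (WithZero.exp 1)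
      have h1 : 1 < w.1.val a := by
        rw [ha, ← WithZero.exp_zero]; exact WithZero.exp_lt_exp.2 one_pos
      refine ⟨a, ?_, ?_⟩
      · rintro rfl; simp at h1
      · intro h
        exact absurd h1 (not_lt.2 ((w.1.absInf_le_one_iff a).1 h.le)))
    (fun w w' hne h => hne (Subtype.ext (Place.ext_of_forall_le_one fun a => by
      rw [← Place.absInf_le_one_iff, ← Place.absInf_le_one_iff]
      exact h.le_one_iff)))
    ⟨P, Finset.mem_insert_self _ _⟩
  obtain ⟨y, hy, hy'⟩ := this
  refine ⟨y, ?_, fun w hw => ?_⟩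
  · rw [← not_le, ← Place.absInf_le_one_iff, not_le]; exact hy
  · rw [← Place.absInf_lt_one_iff]
    exact hy' ⟨w, Finset.mem_insert_of_mem hw⟩ fun h => hT (by
      have : w = P := congrArg Subtype.val h
      rwa [← this])

theorem WithZero.pow_le_exp_neg {z : ℤᵐ⁰} (hz : z < 1) (m : ℕ) :
    z ^ m ≤ WithZero.exp (-(m : ℤ)) := by
  rcases eq_or_ne z 0 with rfl | h0
  · rcases m with _ | m
    · simp
    · simp
  · obtain ⟨k, rfl⟩ : ∃ k : ℤ, z = WithZero.exp k := ⟨_, (WithZero.exp_log h0).symm⟩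
    rw [← WithZero.exp_zero, WithZero.exp_lt_exp] at hz
    rw [← WithZero.exp_nsmul, WithZero.exp_le_exp]
    simp only [nsmul_eq_mul]
    nlinarith [Int.natCast_nonneg m]

/-- Weak approximation: an element close to `0` at the places of `T` and close to `1` at `P`. -/
theorem Place.exists_approx (P : Place K) (T : Finset (Place K)) (hT : P ∉ T) (m : ℕ) :
    ∃ y : K, P.val (1 - y) ≤ WithZero.exp (-(m : ℤ)) ∧
      ∀ w ∈ T, w.val y ≤ WithZero.exp (-(m : ℤ)) := by
  obtain ⟨y, hy, hy'⟩ := P.exists_one_lt_lt_one T hT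
  rcases Nat.eq_zero_or_pos m with rfl | hm
  · exact ⟨1, by simp, fun w _ => by simp⟩
  have hP : P.val (1 + y ^ m) = P.val y ^ m := by
    rw [add_comm, Valuation.map_add_eq_of_lt_left, map_pow]
    rw [map_one, map_pow]
    exact one_lt_pow₀ hy hm.ne'
  have h0 : 1 + y ^ m ≠ 0 := by
    intro h
    rw [h, map_zero] at hP
    exact (pow_pos (zero_lt_one.trans hy) m).ne hP
  refine ⟨y ^ m / (1 + y ^ m), ?_, fun w hw => ?_⟩
  · have : 1 - y ^ m / (1 + y ^ m) = (1 + y ^ m)⁻¹ := by field_simp; ring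
    rw [this, map_inv₀, hP, ← inv_pow]
    exact WithZero.pow_le_exp_neg (inv_lt_one_of_one_lt₀ hy) m
  · have : w.val (1 + y ^ m) = 1 := by
      rw [Valuation.map_add_eq_of_lt_left, map_one]
      rw [map_one, map_pow]
      exact pow_lt_one₀ zero_le (hy' w hw) hm.ne'
    rw [map_div₀, this, div_one, map_pow]
    exact WithZero.pow_le_exp_neg (hy' w hw) m

end

/-! ### Rings of functions regular at finitely many places -/

section

variable {Fq K : Type*} [Field Fq] [Finite Fq] [Field K] [Algebra Fq K]

/-- The functions that are regular at all places of `T`. -/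
def regularAt (T : Set (Place K)) : AddSubgroup K where
  carrier := {a | ∀ w ∈ T, w.val a ≤ 1}
  zero_mem' w _ := by simp
  add_mem' ha hb w hw := (w.val.map_add _ _).trans (max_le (ha w hw) (hb w hw))
  neg_mem' ha w hw := by rw [Valuation.map_neg]; exact ha w hw

variable (Fq) in
/-- The functions that are regular at all places of `T`, as an algebra over the constants. -/
def regularAlgebra (T : Set (Place K)) : Subalgebra Fq K where
  carrier := {a | ∀ w ∈ T, w.val a ≤ 1}
  mul_mem' ha hb w hw := by rw [map_mul]; exact mul_le_one' (ha w hw) (hb w hw)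
  add_mem' ha hb w hw := (w.val.map_add _ _).trans (max_le (ha w hw) (hb w hw))
  algebraMap_mem' c w _ := w.val_algebraMap_le_one c

theorem mem_regularAt {T : Set (Place K)} {a : K} : a ∈ regularAt T ↔ ∀ w ∈ T, w.val a ≤ 1 :=
  Iff.rfl

theorem IsCurveFunctionField.relIndex_dilate_regularAt (hK : IsCurveFunctionField Fq K) {s : K}
    (hs : Transcendental Fq s) {T : Set (Place K)} (hsT : s ∈ regularAt T) :
    (dilate s (regularAt T)).relIndex (regularAt T) ≠ 0 ∧
    (dilate s (regularAt T)).relIndex (regularAt T) ≤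
      Nat.card Fq ^ Module.finrank (IntermediateField.adjoin Fq {s}) K := by
  have := hK.finiteDimensional_adjoin hs
  have hs0 : s ≠ 0 := by
    rintro rfl
    exact hs isAlgebraic_zero
  exact relIndex_smul_subalgebra hs0 (regularAlgebra Fq T) hsT

theorem exists_exp_neg_le {ι : Type*} (T : Finset ι) (c : ι → ℤᵐ⁰) (hc : ∀ w ∈ T, c w ≠ 0) :
    ∃ m : ℕ, ∀ w ∈ T, WithZero.exp (-(m : ℤ)) ≤ c w := by
  refine ⟨T.sup fun w => (WithZero.log (c w)).natAbs, fun w hw => ?_⟩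
  rw [← WithZero.exp_log (hc w hw), WithZero.exp_le_exp]
  have := Finset.le_sup (f := fun w => (WithZero.log (c w)).natAbs) hw
  omega

theorem dilate_le_of_mem {T : Set (Place K)} {s : K} (hs : s ∈ regularAt T) :
    dilate s (regularAt T) ≤ regularAt T := by
  rintro _ ⟨m, hm, rfl⟩ w hw
  change w.val (s * m) ≤ 1
  rw [map_mul]
  exact mul_le_one' (hs w hw) (hm w hw)

theorem mem_dilate_regularAt {T : Set (Place K)} {s : K} (hs0 : s ≠ 0) {a : K} :
    a ∈ dilate s (regularAt T) ↔ ∀ w ∈ T, w.val a ≤ w.val s := by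
  rw [mem_dilate_iff_inv_mul_mem hs0, mem_regularAt]
  refine forall₂_congr fun w _ => ?_
  have : w.val s ≠ 0 := by simpa using hs0
  rw [map_mul, map_inv₀, inv_mul_le_one₀ (zero_lt_iff.2 this)]

/-- The index of `s O` in the ring `O` of functions regular at a finite set of places is
supermultiplicative in the set of places, by weak approximation. -/
theorem relIndex_regularAt_insert (P : Place K) (T : Finset (Place K)) (hT : P ∉ T) {s : K}
    (hs0 : s ≠ 0) (hsT : s ∈ regularAt (T : Set (Place K))) (hsP : s ∈ regularAt {P}) :
    (dilate s (regularAt (insert P (T : Set (Place K))))).relIndex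
        (regularAt (insert P (T : Set (Place K)))) =
      (dilate s (regularAt {P})).relIndex (regularAt {P}) *
      (dilate s (regularAt (T : Set (Place K)))).relIndex (regularAt (T : Set (Place K))) := by
  classical
  set X := regularAt (T : Set (Place K))
  set Y := regularAt ({P} : Set (Place K))
  have hXY : regularAt (insert P (T : Set (Place K))) = X ⊓ Y := by
    ext a
    simp only [AddSubgroup.mem_inf, X, Y, mem_regularAt, Set.forall_mem_insert,
      Set.mem_singleton_iff, forall_eq]
    exact and_comm
  have hsXY : dilate s (X ⊓ Y) = dilate s X ⊓ dilate s Y := by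
    ext a
    simp only [AddSubgroup.mem_inf, mem_dilate_iff_inv_mul_mem hs0]
  have hsX : dilate s X ≤ X := dilate_le_of_mem hsT
  have hsY : dilate s Y ≤ Y := dilate_le_of_mem hsP
  have hval : ∀ w : Place K, w.val s ≠ 0 := fun w => by simpa using hs0
  -- every element of `X` can be changed modulo `s X` so that it becomes regular at `P`
  have h1 : X = dilate s X ⊔ (X ⊓ Y) := by
    refine le_antisymm (fun a ha => ?_) (sup_le hsX inf_le_left)
    have hm0 : max (P.val a) 1 ≠ 0 := (lt_max_of_lt_right zero_lt_one).ne'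
    obtain ⟨m, hm⟩ := exists_exp_neg_le (insert P T)
      (fun w => if w = P then (max (P.val a) 1)⁻¹ else w.val s) (fun w _ => by
        split_ifs
        · exact inv_ne_zero hm0
        · exact hval w)
    obtain ⟨y, hy, hyT⟩ := P.exists_approx T hT m
    have hmP : WithZero.exp (-(m : ℤ)) ≤ (max (P.val a) 1)⁻¹ := by
      simpa using hm P (Finset.mem_insert_self _ _)
    have hmT : ∀ w ∈ T, WithZero.exp (-(m : ℤ)) ≤ w.val s := fun w hw => by
      have := hm w (Finset.mem_insert_of_mem hw)
      have hne : w ≠ P := by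
        rintro rfl
        exact hT hw
      rwa [if_neg hne] at this
    have hay : a * y ∈ dilate s X := by
      rw [mem_dilate_regularAt hs0]
      intro w hw
      rw [map_mul]
      calc w.val a * w.val y ≤ 1 * w.val y := by gcongr; exact ha w hw
        _ ≤ w.val s := by rw [one_mul]; exact (hyT w hw).trans (hmT w hw)
    have : a = a * y + a * (1 - y) := by ring
    rw [this]
    refine AddSubgroup.add_mem_sup hay ⟨?_, ?_⟩
    · have h2 : a * (1 - y) = a - a * y := by ring
      rw [h2]
      exact X.sub_mem ha (hsX hay)
    · rintro w rfl
      rw [map_mul]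
      calc w.val a * w.val (1 - y) ≤ max (w.val a) 1 * (max (w.val a) 1)⁻¹ := by
            gcongr
            · exact le_max_left _ _
            · exact hy.trans hmP
        _ = 1 := mul_inv_cancel₀ hm0
  -- every element of `Y` can be changed modulo `s Y` so that it becomes an element of `s X`
  have h2 : Y = dilate s Y ⊔ (dilate s X ⊓ Y) := by
    refine le_antisymm (fun b hb => ?_) (sup_le hsY inf_le_right)
    have hm0 : ∀ w : Place K, max (w.val b) 1 ≠ 0 := fun w => (lt_max_of_lt_right zero_lt_one).ne'
    obtain ⟨m, hm⟩ := exists_exp_neg_le (insert P T)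
      (fun w => w.val s * (max (w.val b) 1)⁻¹)
      (fun w _ => mul_ne_zero (hval w) (inv_ne_zero (hm0 w)))
    obtain ⟨y, hy, hyT⟩ := P.exists_approx T hT m
    have hmP := hm P (Finset.mem_insert_self _ _)
    have key : ∀ w : Place K, ∀ z : ℤᵐ⁰, z ≤ w.val s * (max (w.val b) 1)⁻¹ →
        w.val b * z ≤ w.val s := fun w z hz => by
      calc w.val b * z ≤ max (w.val b) 1 * (w.val s * (max (w.val b) 1)⁻¹) := by
            gcongr
            exact le_max_left _ _
        _ = w.val s := by rw [mul_left_comm, mul_inv_cancel₀ (hm0 w), mul_one]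
    have hby : b * (1 - y) ∈ dilate s Y := by
      rw [mem_dilate_regularAt hs0]
      rintro w rfl
      rw [map_mul]
      exact key w _ (hy.trans hmP)
    have : b = b * (1 - y) + b * y := by ring
    rw [this]
    refine AddSubgroup.add_mem_sup hby ⟨?_, ?_⟩
    · change b * y ∈ dilate s X
      rw [mem_dilate_regularAt hs0]
      intro w hw
      rw [map_mul]
      exact key w _ ((hyT w hw).trans (hm w (Finset.mem_insert_of_mem hw)))
    · have h3 : b * y = b - b * (1 - y) := by ring
      rw [h3]
      exact Y.sub_mem hb (hsY hby)
  rw [hXY, hsXY, ← AddSubgroup.relIndex_mul_relIndex (dilate s X ⊓ dilate s Y) (dilate s X ⊓ Y)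
    (X ⊓ Y) (inf_le_inf_left _ hsY) (inf_le_inf_right _ hsX)]
  congr 1
  · have : dilate s X ⊓ dilate s Y = dilate s Y ⊓ (dilate s X ⊓ Y) := by
      rw [inf_left_comm, inf_eq_left.2 hsY]
    rw [this, AddSubgroup.inf_relIndex_right]
    have h3 := AddSubgroup.relIndex_sup_left (dilate s X ⊓ Y) (dilate s Y)
    rwa [← h2, eq_comm] at h3
  · have : dilate s X ⊓ Y = dilate s X ⊓ (X ⊓ Y) := by
      rw [← inf_assoc, inf_eq_left.2 hsX]
    rw [this, AddSubgroup.inf_relIndex_right]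
    have h3 := AddSubgroup.relIndex_sup_left (X ⊓ Y) (dilate s X)
    rwa [← h1, eq_comm] at h3

/-- An element of `K` has only finitely many poles. -/
theorem IsCurveFunctionField.finite_poles (hK : IsCurveFunctionField Fq K) (b : K) :
    {w : Place K | 1 < w.val b}.Finite := by
  classical
  by_cases hb : IsAlgebraic Fq b
  · convert Set.finite_empty (α := Place K)
    rw [Set.eq_empty_iff_forall_notMem]
    rintro w (hw : 1 < w.val b)
    by_cases hb0 : b = 0
    · simp [hb0] at hw
    · rw [w.val_eq_one_of_isAlgebraic hb hb0] at hw
      exact lt_irrefl _ hw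
  have hb0 : b ≠ 0 := fun h => hb (h ▸ isAlgebraic_zero)
  have hs : Transcendental Fq b⁻¹ := fun h => hb (by simpa using h.inv)
  have hlt : ∀ w : Place K, 1 < w.val b → w.val b⁻¹ < 1 := fun w hw => by
    rw [map_inv₀]; exact inv_lt_one_of_one_lt₀ hw
  have key : ∀ T : Finset (Place K), (∀ w ∈ T, 1 < w.val b) →
      2 ^ T.card ≤ (dilate b⁻¹ (regularAt (T : Set (Place K)))).relIndex
        (regularAt (T : Set (Place K))) := by
    intro T
    induction T using Finset.induction_on with
    | empty =>
      intro _
      exact Nat.one_le_iff_ne_zero.2 (hK.relIndex_dilate_regularAt hs (by simp [mem_regularAt])).1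
    | insert P T hP ih =>
      intro h
      have hP1 := h P (Finset.mem_insert_self _ _)
      have hsP : b⁻¹ ∈ regularAt {P} := by
        rintro w rfl
        exact (hlt w hP1).le
      rw [Finset.card_insert_of_notMem hP, pow_succ', Finset.coe_insert,
        relIndex_regularAt_insert P T hP (inv_ne_zero hb0)
          (fun w hw => (hlt w (h w (Finset.mem_insert_of_mem hw))).le) hsP]
      refine Nat.mul_le_mul ?_ (ih fun w hw => h w (Finset.mem_insert_of_mem hw))
      have h0 := (hK.relIndex_dilate_regularAt hs hsP).1
      have h1 : (dilate b⁻¹ (regularAt {P})).relIndex (regularAt {P}) ≠ 1 := by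
        rw [Ne, AddSubgroup.relIndex_eq_one]
        intro hle
        have := hle (show (1 : K) ∈ regularAt {P} from fun w _ => by simp)
        rw [mem_dilate_regularAt (inv_ne_zero hb0)] at this
        have := this P rfl
        rw [map_one] at this
        exact absurd (hlt P hP1) (not_lt.2 this)
      omega
  by_contra hinf
  obtain ⟨T, hT, hcard⟩ := Set.Infinite.exists_subset_card_eq hinf
    (Nat.card Fq ^ Module.finrank (IntermediateField.adjoin Fq {b⁻¹}) K)
  have h1 := key T (fun w hw => hT hw)
  have h2 := (hK.relIndex_dilate_regularAt hs (T := (T : Set (Place K)))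
    (fun w hw => (hlt w (hT hw)).le)).2
  rw [← hcard] at h2
  exact absurd (h1.trans h2) (not_le.2 Nat.lt_two_pow_self)

/-- The functions with a pole of order at most `n` at `P`. -/
def Place.ball (P : Place K) (n : ℤ) : AddSubgroup K where
  carrier := {a | P.val a ≤ WithZero.exp n}
  zero_mem' := by simp
  add_mem' ha hb := (P.val.map_add _ _).trans (max_le ha hb)
  neg_mem' ha := by simpa using ha

theorem Place.mem_ball {P : Place K} {n : ℤ} {a : K} : a ∈ P.ball n ↔ P.val a ≤ WithZero.exp n :=
  Iff.rfl

theorem Place.ball_mono (P : Place K) {m n : ℤ} (h : m ≤ n) : P.ball m ≤ P.ball n :=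
  fun _ ha => (Place.mem_ball.1 ha).trans (WithZero.exp_le_exp.2 h)

theorem Place.dilate_ball {P : Place K} {a : K} {k : ℤ} (ha : P.val a = WithZero.exp k) (n : ℤ) :
    dilate a (P.ball n) = P.ball (n + k) := by
  have h0 : a ≠ 0 := by
    rintro rfl
    rw [map_zero] at ha
    exact WithZero.exp_ne_zero ha.symm
  ext b
  rw [mem_dilate_iff_inv_mul_mem h0, mem_ball, mem_ball, map_mul, map_inv₀, ha,
    inv_mul_le_iff₀ (WithZero.exp_pos), ← WithZero.exp_add, add_comm]

theorem WithZero.lt_one_iff_le_exp_neg_one {z : ℤᵐ⁰} : z < 1 ↔ z ≤ WithZero.exp (-1) := by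
  rcases eq_or_ne z 0 with rfl | h0
  · simp
  · rw [← WithZero.exp_log h0, ← WithZero.exp_zero, WithZero.exp_lt_exp, WithZero.exp_le_exp]
    omega

theorem Place.relIndex_ball_zero (P : Place K) :
    (P.ball (-1)).relIndex (P.ball 0) = P.residueCard := by
  have hmem : ∀ a : P.ball 0, (a : K) ∈ P.val.valuationSubring := fun a => by
    have := a.2
    rwa [Place.mem_ball, WithZero.exp_zero] at this
  let f : P.ball 0 →+ IsLocalRing.ResidueField P.val.valuationSubring :=
    { toFun := fun a => IsLocalRing.residue _ (⟨a, hmem a⟩ : P.val.valuationSubring)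
      map_zero' := map_zero _
      map_add' := fun a b => by rw [← map_add]; rfl }
  have hker : (P.ball (-1)).addSubgroupOf (P.ball 0) = f.ker := by
    ext a
    rw [AddSubgroup.mem_addSubgroupOf, AddMonoidHom.mem_ker]
    change _ ↔ IsLocalRing.residue _ (⟨a, hmem a⟩ : P.val.valuationSubring) = 0
    rw [IsLocalRing.residue_eq_zero_iff, Valuation.mem_maximalIdeal_iff,
      WithZero.lt_one_iff_le_exp_neg_one]
    rfl
  have hsurj : f.range = ⊤ := by
    rw [AddMonoidHom.range_eq_top]
    intro z
    obtain ⟨y, rfl⟩ := IsLocalRing.residue_surjective z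
    exact ⟨⟨y, by rw [Place.mem_ball, WithZero.exp_zero]; exact y.2⟩, rfl⟩
  rw [AddSubgroup.relIndex, hker, AddSubgroup.index_ker, hsurj]
  exact Nat.card_congr AddSubgroup.topEquiv.toEquiv

end

/-! ### Riemann's inequality for the multiples of a place -/

section

open scoped IntermediateField.algebraAdjoinAdjoin

variable {Fq K : Type*} [Field Fq] [Finite Fq] [Field K] [Algebra Fq K]

theorem Place.transcendental_of_val_ne_one (P : Place K) {a : K} (ha0 : a ≠ 0)
    (ha : P.val a ≠ 1) : Transcendental Fq a :=
  fun h => ha (P.val_eq_one_of_isAlgebraic h ha0)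

open Polynomial in
theorem Place.val_aeval_le_one (w : Place K) {t : K} (ht : w.val t ≤ 1) (f : Fq[X]) :
    w.val (aeval t f) ≤ 1 := by
  have : aeval t f ∈ regularAlgebra Fq {w} :=
    Algebra.adjoin_le (S := regularAlgebra Fq {w})
      (Set.singleton_subset_iff.2 (by rintro w' rfl; exact ht)) (aeval_mem_adjoin_singleton _ _)
  exact this w rfl

open Polynomial in
theorem Place.val_aeval_le_pow (w : Place K) {t : K} (ht : 1 ≤ w.val t) {f : Fq[X]} {m : ℕ}
    (hf : f.natDegree ≤ m) : w.val (aeval t f) ≤ w.val t ^ m := by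
  rw [aeval_eq_sum_range]
  refine Valuation.map_sum_le _ fun i hi => ?_
  rw [Algebra.smul_def, map_mul, map_pow]
  refine (mul_le_of_le_one_left' (w.val_algebraMap_le_one _)).trans (pow_le_pow_right₀ ht ?_)
  exact (Nat.lt_succ_iff.1 (Finset.mem_range.1 hi)).trans hf

/-- Valuation rings are integrally closed. -/
theorem Place.val_le_one_of_isIntegral (w : Place K) {t z : K} (ht : w.val t ≤ 1)
    (hz : IsIntegral (Algebra.adjoin Fq {t}) z) : w.val z ≤ 1 := by
  let f : Algebra.adjoin Fq {t} →+* w.val.integer :=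
    { toFun := fun y => ⟨y, by
        have h2 : (y : K) ∈ (Polynomial.aeval t : Polynomial Fq →ₐ[Fq] K).range :=
          Algebra.adjoin_singleton_eq_range_aeval Fq t ▸ y.2
        obtain ⟨g, hg⟩ := h2
        rw [Valuation.mem_integer_iff, ← hg]
        exact w.val_aeval_le_one ht g⟩
      map_one' := rfl
      map_mul' := fun _ _ => rfl
      map_zero' := rfl
      map_add' := fun _ _ => rfl }
  have h := hz.map_of_comp_eq f (RingHom.id K) rfl
  exact Valuation.Integers.mem_of_integral (Valuation.integer.integers w.val) h

/-- A basis of `K` over `Fq(t)` whose members have poles only at the poles of `t`. -/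
theorem IsCurveFunctionField.exists_basis_regular (hK : IsCurveFunctionField Fq K) {t : K}
    (ht : Transcendental Fq t) :
    ∃ y : Fin (Module.finrank (IntermediateField.adjoin Fq {t}) K) → K,
      LinearIndependent (IntermediateField.adjoin Fq {t}) y ∧
      ∀ i (w : Place K), w.val t ≤ 1 → w.val (y i) ≤ 1 := by
  classical
  have := hK.finiteDimensional_adjoin ht
  let b := Module.finBasis (IntermediateField.adjoin Fq {t}) K
  have hdom : IsDomain (Algebra.adjoin Fq {t}) := inferInstance
  have : FaithfulSMul (Algebra.adjoin Fq {t}) K := inferInstance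
  obtain ⟨d, hd, hint⟩ := exists_integral_multiples (Algebra.adjoin Fq {t})
    (IntermediateField.adjoin Fq {t}) (L := K) (Finset.univ.image b)
  have hd0 : (d : K) ≠ 0 := fun h => hd (Subtype.ext h)
  refine ⟨fun i => (d : K) * b i, ?_, fun i w hw => ?_⟩
  · have := b.linearIndependent.map' (LinearMap.mulLeft (IntermediateField.adjoin Fq {t}) (d : K))
      (LinearMap.ker_eq_bot.2 fun _ _ h => mul_left_cancel₀ hd0 h)
    exact this
  · exact w.val_le_one_of_isIntegral hw (hint _ (Finset.mem_image_of_mem _ (Finset.mem_univ i)))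

/-- The functions without poles outside `P`, as an additive group. -/
def Place.affine (P : Place K) : AddSubgroup K := regularAt {P}ᶜ

/-- The functions with a pole of order at most `n` at `P` and no other poles. -/
def Place.sections (P : Place K) (n : ℤ) : AddSubgroup K := P.affine ⊓ P.ball n

/-- A function without poles that vanishes at `P` is zero. -/
theorem IsCurveFunctionField.eq_zero_of_mem_affine (hK : IsCurveFunctionField Fq K) {P : Place K}
    {a : K} (ha : a ∈ P.affine) (h : P.val a < 1) : a = 0 := by
  by_contra h0
  obtain ⟨w, hw⟩ := hK.exists_place_one_lt (P.transcendental_of_val_ne_one h0 h.ne)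
  by_cases hwP : w = P
  · subst hwP
    exact absurd hw (not_lt.2 h.le)
  · exact absurd hw (not_lt.2 (ha w hwP))

theorem Place.exists_val_eq_exp (P : Place K) (n : ℤ) :
    ∃ t : K, t ≠ 0 ∧ P.val t = WithZero.exp n := by
  obtain ⟨t, ht⟩ := P.surjective (WithZero.exp n)
  refine ⟨t, ?_, ht⟩
  rintro rfl
  rw [map_zero] at ht
  exact WithZero.exp_ne_zero ht.symm

theorem Place.relIndex_ball (P : Place K) (n : ℤ) :
    (P.ball (n - 1)).relIndex (P.ball n) = P.residueCard := by
  obtain ⟨t, ht0, ht⟩ := P.exists_val_eq_exp n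
  rw [← P.relIndex_ball_zero, ← relIndex_dilate ht0 (P.ball (-1)), Place.dilate_ball ht,
    Place.dilate_ball ht, zero_add, neg_add_eq_sub]

theorem Place.residueCard_pos (P : Place K) : 0 < P.residueCard := by
  have := P.one_lt_residueCard
  exact_mod_cast zero_lt_one.trans this

/-- The upper bound in Riemann's theorem: each additional pole order at `P` increases the dimension
by at most the degree of `P`. -/
theorem IsCurveFunctionField.card_sections (hK : IsCurveFunctionField Fq K) (P : Place K) (n : ℕ) :
    Nat.card (P.sections n) ≠ 0 ∧ Nat.card (P.sections n) ≤ P.residueCard ^ (n + 1) := by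
  have hstep : ∀ m : ℤ, (P.sections (m - 1)).relIndex (P.sections m) ≠ 0 ∧
      (P.sections (m - 1)).relIndex (P.sections m) ≤ P.residueCard := by
    intro m
    have h1 : P.sections (m - 1) = P.ball (m - 1) ⊓ P.sections m := by
      rw [Place.sections, Place.sections, inf_left_comm,
        inf_eq_left.2 (P.ball_mono (sub_one_lt m).le)]
    have hne : (P.ball (m - 1)).relIndex (P.ball m) ≠ 0 := by
      rw [P.relIndex_ball]; exact P.residueCard_pos.ne'
    rw [h1, AddSubgroup.inf_relIndex_right]
    constructor
    · exact fun h => hne (AddSubgroup.relIndex_eq_zero_of_le_right inf_le_right h)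
    · rw [← P.relIndex_ball m]
      exact AddSubgroup.relIndex_le_of_le_right inf_le_right hne
  have hbot : P.sections (-1) = ⊥ := by
    rw [eq_bot_iff]
    rintro a ⟨ha, hb⟩
    exact hK.eq_zero_of_mem_affine ha (WithZero.lt_one_iff_le_exp_neg_one.2 hb)
  have hmono : ∀ m : ℤ, P.sections (m - 1) ≤ P.sections m := fun m =>
    inf_le_inf_left _ (P.ball_mono (sub_one_lt m).le)
  have key : ∀ n : ℕ, (⊥ : AddSubgroup K).relIndex (P.sections n) ≠ 0 ∧
      (⊥ : AddSubgroup K).relIndex (P.sections n) ≤ P.residueCard ^ (n + 1) := by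
    intro n
    induction n with
    | zero =>
      have := hstep 0
      rw [zero_sub, hbot] at this
      simpa using this
    | succ n ih =>
      have := hstep ((n + 1 : ℕ) : ℤ)
      have hc : ((n + 1 : ℕ) : ℤ) - 1 = n := by push_cast; ring
      have hm := hmono ((n + 1 : ℕ) : ℤ)
      rw [hc] at this hm
      rw [← AddSubgroup.relIndex_mul_relIndex ⊥ _ _ bot_le hm]
      refine ⟨mul_ne_zero ih.1 this.1, ?_⟩
      rw [pow_succ]
      exact Nat.mul_le_mul ih.2 this.2
  simpa only [AddSubgroup.relIndex_bot_left] using key n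

open Polynomial in
/-- The map `(fᵢ) ↦ ∑ fᵢ(t) yᵢ` on families of polynomials of degree less than `m`. -/
def polyCombination (t : K) {N : ℕ} (y : Fin N → K) (m : ℕ) :
    (Fin N → degreeLT Fq m) →ₗ[Fq] K :=
  ∑ i, (LinearMap.mulRight Fq (y i)) ∘ₗ (aeval (R := Fq) t).toLinearMap ∘ₗ
    (degreeLT Fq m).subtype ∘ₗ LinearMap.proj i

omit [Finite Fq] in
open Polynomial in
theorem polyCombination_apply (t : K) {N : ℕ} (y : Fin N → K) (m : ℕ)
    (f : Fin N → degreeLT Fq m) :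
    polyCombination t y m f = ∑ i, aeval t (f i : Fq[X]) * y i := by
  simp [polyCombination]

omit [Finite Fq] in
open Polynomial in
theorem card_range_polyCombination {t : K} (ht : Transcendental Fq t) {N : ℕ} {y : Fin N → K}
    (hy : LinearIndependent (IntermediateField.adjoin Fq {t}) y) (m : ℕ) :
    Nat.card (LinearMap.range (polyCombination (Fq := Fq) t y m)) = Nat.card Fq ^ (N * m) := by
  have hinj : Function.Injective (polyCombination (Fq := Fq) t y m) := by
    rw [← LinearMap.ker_eq_bot, LinearMap.ker_eq_bot']
    intro f hf
    rw [polyCombination_apply] at hf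
    have hmem : ∀ i, aeval t (f i : Fq[X]) ∈ IntermediateField.adjoin Fq {t} := fun i =>
      IntermediateField.algebra_adjoin_le_adjoin Fq {t} (aeval_mem_adjoin_singleton _ _)
    have h := Fintype.linearIndependent_iff.1 hy (fun i => ⟨_, hmem i⟩) hf
    ext1 i
    have h2 : aeval t (f i : Fq[X]) = 0 := congrArg Subtype.val (h i)
    exact Subtype.ext ((transcendental_iff.1 ht) _ h2)
  rw [Nat.card_congr (LinearEquiv.ofInjective _ hinj).symm.toEquiv,
    Nat.card_fun, Nat.card_congr (degreeLTEquiv Fq m).toEquiv, Nat.card_fun, ← pow_mul]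
  simp [mul_comm]

open Polynomial in
/-- Riemann's inequality for the multiples of a place: the functions with a pole of order at most
`n` at `P` and no other poles form a space of dimension at least `n d - c`. -/
theorem IsCurveFunctionField.exists_le_card_sections (hK : IsCurveFunctionField Fq K)
    (P : Place K) :
    ∃ c : ℕ, ∀ n : ℕ, P.residueCard ^ n ≤ c * Nat.card (P.sections n) := by
  classical
  obtain ⟨t, ht0, htP⟩ := P.exists_val_eq_exp 1
  have htr : Transcendental Fq t := P.transcendental_of_val_ne_one ht0 (by
    rw [htP, ← WithZero.exp_zero, Ne, WithZero.exp_inj]; exact one_ne_zero)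
  have hs : Transcendental Fq t⁻¹ := fun h => htr (by simpa using h.inv)
  have hP1 : 1 < P.val t := by
    rw [htP, ← WithZero.exp_zero]; exact WithZero.exp_lt_exp.2 one_pos
  have hfield : IntermediateField.adjoin Fq {t⁻¹} = IntermediateField.adjoin Fq {t} := by
    apply le_antisymm <;> rw [IntermediateField.adjoin_simple_le_iff]
    · exact inv_mem (IntermediateField.mem_adjoin_simple_self Fq t)
    · simpa using inv_mem (IntermediateField.mem_adjoin_simple_self Fq t⁻¹)
  obtain ⟨N, hN, y, hy, hyreg⟩ : ∃ N, N = Module.finrank (IntermediateField.adjoin Fq {t}) K ∧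
      ∃ y : Fin N → K, LinearIndependent (IntermediateField.adjoin Fq {t}) y ∧
        ∀ i (w : Place K), w.val t ≤ 1 → w.val (y i) ≤ 1 :=
    ⟨_, rfl, hK.exists_basis_regular htr⟩
  -- the poles of `t` different from `P`
  set T : Finset (Place K) := (hK.finite_poles t).toFinset.erase P with hTdef
  have hT : ∀ w, w ∈ T ↔ w ≠ P ∧ 1 < w.val t := fun w => by
    simp [hTdef]
  have hPT : P ∉ T := fun h => ((hT P).1 h).1 rfl
  have hinv : ∀ w : Place K, 1 < w.val t → w.val t⁻¹ ≤ 1 := fun w hw => by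
    rw [map_inv₀]; exact (inv_lt_one_of_one_lt₀ hw).le
  have hsT : t⁻¹ ∈ regularAt (T : Set (Place K)) := fun w hw => hinv w ((hT w).1 hw).2
  have hsP : t⁻¹ ∈ regularAt {P} := by
    rintro w rfl
    exact hinv w hP1
  set O := regularAt (T : Set (Place K)) with hO
  set B := (dilate t⁻¹ O).relIndex O with hB
  set Q := P.residueCard with hQ
  have hB0 : B ≠ 0 := (hK.relIndex_dilate_regularAt hs hsT).1
  -- the fundamental inequality, by comparison with the place `P`
  have hBQ : Q * B ≤ Nat.card Fq ^ N := by
    have h1 := (hK.relIndex_dilate_regularAt hs (T := insert P (T : Set (Place K))) (by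
      rintro w (rfl | hw)
      · exact hinv w hP1
      · exact hsT w hw)).2
    rw [relIndex_regularAt_insert P T hPT (inv_ne_zero ht0) hsT hsP, hfield, ← hN] at h1
    have h2 : (dilate t⁻¹ (regularAt {P})).relIndex (regularAt {P}) = Q := by
      have h3 : regularAt {P} = P.ball 0 := by
        ext a
        simp [mem_regularAt, Place.mem_ball]
      rw [h3, Place.dilate_ball (k := -1) (by rw [map_inv₀, htP, WithZero.exp_neg]), zero_add,
        P.relIndex_ball_zero]
    rwa [h2] at h1
  -- the chain `O ⊆ t O ⊆ t² O ⊆ ...`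
  have hmono1 : ∀ n : ℕ, dilate (t ^ n) O ≤ dilate (t ^ (n + 1)) O := fun n a ha => by
    rw [mem_dilate_regularAt (pow_ne_zero _ ht0)] at ha ⊢
    intro w hw
    refine (ha w hw).trans ?_
    rw [map_pow, map_pow]
    exact pow_le_pow_right₀ ((hT w).1 hw).2.le (Nat.le_succ n)
  have hchain : ∀ n : ℕ, O ≤ dilate (t ^ n) O ∧ O.relIndex (dilate (t ^ n) O) = B ^ n := by
    intro n
    induction n with
    | zero =>
      have : dilate (t ^ 0) O = O := by
        ext a
        rw [pow_zero, mem_dilate_iff_inv_mul_mem one_ne_zero, inv_one, one_mul]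
      rw [this, AddSubgroup.relIndex_self, pow_zero]
      exact ⟨le_rfl, rfl⟩
    | succ n ih =>
      refine ⟨ih.1.trans (hmono1 n), ?_⟩
      rw [← AddSubgroup.relIndex_mul_relIndex O _ _ ih.1 (hmono1 n), ih.2, pow_succ B]
      congr 1
      have h4 : dilate (t ^ n) O = dilate (t ^ (n + 1)) (dilate t⁻¹ O) := by
        ext a
        rw [mem_dilate_iff_inv_mul_mem (pow_ne_zero _ ht0),
          mem_dilate_iff_inv_mul_mem (pow_ne_zero _ ht0),
          mem_dilate_iff_inv_mul_mem (inv_ne_zero ht0)]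
        have : t⁻¹⁻¹ * ((t ^ (n + 1))⁻¹ * a) = (t ^ n)⁻¹ * a := by
          field_simp
          ring
        rw [this]
      rw [h4, relIndex_dilate (pow_ne_zero _ ht0)]
  -- a bound for the poles of the basis
  obtain ⟨k, hk⟩ : ∃ k : ℕ, ∀ i, ∀ w ∈ insert P T, w.val (y i) ≤ w.val t ^ k := by
    have hlt : ∀ w ∈ insert P T, 1 < w.val t := fun w hw => by
      rcases Finset.mem_insert.1 hw with rfl | hw
      · exact hP1
      · exact ((hT w).1 hw).2
    have h1 : ∀ i, ∀ w : Place K, ∃ k : ℕ, 1 < w.val t → w.val (y i) ≤ w.val t ^ k := fun i w => by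
      by_cases h : 1 < w.val t
      · obtain ⟨k, hk⟩ := MulArchimedean.arch (w.val (y i)) h
        exact ⟨k, fun _ => hk⟩
      · exact ⟨0, fun h' => absurd h' h⟩
    choose κ hκ using h1
    refine ⟨Finset.univ.sup fun i => (insert P T).sup (κ i), fun i w hw => ?_⟩
    refine (hκ i w (hlt w hw)).trans (pow_le_pow_right₀ (hlt w hw).le ?_)
    exact (Finset.le_sup (f := κ i) hw).trans
      (Finset.le_sup (f := fun i => (insert P T).sup (κ i)) (Finset.mem_univ i))
  have hpole : ∀ (m : ℕ) (a : K), a ∈ LinearMap.range (polyCombination (Fq := Fq) t y m) →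
      (∀ w : Place K, w.val t ≤ 1 → w.val a ≤ 1) ∧
      ∀ w ∈ insert P T, w.val a ≤ w.val t ^ (m + k) := by
    intro m a ha
    obtain ⟨f, rfl⟩ := ha
    rw [polyCombination_apply]
    refine ⟨fun w hw => Valuation.map_sum_le _ fun i _ => ?_,
      fun w hw => Valuation.map_sum_le _ fun i _ => ?_⟩
    · rw [map_mul]
      exact mul_le_one' (w.val_aeval_le_one hw _) (hyreg i w hw)
    · rw [map_mul, pow_add]
      refine mul_le_mul' (w.val_aeval_le_pow ?_ ?_) (hk i w hw)
      · rcases Finset.mem_insert.1 hw with rfl | hw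
        · exact hP1.le
        · exact ((hT w).1 hw).2.le
      · exact natDegree_le_of_degree_le (mem_degreeLT.1 (f i).2).le
  have hmain : ∀ m : ℕ, Q ^ m ≤ B ^ k * Nat.card (P.sections ((m + k : ℕ) : ℤ)) := by
    intro m
    set G := (LinearMap.range (polyCombination (Fq := Fq) t y m)).toAddSubgroup with hG
    have hcard : Nat.card G = Nat.card Fq ^ (N * m) := card_range_polyCombination htr hy m
    have hGO : G ≤ dilate (t ^ (m + k)) O := fun a ha => by
      rw [mem_dilate_regularAt (pow_ne_zero _ ht0)]
      intro w hw
      rw [map_pow]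
      exact (hpole m a ha).2 w (Finset.mem_insert_of_mem hw)
    have hsec : O ⊓ G ≤ P.sections ((m + k : ℕ) : ℤ) := by
      rintro a ⟨haO, haG⟩
      refine ⟨fun w hw => ?_, ?_⟩
      · by_cases h1 : 1 < w.val t
        · exact haO w ((hT w).2 ⟨hw, h1⟩)
        · exact (hpole m a haG).1 w (not_lt.1 h1)
      · have := (hpole m a haG).2 P (Finset.mem_insert_self _ _)
        rw [htP, ← WithZero.exp_nsmul] at this
        rwa [nsmul_one] at this
    have h1 : Nat.card G = Nat.card (O ⊓ G : AddSubgroup K) * O.relIndex G := by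
      rw [← AddSubgroup.relIndex_bot_left, ← AddSubgroup.relIndex_bot_left,
        ← AddSubgroup.inf_relIndex_right O G,
        AddSubgroup.relIndex_mul_relIndex _ _ _ bot_le inf_le_right]
    have h2 : O.relIndex G ≤ B ^ (m + k) := by
      rw [← (hchain (m + k)).2]
      refine AddSubgroup.relIndex_le_of_le_right hGO ?_
      rw [(hchain (m + k)).2]
      exact pow_ne_zero _ hB0
    have h3 : Nat.card (O ⊓ G : AddSubgroup K) ≤ Nat.card (P.sections ((m + k : ℕ) : ℤ)) := by
      have : Finite (P.sections ((m + k : ℕ) : ℤ)) :=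
        Nat.finite_of_card_ne_zero (hK.card_sections P (m + k)).1
      exact Nat.card_mono (Set.toFinite _) hsec
    have h4 : (Q * B) ^ m ≤ Nat.card (P.sections ((m + k : ℕ) : ℤ)) * B ^ (m + k) := by
      calc (Q * B) ^ m ≤ (Nat.card Fq ^ N) ^ m := Nat.pow_le_pow_left hBQ m
        _ = Nat.card G := by rw [hcard, pow_mul]
        _ ≤ _ := by rw [h1]; exact Nat.mul_le_mul h3 h2
    have hBm : 0 < B ^ m := pow_pos (Nat.pos_of_ne_zero hB0) m
    refine Nat.le_of_mul_le_mul_right ?_ hBm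
    calc Q ^ m * B ^ m = (Q * B) ^ m := (mul_pow _ _ _).symm
      _ ≤ _ := h4
      _ = _ := by ring
  refine ⟨Q ^ k * B ^ k, fun n => ?_⟩
  rcases le_total k n with h | h
  · obtain ⟨m, rfl⟩ := Nat.exists_eq_add_of_le' h
    calc Q ^ (m + k) = Q ^ k * Q ^ m := by ring
      _ ≤ Q ^ k * (B ^ k * Nat.card (P.sections ((m + k : ℕ) : ℤ))) :=
        Nat.mul_le_mul_left _ (hmain m)
      _ = _ := by ring
  · have h1 : Q ^ n ≤ Q ^ k := Nat.pow_le_pow_right P.residueCard_pos h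
    have h2 : 1 ≤ B ^ k := Nat.one_le_pow _ _ (Nat.pos_of_ne_zero hB0)
    have h3 : 1 ≤ Nat.card (P.sections n) :=
      Nat.one_le_iff_ne_zero.2 (hK.card_sections P n).1
    calc Q ^ n ≤ Q ^ k := h1
      _ = Q ^ k * 1 * 1 := by ring
      _ ≤ Q ^ k * B ^ k * Nat.card (P.sections n) := by gcongr

end

/-! ### The ring `A` -/

section

open scoped IntermediateField.algebraAdjoinAdjoin

variable {Fq K : Type*} [Field Fq] [Finite Fq] [Field K] [Algebra Fq K]

/-- By Riemann's inequality `A` contains a function with a pole at `P`. -/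
theorem IsCurveFunctionField.exists_mem_ringA_one_lt (hK : IsCurveFunctionField Fq K)
    (P : Place K) : ∃ a ∈ ringA Fq P, 1 < P.val a := by
  by_contra! hcon
  obtain ⟨c, hc⟩ := hK.exists_le_card_sections P
  have hQ : 1 < P.residueCard := by exact_mod_cast P.one_lt_residueCard
  have hfin : Finite (P.sections ((0 : ℕ) : ℤ)) :=
    Nat.finite_of_card_ne_zero (hK.card_sections P 0).1
  have hle : ∀ n : ℕ, P.residueCard ^ n ≤ c * P.residueCard := fun n => by
    refine (hc n).trans (Nat.mul_le_mul_left c ?_)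
    refine (Nat.card_mono (Set.toFinite (P.sections ((0 : ℕ) : ℤ) : Set K)) ?_).trans
      ((hK.card_sections P 0).2.trans (by simp))
    rintro a ⟨ha, _⟩
    refine ⟨ha, ?_⟩
    have := hcon a ha
    change P.val a ≤ WithZero.exp _
    simpa using this
  exact absurd (hle (c * P.residueCard)) (not_le.2 (Nat.lt_pow_self hQ))

/-- Every element of `K` is algebraic over `Fq[a] ⊆ A`, where `a` has a pole at `P`, so a multiple
of it is integral over `Fq[a]` and hence lies in `A`. -/
theorem IsCurveFunctionField.isFractionRing_ringA (hK : IsCurveFunctionField Fq K)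
    (P : Place K) : IsFractionRing (ringA Fq P) K := by
  obtain ⟨a, haA, ha⟩ := hK.exists_mem_ringA_one_lt P
  have ha0 : a ≠ 0 := by
    rintro rfl
    simp at ha
  have htr : Transcendental Fq a := P.transcendental_of_val_ne_one ha0 ha.ne'
  have := hK.finiteDimensional_adjoin htr
  have halg : Algebra.IsAlgebraic (Algebra.adjoin Fq {a}) K :=
    (IsFractionRing.comap_isAlgebraic_iff (A := Algebra.adjoin Fq {a})
      (K := IntermediateField.adjoin Fq {a}) (C := K)).2 inferInstance
  have hle : Algebra.adjoin Fq {a} ≤ ringA Fq P :=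
    Algebra.adjoin_le (Set.singleton_subset_iff.2 haA)
  refine IsFractionRing.of_field _ _ fun z => ?_
  obtain ⟨d, hd, hint⟩ := (halg.isAlgebraic z).exists_integral_multiple
  have hd0 : (d : K) ≠ 0 := fun h => hd (Subtype.ext h)
  have hmem : (d : K) * z ∈ ringA Fq P := fun w hw =>
    w.val_le_one_of_isIntegral (haA w hw) hint
  exact ⟨⟨_, hmem⟩, ⟨d, hle d.2⟩, (mul_div_cancel_left₀ z hd0).symm⟩

/-- `A` is Noetherian of dimension one since its quotients are finite, and integrally closed as an
intersection of valuation rings. -/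
theorem IsCurveFunctionField.isDedekindDomain_ringA (hK : IsCurveFunctionField Fq K)
    (P : Place K) : IsDedekindDomain (ringA Fq P) := by
  have := hK.hasFiniteQuotients (ringA Fq P)
  have := hK.isFractionRing_ringA P
  have : IsIntegrallyClosed (ringA Fq P) := by
    rw [isIntegrallyClosed_iff K]
    intro z hz
    refine ⟨⟨z, fun w hw => ?_⟩, rfl⟩
    let f : ringA Fq P →+* w.val.integer :=
      { toFun := fun y => ⟨y, y.2 w hw⟩
        map_one' := rfl
        map_mul' := fun _ _ => rfl
        map_zero' := rfl
        map_add' := fun _ _ => rfl }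
    have h := hz.map_of_comp_eq f (RingHom.id K) rfl
    exact Valuation.Integers.mem_of_integral (Valuation.integer.integers w.val) h
  exact { }

/-- The index of an ideal of `A`, computed in `K`. -/
theorem relIndex_map_subtype (P : Place K) (J : Ideal (ringA Fq P)) :
    (J.toAddSubgroup.map ((ringA Fq P).val : ringA Fq P →+ K)).relIndex P.affine =
      J.cardQuot := by
  have h1 : (⊤ : AddSubgroup (ringA Fq P)).map ((ringA Fq P).val : ringA Fq P →+ K) =
      P.affine := by
    ext y
    constructor
    · rintro ⟨z, _, rfl⟩; exact z.2
    · intro hy; exact ⟨⟨y, hy⟩, trivial, rfl⟩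
  rw [← h1, AddSubgroup.relIndex_map_map_of_injective _ _ Subtype.val_injective,
    AddSubgroup.relIndex_top_right]
  rfl

theorem map_subtype_span_singleton (P : Place K) (b : ringA Fq P) :
    (Ideal.span {b}).toAddSubgroup.map ((ringA Fq P).val : ringA Fq P →+ K) =
      dilate (b : K) P.affine := by
  ext y
  rw [mem_dilate, AddSubgroup.mem_map]
  constructor
  · rintro ⟨z, hz, rfl⟩
    obtain ⟨c, rfl⟩ := Ideal.mem_span_singleton'.1 hz
    exact ⟨c, c.2, mul_comm _ _⟩
  · rintro ⟨m, hm, rfl⟩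
    exact ⟨⟨m, hm⟩ * b, Ideal.mem_span_singleton'.2 ⟨_, rfl⟩, mul_comm _ _⟩

/-- The number of zeros of a function is at most the number of its poles, up to a constant. -/
theorem IsCurveFunctionField.exists_cardQuot_span_le (hK : IsCurveFunctionField Fq K)
    (P : Place K) : ∃ c : ℕ, ∀ (v : ℕ) (b : ringA Fq P), P.val (b : K) = WithZero.exp (v : ℤ) →
      (Ideal.span {b}).cardQuot ≤ c * P.residueCard ^ (v + 1) := by
  obtain ⟨c, hc⟩ := hK.exists_le_card_sections P
  refine ⟨c, fun v b hb => ?_⟩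
  have hb0 : (b : K) ≠ 0 := fun h => by
    rw [h, map_zero] at hb
    exact WithZero.exp_ne_zero hb.symm
  set B := dilate (b : K) P.affine with hBdef
  have hidx : (Ideal.span {b}).cardQuot = B.relIndex P.affine := by
    rw [← relIndex_map_subtype, map_subtype_span_singleton]
  have hBle : B ≤ P.affine := by
    rintro _ ⟨m, hm, rfl⟩
    exact (ringA Fq P).mul_mem b.2 hm
  have hfin : Finite (ringA Fq P ⧸ Ideal.span {b}) :=
    (hK.hasFiniteQuotients (ringA Fq P)).finiteQuotient (by
      rw [Ne, Ideal.span_singleton_eq_bot]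
      rintro rfl
      exact hb0 rfl)
  -- for large `n`, every class modulo `b` is represented by a section of order `n`
  obtain ⟨n, hnv, hn⟩ : ∃ n : ℕ, v ≤ n ∧ P.affine = B ⊔ P.sections n := by
    have hrep : ∀ z : ringA Fq P ⧸ Ideal.span {b}, ∃ y : ringA Fq P, ∃ n : ℕ,
        Ideal.Quotient.mk _ y = z ∧ P.val (y : K) ≤ WithZero.exp (n : ℤ) := fun z => by
      obtain ⟨y, rfl⟩ := Ideal.Quotient.mk_surjective z
      refine ⟨y, (WithZero.log (P.val (y : K))).toNat, rfl, ?_⟩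
      rcases eq_or_ne (P.val (y : K)) 0 with h | h
      · rw [h]; exact zero_le
      · conv_lhs => rw [← WithZero.exp_log h]
        exact WithZero.exp_le_exp.2 (Int.self_le_toNat _)
    choose y n hy hyn using hrep
    have := Fintype.ofFinite (ringA Fq P ⧸ Ideal.span {b})
    refine ⟨max v (Finset.univ.sup n), le_max_left _ _, le_antisymm (fun a ha => ?_)
      (sup_le hBle inf_le_left)⟩
    set z : ringA Fq P ⧸ Ideal.span {b} := Ideal.Quotient.mk _ (⟨a, ha⟩ : ringA Fq P) with hz
    have h1 : (⟨a, ha⟩ : ringA Fq P) - y z ∈ Ideal.span {b} := by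
      rw [← Ideal.Quotient.eq, hy]
    have h2 : a - y z ∈ B := by
      rw [hBdef, ← map_subtype_span_singleton]
      exact ⟨_, h1, rfl⟩
    have : a = (a - y z) + y z := by ring
    rw [this]
    refine AddSubgroup.add_mem_sup h2 ⟨(y z).2, (hyn z).trans (WithZero.exp_le_exp.2 ?_)⟩
    exact_mod_cast (Finset.le_sup (f := n) (Finset.mem_univ z)).trans (le_max_right _ _)
  have hrel : B.relIndex P.affine = B.relIndex (P.sections n) := by
    have h3 := AddSubgroup.relIndex_sup_left (P.sections n) B
    rwa [← hn] at h3
  have hcard : Nat.card (P.sections n) =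
      Nat.card (B ⊓ P.sections n : AddSubgroup K) * B.relIndex (P.sections n) := by
    rw [← AddSubgroup.relIndex_bot_left, ← AddSubgroup.relIndex_bot_left,
      ← AddSubgroup.inf_relIndex_right B (P.sections n),
      AddSubgroup.relIndex_mul_relIndex _ _ _ bot_le inf_le_right]
  have hsub : dilate (b : K) (P.sections ((n - v : ℕ) : ℤ)) ≤ B ⊓ P.sections n := by
    rintro _ ⟨m, ⟨hm1, hm2⟩, rfl⟩
    refine ⟨⟨m, hm1, rfl⟩, (ringA Fq P).mul_mem b.2 hm1, ?_⟩
    have h4 := Place.dilate_ball hb ((n - v : ℕ) : ℤ)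
    have h5 : ((n - v : ℕ) : ℤ) + v = n := by push_cast [hnv]; ring
    rw [h5] at h4
    change _ ∈ P.ball n
    rw [← h4]
    exact ⟨m, hm2, rfl⟩
  have hfinn : Finite (P.sections n) := Nat.finite_of_card_ne_zero (hK.card_sections P n).1
  have hcard2 : Nat.card (P.sections ((n - v : ℕ) : ℤ)) ≤
      Nat.card (B ⊓ P.sections n : AddSubgroup K) := by
    have e : Nat.card (dilate (b : K) (P.sections ((n - v : ℕ) : ℤ))) =
        Nat.card (P.sections ((n - v : ℕ) : ℤ)) :=
      (Nat.card_congr (AddSubgroup.equivMapOfInjective _ _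
        (fun _ _ h => mul_left_cancel₀ hb0 h)).toEquiv).symm
    rw [← e]
    exact Nat.card_mono ((Set.toFinite (P.sections n : Set K)).subset inf_le_right) hsub
  have h6 : (Ideal.span {b}).cardQuot * P.residueCard ^ (n - v) ≤ c * P.residueCard ^ (n + 1) := by
    calc (Ideal.span {b}).cardQuot * P.residueCard ^ (n - v)
        ≤ (Ideal.span {b}).cardQuot * (c * Nat.card (B ⊓ P.sections n : AddSubgroup K)) :=
          Nat.mul_le_mul_left _ ((hc _).trans (Nat.mul_le_mul_left _ hcard2))
      _ = c * Nat.card (P.sections n) := by rw [hcard, hidx, hrel]; ring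
      _ ≤ _ := Nat.mul_le_mul_left _ (hK.card_sections P n).2
  refine Nat.le_of_mul_le_mul_right ?_ (pow_pos P.residueCard_pos (n - v))
  calc _ ≤ _ := h6
    _ = c * P.residueCard ^ (v + 1) * P.residueCard ^ (n - v) := by
      rw [mul_assoc, ← pow_add]
      congr 2
      omega

/-- Every ideal contains a principal ideal whose relative index is bounded. -/
theorem IsCurveFunctionField.exists_mem_cardQuot_span_le (hK : IsCurveFunctionField Fq K)
    (P : Place K) : ∃ C : ℕ, ∀ J : Ideal (ringA Fq P), J ≠ ⊥ → ∃ b ∈ J, b ≠ 0 ∧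
      (Ideal.span {b}).cardQuot ≤ C * J.cardQuot := by
  obtain ⟨c, hc⟩ := hK.exists_le_card_sections P
  obtain ⟨c', hc'⟩ := hK.exists_cardQuot_span_le P
  set Q := P.residueCard
  have hQ : 1 < Q := by exact_mod_cast P.one_lt_residueCard
  refine ⟨c' * Q ^ 2 * c, fun J hJ => ?_⟩
  have := hK.hasFiniteQuotients (ringA Fq P)
  have hJ0 : 0 < J.cardQuot := Ring.HasFiniteQuotients.cardQuot_pos J hJ
  have hc0 : 0 < c := by
    rcases Nat.eq_zero_or_pos c with rfl | h
    · have := hc 0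
      simp at this
    · exact h
  have hex : ∃ n, c * J.cardQuot < Q ^ n := ⟨c * J.cardQuot, Nat.lt_pow_self hQ⟩
  classical
  obtain ⟨n, hn, hmin⟩ : ∃ n, c * J.cardQuot < Q ^ (n + 1) ∧ Q ^ n ≤ c * J.cardQuot := by
    rcases h : Nat.find hex with _ | n
    · have := Nat.find_spec hex
      rw [h, pow_zero] at this
      have := Nat.mul_pos hc0 hJ0
      omega
    · refine ⟨n, by rw [← h]; exact Nat.find_spec hex, ?_⟩
      exact not_lt.1 (Nat.find_min hex (by omega))
  set S := P.sections ((n + 1 : ℕ) : ℤ) with hS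
  set JK := J.toAddSubgroup.map ((ringA Fq P).val : ringA Fq P →+ K) with hJK
  have hlt : J.cardQuot < Nat.card S :=
    Nat.lt_of_mul_lt_mul_left (hn.trans_le (hc (n + 1)))
  have hne : JK ⊓ S ≠ ⊥ := by
    intro hbot
    have h1 : Nat.card S = JK.relIndex S := by
      rw [← AddSubgroup.inf_relIndex_right, hbot, AddSubgroup.relIndex_bot_left]
    have h2 : JK.relIndex S ≤ J.cardQuot := by
      rw [← relIndex_map_subtype]
      refine AddSubgroup.relIndex_le_of_le_right inf_le_left ?_
      rw [relIndex_map_subtype]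
      exact hJ0.ne'
    omega
  obtain ⟨⟨a, ⟨b, hbJ, hba⟩, haS⟩, hne0⟩ := AddSubgroup.ne_bot_iff_exists_ne_zero.1 hne
  have hab : a = (b : K) := hba.symm
  subst hab
  have hb0 : (b : K) ≠ 0 := fun h => hne0 (Subtype.ext h)
  have hPb0 : P.val (b : K) ≠ 0 := by simpa using hb0
  refine ⟨b, hbJ, fun h => hb0 (congrArg Subtype.val h), ?_⟩
  have hv0 : 0 ≤ WithZero.log (P.val (b : K)) := by
    by_contra hneg
    refine hb0 (hK.eq_zero_of_mem_affine (P := P) b.2 ?_)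
    rw [← WithZero.exp_log hPb0, ← WithZero.exp_zero, WithZero.exp_lt_exp]
    omega
  obtain ⟨v, hv⟩ := Int.eq_ofNat_of_zero_le hv0
  have hbv : P.val (b : K) = WithZero.exp (v : ℤ) := by rw [← hv, WithZero.exp_log hPb0]
  have hvn : v ≤ n + 1 := by
    have h3 : P.val (b : K) ≤ WithZero.exp ((n + 1 : ℕ) : ℤ) := haS.2
    rw [hbv, WithZero.exp_le_exp] at h3
    exact_mod_cast h3
  calc (Ideal.span {b}).cardQuot ≤ c' * Q ^ (v + 1) := hc' v b hbv
    _ ≤ c' * Q ^ (n + 2) := Nat.mul_le_mul_left _ (Nat.pow_le_pow_right (by omega) (by omega))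
    _ = c' * Q ^ 2 * Q ^ n := by ring
    _ ≤ c' * Q ^ 2 * (c * J.cardQuot) := Nat.mul_le_mul_left _ hmin
    _ = _ := by ring

end

/-! ### Indices of fractional ideals -/

section

section FractionalIdeal

variable {A K : Type*} [CommRing A] [Field K] [Algebra A K]

/-- The additive group underlying a fractional ideal. -/
def idealGroup (I : FractionalIdeal A⁰ K) : AddSubgroup K := (I : Submodule A K).toAddSubgroup

theorem mem_idealGroup {I : FractionalIdeal A⁰ K} {x : K} : x ∈ idealGroup I ↔ x ∈ I := Iff.rfl

variable [IsDedekindDomain A] [IsFractionRing A K]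

omit [IsDedekindDomain A] in
theorem idealGroup_spanSingleton_mul {a : K} (I : FractionalIdeal A⁰ K) :
    idealGroup (FractionalIdeal.spanSingleton A⁰ a * I) = dilate a (idealGroup I) := by
  ext y
  rw [mem_idealGroup, FractionalIdeal.mem_singleton_mul, mem_dilate]
  simp only [mem_idealGroup, eq_comm]

/-- `M / M J` is generated by one element. -/
theorem exists_mul_add_spanSingleton_eq {M : FractionalIdeal A⁰ K} {J : Ideal A}
    (hJ : J ≠ ⊥) (hM : M ≠ 0) :
    ∃ a : K, M * J + FractionalIdeal.spanSingleton A⁰ a = M := by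
  obtain ⟨d, M₀, hd, rfl⟩ := FractionalIdeal.exists_eq_spanSingleton_mul M
  have hM₀ : M₀ ≠ 0 := by
    rintro rfl
    simp at hM
  obtain ⟨a, ha⟩ := IsDedekindDomain.exists_sup_span_eq (I := M₀ * J) (J := M₀) Ideal.mul_le_left
    (mul_ne_zero hM₀ hJ)
  refine ⟨(algebraMap A K d)⁻¹ * algebraMap A K a, ?_⟩
  conv_rhs => rw [← ha]
  rw [FractionalIdeal.coeIdeal_sup, mul_add, FractionalIdeal.coeIdeal_mul,
    FractionalIdeal.coeIdeal_span_singleton, FractionalIdeal.spanSingleton_mul_spanSingleton,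
    mul_assoc]

/-- `M J + a N = M` for a suitable `a`, so `M / M J` is a quotient of `N / N J`. -/
theorem relIndex_mul_dvd {M N : FractionalIdeal A⁰ K} {J : Ideal A} (hJ : J ≠ ⊥)
    (hM : M ≠ 0) (hN : N ≠ 0) :
    (idealGroup (M * (J : FractionalIdeal A⁰ K))).relIndex (idealGroup M) ∣
      (idealGroup (N * (J : FractionalIdeal A⁰ K))).relIndex (idealGroup N) := by
  obtain ⟨a, ha⟩ := exists_mul_add_spanSingleton_eq (M := M * N⁻¹) hJ
    (mul_ne_zero hM (inv_ne_zero hN))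
  have h1 : M * J + FractionalIdeal.spanSingleton A⁰ a * N = M := by
    calc _ = (M * N⁻¹ * J + FractionalIdeal.spanSingleton A⁰ a) * N := by
          rw [add_mul, mul_right_comm, mul_assoc M N⁻¹ N, inv_mul_cancel₀ hN, mul_one]
      _ = M := by rw [ha, mul_assoc, inv_mul_cancel₀ hN, mul_one]
  have h2 : idealGroup M =
      idealGroup (M * (J : FractionalIdeal A⁰ K)) ⊔ dilate a (idealGroup N) := by
    rw [← idealGroup_spanSingleton_mul]
    conv_lhs => rw [← h1]
    rw [idealGroup, FractionalIdeal.coe_add]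
    exact Submodule.sup_toAddSubgroup _ _
  have h3 : (idealGroup (M * (J : FractionalIdeal A⁰ K))).relIndex (idealGroup M) =
      (idealGroup (M * (J : FractionalIdeal A⁰ K))).relIndex (dilate a (idealGroup N)) := by
    have h := AddSubgroup.relIndex_sup_left (dilate a (idealGroup N))
      (idealGroup (M * (J : FractionalIdeal A⁰ K)))
    rwa [← h2] at h
  rw [h3]
  rcases eq_or_ne a 0 with rfl | ha0
  · have : dilate 0 (idealGroup N) = ⊥ := by
      rw [eq_bot_iff]
      rintro _ ⟨m, _, rfl⟩
      simp
    rw [this, AddSubgroup.relIndex_bot_right]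
    exact one_dvd _
  · rw [← relIndex_dilate ha0 (idealGroup (N * (J : FractionalIdeal A⁰ K)))]
    refine AddSubgroup.relIndex_dvd_of_le_left _ ?_
    rw [← idealGroup_spanSingleton_mul]
    have h4 : FractionalIdeal.spanSingleton A⁰ a * (N * J) ≤ M * J := by
      rw [← mul_assoc]
      refine mul_le_mul_left ?_ _
      rw [← h1, ← FractionalIdeal.sup_eq_add]
      exact le_sup_right
    exact h4

/-- The index of `M J` in `M` is the same for all fractional ideals `M`. -/
theorem relIndex_mul_eq {M N : FractionalIdeal A⁰ K} {J : Ideal A} (hJ : J ≠ ⊥)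
    (hM : M ≠ 0) (hN : N ≠ 0) :
    (idealGroup (M * (J : FractionalIdeal A⁰ K))).relIndex (idealGroup M) =
      (idealGroup (N * (J : FractionalIdeal A⁰ K))).relIndex (idealGroup N) :=
  Nat.dvd_antisymm (relIndex_mul_dvd hJ hM hN) (relIndex_mul_dvd hJ hN hM)

omit [IsDedekindDomain A] in
theorem relIndex_idealGroup_coeIdeal (J : Ideal A) :
    (idealGroup (J : FractionalIdeal A⁰ K)).relIndex (idealGroup (1 : FractionalIdeal A⁰ K)) =
      J.cardQuot := by
  have h1 : ∀ I : Ideal A, idealGroup (I : FractionalIdeal A⁰ K) =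
      I.toAddSubgroup.map (algebraMap A K : A →+ K) := fun I => by
    ext y
    rw [mem_idealGroup, FractionalIdeal.mem_coeIdeal]
    rfl
  rw [← FractionalIdeal.coeIdeal_top, h1, h1,
    AddSubgroup.relIndex_map_map_of_injective _ _ (IsFractionRing.injective A K)]
  exact AddSubgroup.relIndex_top_right _

theorem relIndex_mul_eq_cardQuot {M : FractionalIdeal A⁰ K} {J : Ideal A} (hJ : J ≠ ⊥)
    (hM : M ≠ 0) :
    (idealGroup (M * (J : FractionalIdeal A⁰ K))).relIndex (idealGroup M) = J.cardQuot := by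
  rw [relIndex_mul_eq hJ hM one_ne_zero, one_mul, relIndex_idealGroup_coeIdeal]

/-- A nonzero multiple of a fractional ideal is contained in any other one. -/
theorem exists_spanSingleton_mul_le {M N : FractionalIdeal A⁰ K} (hN : N ≠ 0) :
    ∃ a : A, a ≠ 0 ∧ M * (Ideal.span {a} : Ideal A) ≤ N := by
  obtain ⟨d, M₀, hd, hM⟩ := FractionalIdeal.exists_eq_spanSingleton_mul (M * N⁻¹)
  refine ⟨d, hd, ?_⟩
  have hdK : algebraMap A K d ≠ 0 := by simpa using hd
  have h1 : M * N⁻¹ * (Ideal.span {d} : Ideal A) ≤ 1 := by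
    rw [hM, FractionalIdeal.coeIdeal_span_singleton, mul_right_comm,
      FractionalIdeal.spanSingleton_mul_spanSingleton, inv_mul_cancel₀ hdK,
      FractionalIdeal.spanSingleton_one, one_mul]
    exact FractionalIdeal.coeIdeal_le_one
  calc M * (Ideal.span {d} : Ideal A) = M * N⁻¹ * (Ideal.span {d} : Ideal A) * N := by
        rw [mul_right_comm (M * N⁻¹), mul_assoc M N⁻¹ N, inv_mul_cancel₀ hN, mul_one]
    _ ≤ 1 * N := mul_le_mul_left h1 _
    _ = N := one_mul N

variable [Ring.HasFiniteQuotients A]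

theorem relIndex_idealGroup_ne_zero {M N : FractionalIdeal A⁰ K} (hM : M ≠ 0) (hN : N ≠ 0) :
    (idealGroup N).relIndex (idealGroup M) ≠ 0 := by
  obtain ⟨a, ha0, ha⟩ := exists_spanSingleton_mul_le (M := M) hN
  have ha' : (Ideal.span {a} : Ideal A) ≠ ⊥ := by simpa using ha0
  intro h
  have h2 := AddSubgroup.relIndex_eq_zero_of_le_left (show idealGroup (M * ((Ideal.span {a} :
    Ideal A) : FractionalIdeal A⁰ K)) ≤ idealGroup N from ha) h
  rw [relIndex_mul_eq_cardQuot ha' hM] at h2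
  exact (Ring.HasFiniteQuotients.cardQuot_pos _ ha').ne' h2

omit [Ring.HasFiniteQuotients A] in
theorem cardQuot_mul_eq {I J : Ideal A} (hI : I ≠ ⊥) (hJ : J ≠ ⊥) :
    (I * J).cardQuot = I.cardQuot * J.cardQuot := by
  have hI' : (I : FractionalIdeal A⁰ (FractionRing A)) ≠ 0 := by simpa using hI
  rw [← relIndex_idealGroup_coeIdeal (K := FractionRing A) (I * J),
    ← relIndex_idealGroup_coeIdeal (K := FractionRing A) I, ← relIndex_mul_eq_cardQuot hJ hI',
    FractionalIdeal.coeIdeal_mul, mul_comm ((idealGroup _).relIndex _)]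
  refine (AddSubgroup.relIndex_mul_relIndex _ _ _ ?_ ?_).symm
  · have : (I : FractionalIdeal A⁰ (FractionRing A)) * J ≤ I := by
      rw [← FractionalIdeal.coeIdeal_mul, FractionalIdeal.coeIdeal_le_coeIdeal]
      exact Ideal.mul_le_left
    exact this
  · have : (I : FractionalIdeal A⁰ (FractionRing A)) ≤ 1 := FractionalIdeal.coeIdeal_le_one
    exact this

end FractionalIdeal

end

section

variable {Fq K : Type*} [Field Fq] [Finite Fq] [Field K] [Algebra Fq K] {P : Place K}

/-! ### Relative dimensions, lattices and their degrees -/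

theorem natCard_pow_relDim {M N : Submodule (ringA Fq P) K}
    (h : N.toAddSubgroup.relIndex M.toAddSubgroup ≠ 0) :
    Nat.card Fq ^ relDim M N = N.toAddSubgroup.relIndex M.toAddSubgroup := by
  have h1 : N.toAddSubgroup.relIndex M.toAddSubgroup = Nat.card (M ⧸ N.submoduleOf M) := rfl
  have h2 : Finite (M ⧸ N.submoduleOf M) := Nat.finite_of_card_ne_zero (h1 ▸ h)
  have : Module.Finite Fq (M ⧸ N.submoduleOf M) := Module.Finite.of_finite
  rw [h1]
  exact (Module.natCard_eq_pow_finrank (K := Fq) (V := M ⧸ N.submoduleOf M)).symm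

theorem relDim_eq_of_relIndex_eq {M N M' N' : Submodule (ringA Fq P) K}
    (h : N.toAddSubgroup.relIndex M.toAddSubgroup ≠ 0)
    (h' : N.toAddSubgroup.relIndex M.toAddSubgroup = N'.toAddSubgroup.relIndex M'.toAddSubgroup) :
    relDim M N = relDim M' N' := by
  apply Nat.pow_right_injective (Finite.one_lt_card (α := Fq))
  simp only
  rw [natCard_pow_relDim h, h', natCard_pow_relDim (h' ▸ h)]

theorem relDim_eq_zero_of_le {M N : Submodule (ringA Fq P) K} (h : M ≤ N) : relDim M N = 0 := by
  have h1 : N.toAddSubgroup.relIndex M.toAddSubgroup = 1 := AddSubgroup.relIndex_eq_one.2 h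
  have h2 := natCard_pow_relDim (h1 ▸ one_ne_zero : N.toAddSubgroup.relIndex M.toAddSubgroup ≠ 0)
  rw [h1] at h2
  exact ((Nat.pow_eq_one.1 h2).resolve_left (Finite.one_lt_card (α := Fq)).ne')

theorem relDim_eq_add {M N D : Submodule (ringA Fq P) K} (hD : D ≤ M ⊓ N)
    (h : D.toAddSubgroup.relIndex M.toAddSubgroup ≠ 0) :
    relDim M D = relDim M N + relDim (M ⊓ N) D := by
  have h1 : D.toAddSubgroup.relIndex (M ⊓ N).toAddSubgroup *
      N.toAddSubgroup.relIndex M.toAddSubgroup = D.toAddSubgroup.relIndex M.toAddSubgroup := by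
    rw [← AddSubgroup.inf_relIndex_left M.toAddSubgroup]
    exact AddSubgroup.relIndex_mul_relIndex _ _ _ hD (inf_le_left : M ⊓ N ≤ M)
  have h2 := h
  rw [← h1, mul_ne_zero_iff] at h2
  apply Nat.pow_right_injective (Finite.one_lt_card (α := Fq))
  simp only
  rw [pow_add, natCard_pow_relDim h, natCard_pow_relDim h2.1, natCard_pow_relDim h2.2, ← h1,
    mul_comm]

theorem relDim_sub_relDim {M N D : Submodule (ringA Fq P) K} (hD : D ≤ M ⊓ N)
    (hM : D.toAddSubgroup.relIndex M.toAddSubgroup ≠ 0)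
    (hN : D.toAddSubgroup.relIndex N.toAddSubgroup ≠ 0) :
    (relDim M N : ℤ) - relDim N M = relDim M D - relDim N D := by
  rw [relDim_eq_add hD hM, relDim_eq_add (inf_comm M N ▸ hD) hN, inf_comm N M]
  push_cast
  ring

namespace Lattice

/-- A lattice as a fractional ideal of `A`. -/
def toFrac (Λ : Lattice Fq P) : FractionalIdeal (ringA Fq P)⁰ K := ⟨Λ.carrier, Λ.isFractional⟩

theorem mem_toFrac {Λ : Lattice Fq P} {x : K} : x ∈ Λ.toFrac ↔ x ∈ Λ.carrier := Iff.rfl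

theorem toFrac_ne_zero (Λ : Lattice Fq P) : Λ.toFrac ≠ 0 := fun h => Λ.ne_bot <| by
  have h1 : (Λ.toFrac : Submodule (ringA Fq P) K) = ⊥ := by rw [h]; exact FractionalIdeal.coe_zero
  exact h1

theorem toFrac_injective : Function.Injective (toFrac : Lattice Fq P → _) := fun _ _ h =>
  Lattice.ext (congrArg (fun I : FractionalIdeal (ringA Fq P)⁰ K =>
    (I : Submodule (ringA Fq P) K)) h)

/-- A nonzero fractional ideal as a lattice. -/
def ofFrac (I : FractionalIdeal (ringA Fq P)⁰ K) (hI : I ≠ 0) : Lattice Fq P where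
  carrier := I
  ne_bot h := hI (FractionalIdeal.coeToSubmodule_eq_bot.1 h)
  isFractional := I.2

theorem toFrac_ofFrac (I : FractionalIdeal (ringA Fq P)⁰ K) (hI : I ≠ 0) :
    (ofFrac I hI).toFrac = I := rfl

variable [IsFractionRing (ringA Fq P) K] [IsDedekindDomain (ringA Fq P)]

/-- The lattice `γ Λ`. -/
def scale (γ : Kˣ) (Λ : Lattice Fq P) : Lattice Fq P :=
  ofFrac (FractionalIdeal.spanSingleton _ (γ : K) * Λ.toFrac) <|
    mul_ne_zero (FractionalIdeal.spanSingleton_ne_zero_iff.2 γ.ne_zero) Λ.toFrac_ne_zero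

theorem toFrac_scale (γ : Kˣ) (Λ : Lattice Fq P) :
    (scale γ Λ).toFrac = FractionalIdeal.spanSingleton _ (γ : K) * Λ.toFrac := rfl

theorem mul_mem_scale {γ : Kˣ} {Λ : Lattice Fq P} {x : K} :
    (γ : K) * x ∈ (scale γ Λ).carrier ↔ x ∈ Λ.carrier := by
  rw [← mem_toFrac, toFrac_scale, FractionalIdeal.mem_singleton_mul]
  constructor
  · rintro ⟨y, hy, h⟩
    rw [mul_left_cancel₀ γ.ne_zero h]
    exact hy
  · exact fun h => ⟨x, h, rfl⟩

theorem mem_scale {γ : Kˣ} {Λ : Lattice Fq P} {x : K} :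
    x ∈ (scale γ Λ).carrier ↔ (γ : K)⁻¹ * x ∈ Λ.carrier := by
  rw [← mul_mem_scale (γ := γ) (Λ := Λ), mul_inv_cancel_left₀ γ.ne_zero]

theorem scale_one (Λ : Lattice Fq P) : scale 1 Λ = Λ := by
  ext x
  rw [mem_scale]
  simp

theorem scale_scale (γ δ : Kˣ) (Λ : Lattice Fq P) : scale γ (scale δ Λ) = scale (γ * δ) Λ := by
  ext x
  rw [mem_scale, mem_scale, mem_scale, Units.val_mul, mul_inv_rev, mul_assoc]

theorem scale_injective (γ : Kˣ) : Function.Injective (scale γ : Lattice Fq P → _) :=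
  fun Λ Λ' h => by
  rw [← scale_one Λ, ← inv_mul_cancel γ, ← scale_scale, h, scale_scale, inv_mul_cancel, scale_one]

/-- A scalar that fixes one lattice is a unit of `A` and fixes them all. -/
theorem scale_eq_self_of_scale_eq_self {γ : Kˣ} {Λ : Lattice Fq P} (h : scale γ Λ = Λ)
    (Λ' : Lattice Fq P) : scale γ Λ' = Λ' := by
  apply toFrac_injective
  have h1 := congrArg toFrac h
  rw [toFrac_scale] at h1 ⊢
  rw [(mul_eq_right₀ Λ.toFrac_ne_zero).1 h1, one_mul]

theorem exists_smul_mem (Λ Λ' : Lattice Fq P) :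
    ∃ a : ringA Fq P, a ≠ 0 ∧ ∀ x ∈ Λ'.carrier, a • x ∈ Λ.carrier := by
  obtain ⟨a, ha0, ha⟩ := exists_spanSingleton_mul_le (M := Λ'.toFrac) Λ.toFrac_ne_zero
  refine ⟨a, ha0, fun x hx => ?_⟩
  have h1 : x * algebraMap (ringA Fq P) K a ∈
      Λ'.toFrac * ((Ideal.span {a} : Ideal (ringA Fq P)) : FractionalIdeal (ringA Fq P)⁰ K) :=
    FractionalIdeal.mul_mem_mul hx
      (FractionalIdeal.mem_coeIdeal_of_mem _ (Ideal.mem_span_singleton_self a))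
  rw [Algebra.smul_def, mul_comm]
  exact ha h1

/-- A nonzero element of `A` that multiplies `Λ + Λ'` into `Λ`. -/
theorem exists_smul_sup_mem (Λ Λ' : Lattice Fq P) :
    ∃ a : ringA Fq P, a ≠ 0 ∧ ∀ x ∈ Λ.carrier ⊔ Λ'.carrier, a • x ∈ Λ.carrier := by
  obtain ⟨a, ha0, ha⟩ := exists_smul_mem Λ Λ'
  refine ⟨a, ha0, fun x hx => ?_⟩
  obtain ⟨y, hy, z, hz, rfl⟩ := Submodule.mem_sup.1 hx
  rw [smul_add]
  exact add_mem (Λ.carrier.smul_mem _ hy) (ha z hz)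

variable [Ring.HasFiniteQuotients (ringA Fq P)]

theorem relIndex_ne_zero (Λ Λ' : Lattice Fq P) :
    Λ.carrier.toAddSubgroup.relIndex Λ'.carrier.toAddSubgroup ≠ 0 :=
  relIndex_idealGroup_ne_zero (M := Λ'.toFrac) (N := Λ.toFrac) Λ'.toFrac_ne_zero Λ.toFrac_ne_zero

/-- The difference of degrees is the generalized index of the two lattices, which scaling
preserves. -/
theorem deg_sub_deg (Λ Λ' : Lattice Fq P) :
    Λ'.deg - Λ.deg = (relDim Λ.carrier Λ'.carrier : ℤ) - relDim Λ'.carrier Λ.carrier := by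
  set O : Lattice Fq P := ofFrac 1 one_ne_zero with hO
  have hO1 : O.carrier = 1 := FractionalIdeal.coe_one (S := (ringA Fq P)⁰) (P := K)
  have hD : ∀ M : Lattice Fq P, (O.carrier ⊓ (Λ.carrier ⊓ Λ'.carrier)).toAddSubgroup.relIndex
      M.carrier.toAddSubgroup ≠ 0 := fun M => by
    have h : (O.carrier ⊓ (Λ.carrier ⊓ Λ'.carrier)).toAddSubgroup = O.carrier.toAddSubgroup ⊓
        (Λ.carrier.toAddSubgroup ⊓ Λ'.carrier.toAddSubgroup) := rfl
    rw [h]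
    exact AddSubgroup.relIndex_inf_ne_zero (relIndex_ne_zero O M)
      (AddSubgroup.relIndex_inf_ne_zero (relIndex_ne_zero Λ M) (relIndex_ne_zero Λ' M))
  rw [Lattice.deg, Lattice.deg, ← hO1,
    relDim_sub_relDim (M := O.carrier) (N := Λ'.carrier)
      (le_inf inf_le_left (inf_le_right.trans inf_le_right)) (hD O) (hD Λ'),
    relDim_sub_relDim (M := O.carrier) (N := Λ.carrier)
      (le_inf inf_le_left (inf_le_right.trans inf_le_left)) (hD O) (hD Λ),
    relDim_sub_relDim (M := Λ.carrier) (N := Λ'.carrier) inf_le_right (hD Λ) (hD Λ')]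
  ring

theorem relDim_scale (γ : Kˣ) (Λ Λ' : Lattice Fq P) :
    relDim (scale γ Λ).carrier (scale γ Λ').carrier = relDim Λ.carrier Λ'.carrier := by
  have h : ∀ M : Lattice Fq P, (scale γ M).carrier.toAddSubgroup =
      dilate (γ : K) M.carrier.toAddSubgroup := fun M => by
    ext y
    rw [mem_dilate_iff_inv_mul_mem γ.ne_zero]
    exact mem_scale
  refine relDim_eq_of_relIndex_eq (relIndex_ne_zero _ _) ?_
  rw [h, h, relIndex_dilate γ.ne_zero]

theorem deg_scale_sub_deg_scale (γ : Kˣ) (Λ Λ' : Lattice Fq P) :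
    (scale γ Λ').deg - (scale γ Λ).deg = Λ'.deg - Λ.deg := by
  rw [deg_sub_deg, deg_sub_deg, relDim_scale, relDim_scale]

end Lattice

namespace NonzeroIdeal

theorem coe_ne_zero (J : NonzeroIdeal Fq P) :
    (J.1 : FractionalIdeal (ringA Fq P)⁰ K) ≠ 0 := J.toLattice.toFrac_ne_zero

/-- The degree `dim A/J` of a nonzero ideal. -/
def degree (J : NonzeroIdeal Fq P) : ℕ := relDim 1 J.toLattice.carrier

theorem toLattice_le_one (J : NonzeroIdeal Fq P) :
    J.toLattice.carrier ≤ (1 : Submodule (ringA Fq P) K) := by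
  rintro _ ⟨b, _, rfl⟩
  exact Submodule.mem_one.2 ⟨b, rfl⟩

theorem deg_toLattice (J : NonzeroIdeal Fq P) : J.toLattice.deg = J.degree := by
  rw [Lattice.deg, relDim_eq_zero_of_le J.toLattice_le_one, Nat.cast_zero, sub_zero]
  rfl

variable [IsFractionRing (ringA Fq P) K]

theorem relIndex_toLattice (J : NonzeroIdeal Fq P) :
    J.toLattice.carrier.toAddSubgroup.relIndex (1 : Submodule (ringA Fq P) K).toAddSubgroup =
      J.1.cardQuot := by
  rw [← relIndex_idealGroup_coeIdeal (K := K), idealGroup, idealGroup, FractionalIdeal.coe_one]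
  rfl

variable [IsDedekindDomain (ringA Fq P)]

omit [IsDedekindDomain (ringA Fq P)] in
theorem toFrac_invMul (J : NonzeroIdeal Fq P) (Λ : Lattice Fq P) :
    (J.invMul Λ).toFrac = (J.1 : FractionalIdeal (ringA Fq P)⁰ K)⁻¹ * Λ.toFrac := by
  apply FractionalIdeal.coeToSubmodule_injective
  beta_reduce
  rw [FractionalIdeal.coe_mul, FractionalIdeal.inv_eq, FractionalIdeal.coe_div J.coe_ne_zero,
    FractionalIdeal.coe_one]
  rfl

theorem invMul_mul (J : NonzeroIdeal Fq P) (Λ : Lattice Fq P) :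
    (J.invMul Λ).toFrac * J.1 = Λ.toFrac := by
  rw [toFrac_invMul, mul_right_comm, inv_mul_cancel₀ J.coe_ne_zero, one_mul]

theorem invMul_injective (Λ : Lattice Fq P) :
    Function.Injective fun J : NonzeroIdeal Fq P => J.invMul Λ := fun J J' h => by
  have h1 := congrArg Lattice.toFrac h
  simp only [toFrac_invMul] at h1
  have h2 := inv_injective (mul_right_cancel₀ Λ.toFrac_ne_zero h1)
  exact Subtype.ext (FractionalIdeal.coeIdeal_injective h2)

variable [Ring.HasFiniteQuotients (ringA Fq P)]

omit [IsDedekindDomain (ringA Fq P)] in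
theorem natCard_pow_degree (J : NonzeroIdeal Fq P) : Nat.card Fq ^ J.degree = J.1.cardQuot := by
  have h : J.1.cardQuot ≠ 0 := (Ring.HasFiniteQuotients.cardQuot_pos _ J.2).ne'
  rw [← relIndex_toLattice] at h ⊢
  exact natCard_pow_relDim h

omit [IsDedekindDomain (ringA Fq P)] in
/-- There are finitely many ideals of bounded degree, which makes the partition function
converge. -/
theorem finite_degree_le (n : ℕ) : {J : NonzeroIdeal Fq P | J.degree ≤ n}.Finite := by
  refine Set.Finite.of_finite_image ((Ring.HasFiniteQuotients.finite_cardQuot_le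
    (R := ringA Fq P) (Nat.card Fq ^ n)).subset ?_) (f := Subtype.val)
    Subtype.val_injective.injOn
  rintro _ ⟨J, hJ, rfl⟩
  change J.1.cardQuot ≤ _
  rw [← natCard_pow_degree]
  exact Nat.pow_le_pow_right Nat.card_pos hJ

omit [IsDedekindDomain (ringA Fq P)] in
theorem degree_eq_zero_iff (J : NonzeroIdeal Fq P) : J.degree = 0 ↔ J.1 = ⊤ := by
  have h := J.natCard_pow_degree
  constructor
  · intro h0
    rw [h0, pow_zero] at h
    exact Submodule.cardQuot_eq_one_iff.1 h.symm
  · intro h0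
    rw [h0, Submodule.cardQuot_top] at h
    exact (Nat.pow_eq_one.1 h).resolve_left (Finite.one_lt_card (α := Fq)).ne'

theorem deg_invMul (J : NonzeroIdeal Fq P) (Λ : Lattice Fq P) :
    (J.invMul Λ).deg = Λ.deg - J.degree := by
  have h1 : relDim (J.invMul Λ).carrier Λ.carrier = J.degree := by
    refine relDim_eq_of_relIndex_eq (Lattice.relIndex_ne_zero _ _) ?_
    rw [relIndex_toLattice, ← relIndex_mul_eq_cardQuot J.2 (J.invMul Λ).toFrac_ne_zero,
      invMul_mul]
    rfl
  have h2 := Lattice.deg_sub_deg Λ (J.invMul Λ)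
  rw [relDim_eq_zero_of_le (J.le_invMul Λ), h1] at h2
  push_cast at h2
  linarith

end NonzeroIdeal

/-- Finiteness of the class number: up to scaling there are only finitely many lattices. -/
theorem IsCurveFunctionField.exists_finite_lattices (hK : IsCurveFunctionField Fq K)
    [IsFractionRing (ringA Fq P) K] [IsDedekindDomain (ringA Fq P)]
    [Ring.HasFiniteQuotients (ringA Fq P)] :
    ∃ S : Set (Lattice Fq P), S.Finite ∧ ∀ Λ, ∃ Λ₀ ∈ S, ∃ γ : Kˣ, Λ = Λ₀.scale γ := by
  obtain ⟨C, hC⟩ := hK.exists_mem_cardQuot_span_le P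
  have hfin := Ring.HasFiniteQuotients.finite_cardQuot_le (R := ringA Fq P) C
  refine ⟨{Λ | ∃ I : Ideal (ringA Fq P), I.cardQuot ≤ C ∧
    Λ.toFrac = (I : FractionalIdeal (ringA Fq P)⁰ K)⁻¹}, ?_, fun Λ => ?_⟩
  · refine Set.Finite.of_finite_image ((hfin.image
      fun I : Ideal (ringA Fq P) => (I : FractionalIdeal (ringA Fq P)⁰ K)⁻¹).subset ?_)
      (Lattice.toFrac_injective.injOn (s := {Λ | ∃ I : Ideal (ringA Fq P), I.cardQuot ≤ C ∧
        Λ.toFrac = (I : FractionalIdeal (ringA Fq P)⁰ K)⁻¹}))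
    rintro _ ⟨Λ, ⟨I, hI, h⟩, rfl⟩
    exact ⟨I, hI, h.symm⟩
  · obtain ⟨d, J, hd, hJ⟩ := FractionalIdeal.exists_eq_spanSingleton_mul Λ.toFrac
    have hJ0 : J ≠ ⊥ := by
      rintro rfl
      apply Λ.toFrac_ne_zero
      rw [hJ]
      simp
    obtain ⟨b, hbJ, hb0, hb⟩ := hC J hJ0
    obtain ⟨I, hI⟩ := Ideal.dvd_span_singleton.2 hbJ
    have hI0 : I ≠ ⊥ := by
      rintro rfl
      rw [Ideal.mul_bot, Ideal.span_singleton_eq_bot] at hI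
      exact hb0 hI
    have hIC : I.cardQuot ≤ C := by
      rw [hI, cardQuot_mul_eq hJ0 hI0, mul_comm] at hb
      exact Nat.le_of_mul_le_mul_right hb (Ring.HasFiniteQuotients.cardQuot_pos J hJ0)
    have hI0' : (I : FractionalIdeal (ringA Fq P)⁰ K) ≠ 0 := by simpa using hI0
    have hbK : algebraMap (ringA Fq P) K b ≠ 0 := by simpa using hb0
    have hdK : algebraMap (ringA Fq P) K d ≠ 0 := by simpa using hd
    refine ⟨Lattice.ofFrac _ (inv_ne_zero hI0'), ⟨I, hIC, rfl⟩,
      Units.mk0 ((algebraMap _ K d)⁻¹ * algebraMap _ K b) (mul_ne_zero (inv_ne_zero hdK) hbK), ?_⟩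
    apply Lattice.toFrac_injective
    rw [Lattice.toFrac_scale, Lattice.toFrac_ofFrac, hJ, Units.val_mk0,
      ← FractionalIdeal.spanSingleton_mul_spanSingleton, mul_assoc]
    congr 1
    rw [← FractionalIdeal.coeIdeal_span_singleton, hI, FractionalIdeal.coeIdeal_mul,
      mul_assoc, mul_inv_cancel₀ hI0', mul_one]

end

/-! ### `K`-lattices through representatives -/

section

variable {Fq K : Type*} [Field Fq] [Finite Fq] [Field K] [Algebra Fq K] {P : Place K}

namespace KLattice

/-- `w` represents the value `φ(z)`. -/
def Rep (L : KLattice Fq P) (z : K ⧸ (1 : Submodule (ringA Fq P) K)) (w : K) : Prop :=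
  L.φ z = Submodule.Quotient.mk w

theorem exists_rep (L : KLattice Fq P) (z : K ⧸ (1 : Submodule (ringA Fq P) K)) :
    ∃ w, L.Rep z w := by
  obtain ⟨w, hw⟩ := Submodule.Quotient.mk_surjective _ (L.φ z)
  exact ⟨w, hw.symm⟩

theorem Rep.sub_mem {L : KLattice Fq P} {z : K ⧸ (1 : Submodule (ringA Fq P) K)} {w w' : K}
    (h : L.Rep z w) (h' : L.Rep z w') : w - w' ∈ L.lat.carrier :=
  (Submodule.Quotient.eq _).1 (h.symm.trans h')

theorem Rep.congr {L : KLattice Fq P} {z : K ⧸ (1 : Submodule (ringA Fq P) K)} {w w' : K}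
    (h : L.Rep z w) (h' : w - w' ∈ L.lat.carrier) : L.Rep z w' :=
  h.trans ((Submodule.Quotient.eq _).2 h')

theorem Rep.smul {L : KLattice Fq P} {z : K ⧸ (1 : Submodule (ringA Fq P) K)} {w : K}
    (h : L.Rep z w) (a : ringA Fq P) : L.Rep (a • z) (a • w) := by
  rw [Rep, map_smul, h, Submodule.Quotient.mk_smul]

theorem ext_rep {L L' : KLattice Fq P} (h : L.lat = L'.lat)
    (h' : ∀ z w, L.Rep z w → L'.Rep z w) : L = L' := by
  obtain ⟨Λ, φ⟩ := L
  obtain ⟨Λ', φ'⟩ := L'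
  obtain rfl : Λ = Λ' := h
  congr 1
  refine LinearMap.ext fun z => ?_
  obtain ⟨w, hw⟩ := Submodule.Quotient.mk_surjective _ (φ z)
  rw [← hw]
  exact (h' z w hw.symm).symm

theorem commens_iff {L L' : KLattice Fq P} :
    Commens L L' ↔ ∀ z w w', L.Rep z w → L'.Rep z w' →
      w - w' ∈ L.lat.carrier ⊔ L'.lat.carrier := by
  refine forall_congr' fun z => ?_
  constructor
  · intro h w w' hw hw'
    rw [hw, hw'] at h
    exact (Submodule.Quotient.eq _).1 h
  · intro h
    obtain ⟨w, hw⟩ := L.exists_rep z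
    obtain ⟨w', hw'⟩ := L'.exists_rep z
    rw [hw, hw']
    exact (Submodule.Quotient.eq _).2 (h w w' hw hw')

theorem Commens.symm {L L' : KLattice Fq P} (h : Commens L L') : Commens L' L := by
  rw [commens_iff] at h ⊢
  intro z w w' hw hw'
  rw [← neg_sub, neg_mem_iff, sup_comm]
  exact h z w' w hw' hw

/-- `K / A` is divisible. -/
theorem exists_smul_eq {a : ringA Fq P} (ha : a ≠ 0) (z : K ⧸ (1 : Submodule (ringA Fq P) K)) :
    ∃ z', a • z' = z := by
  obtain ⟨w, rfl⟩ := Submodule.Quotient.mk_surjective _ z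
  have ha' : (a : K) ≠ 0 := fun h => ha (Subtype.ext h)
  refine ⟨Submodule.Quotient.mk ((a : K)⁻¹ * w), ?_⟩
  rw [← Submodule.Quotient.mk_smul]
  congr 1
  exact mul_inv_cancel_left₀ ha' w

variable [IsFractionRing (ringA Fq P) K] [IsDedekindDomain (ringA Fq P)]

/-- Commensurability is transitive since `K/A` is divisible and the quotient of two lattices is
torsion of bounded exponent. -/
theorem Commens.trans {L L' L'' : KLattice Fq P} (h : Commens L L') (h' : Commens L' L'') :
    Commens L L'' := by
  rw [commens_iff] at h h' ⊢
  intro z w w'' hw hw''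
  obtain ⟨a, ha0, ha⟩ := Lattice.exists_smul_mem L.lat L'.lat
  obtain ⟨z', rfl⟩ := exists_smul_eq ha0 z
  obtain ⟨y, hy⟩ := L.exists_rep z'
  obtain ⟨y', hy'⟩ := L'.exists_rep z'
  obtain ⟨y'', hy''⟩ := L''.exists_rep z'
  have h1 : a • (y - y'') ∈ L.lat.carrier ⊔ L''.lat.carrier := by
    obtain ⟨u, hu, v, hv, huv⟩ := Submodule.mem_sup.1 (h z' y y' hy hy')
    obtain ⟨u', hu', v', hv', huv'⟩ := Submodule.mem_sup.1 (h' z' y' y'' hy' hy'')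
    have : y - y'' = u + v + u' + v' := by
      rw [huv, add_assoc, huv']
      ring
    rw [this, smul_add, smul_add, smul_add]
    refine add_mem (add_mem (add_mem ?_ ?_) ?_) ?_
    · exact Submodule.mem_sup_left (L.lat.carrier.smul_mem a hu)
    · exact Submodule.mem_sup_left (ha v hv)
    · exact Submodule.mem_sup_left (ha u' hu')
    · exact Submodule.mem_sup_right (L''.lat.carrier.smul_mem a hv')
  have h2 := hw.sub_mem (hy.smul a)
  have h3 := (hy''.smul a).sub_mem hw''
  have : w - w'' = (w - a • y) + a • (y - y'') + (a • y'' - w'') := by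
    rw [smul_sub]
    ring
  rw [this]
  exact add_mem (add_mem (Submodule.mem_sup_left h2) h1) (Submodule.mem_sup_right h3)

/-- A `K`-lattice commensurable with `L` is determined by its underlying lattice. -/
theorem Commens.eq_of_lat_eq {L L₁ L₂ : KLattice Fq P} (h₁ : Commens L L₁) (h₂ : Commens L L₂)
    (h : L₁.lat = L₂.lat) : L₁ = L₂ := by
  have h12 := commens_iff.1 (h₁.symm.trans h₂)
  refine ext_rep h fun z w hw => ?_
  obtain ⟨w', hw'⟩ := L₂.exists_rep z
  have := h12 z w w' hw hw'
  rw [h, sup_idem] at this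
  exact hw'.congr (by rw [← neg_sub]; exact neg_mem this)

/-- The `K`-lattice `γ L`. -/
def scale (γ : Kˣ) (L : KLattice Fq P) : KLattice Fq P where
  lat := L.lat.scale γ
  φ := (Submodule.mapQ L.lat.carrier (L.lat.scale γ).carrier
    (LinearMap.mulLeft (ringA Fq P) (γ : K)) fun _ hx => Lattice.mul_mem_scale.2 hx).comp L.φ

theorem rep_scale {γ : Kˣ} {L : KLattice Fq P} {z : K ⧸ (1 : Submodule (ringA Fq P) K)} {w : K} :
    (L.scale γ).Rep z ((γ : K) * w) ↔ L.Rep z w := by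
  have key : ∀ w, L.Rep z w → (L.scale γ).Rep z ((γ : K) * w) := fun w hw => by
    have h : (L.scale γ).φ z = Submodule.mapQ L.lat.carrier (L.lat.scale γ).carrier
      (LinearMap.mulLeft (ringA Fq P) (γ : K)) (fun _ hx => Lattice.mul_mem_scale.2 hx)
      (L.φ z) := rfl
    rw [Rep, h, hw]
    rfl
  refine ⟨fun h => ?_, key w⟩
  obtain ⟨w', hw'⟩ := L.exists_rep z
  have h1 := (key w' hw').sub_mem h
  rw [← mul_sub] at h1
  exact hw'.congr (Lattice.mul_mem_scale.1 h1)

theorem isScaling_iff {γ : Kˣ} {L L' : KLattice Fq P} : IsScaling γ L L' ↔ L' = L.scale γ := by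
  constructor
  · rintro ⟨h1, h2⟩
    have hlat : (L.scale γ).lat = L'.lat := by
      ext x
      change x ∈ (L.lat.scale γ).carrier ↔ _
      rw [Lattice.mem_scale, ← h1, mul_inv_cancel_left₀ γ.ne_zero]
    refine (ext_rep hlat fun z w hw => ?_).symm
    have h3 : w = (γ : K) * ((γ : K)⁻¹ * w) := (mul_inv_cancel_left₀ γ.ne_zero w).symm
    rw [h3, rep_scale] at hw
    rw [h3]
    exact h2 z _ hw
  · rintro rfl
    exact ⟨fun w => Lattice.mul_mem_scale, fun z w hw => rep_scale.2 hw⟩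

theorem scale_one (L : KLattice Fq P) : L.scale 1 = L :=
  (isScaling_iff.1 ⟨fun w => by rw [Units.val_one, one_mul],
    fun z w hw => by rw [Units.val_one, one_mul]; exact hw⟩).symm

theorem scale_scale (γ δ : Kˣ) (L : KLattice Fq P) : (L.scale δ).scale γ = L.scale (γ * δ) := by
  refine ext_rep (Lattice.scale_scale γ δ L.lat) fun z w hw => ?_
  have h3 : w = (γ : K) * ((δ : K) * (((γ * δ : Kˣ) : K)⁻¹ * w)) := by
    rw [← mul_assoc, ← Units.val_mul, mul_inv_cancel_left₀ (γ * δ).ne_zero]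
  rw [h3, rep_scale, rep_scale] at hw
  rw [h3, ← mul_assoc, ← Units.val_mul, rep_scale]
  exact hw

theorem Commens.scale {L L' : KLattice Fq P} (h : Commens L L') (γ : Kˣ) :
    Commens (L.scale γ) (L'.scale γ) := by
  rw [commens_iff] at h ⊢
  intro z w w' hw hw'
  have h3 : ∀ w : K, w = (γ : K) * ((γ : K)⁻¹ * w) := fun w =>
    (mul_inv_cancel_left₀ γ.ne_zero w).symm
  rw [h3 w, rep_scale] at hw
  rw [h3 w', rep_scale] at hw'
  obtain ⟨u, hu, v, hv, huv⟩ := Submodule.mem_sup.1 (h z _ _ hw hw')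
  have : w - w' = (γ : K) * u + (γ : K) * v := by
    rw [← mul_add, huv, ← mul_sub, mul_inv_cancel_left₀ γ.ne_zero]
  rw [this]
  exact add_mem (Submodule.mem_sup_left (Lattice.mul_mem_scale.2 hu))
    (Submodule.mem_sup_right (Lattice.mul_mem_scale.2 hv))

theorem commens_scale_iff {L L' : KLattice Fq P} {γ : Kˣ} :
    Commens (L.scale γ) (L'.scale γ) ↔ Commens L L' := by
  refine ⟨fun h => ?_, fun h => h.scale γ⟩
  have := h.scale γ⁻¹
  rwa [scale_scale, scale_scale, inv_mul_cancel, scale_one, scale_one] at this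

/-- Scaling as a permutation of the set of `K`-lattices. -/
def scaleEquiv (γ : Kˣ) : KLattice Fq P ≃ KLattice Fq P where
  toFun := scale γ
  invFun := scale γ⁻¹
  left_inv L := by rw [scale_scale, inv_mul_cancel, scale_one]
  right_inv L := by rw [scale_scale, mul_inv_cancel, scale_one]

/-! ### `K`-lattices commensurable with an invertible one -/

omit [IsFractionRing (ringA Fq P) K] [IsDedekindDomain (ringA Fq P)] in
theorem commens_invMul (J : NonzeroIdeal Fq P) (L : KLattice Fq P) :
    Commens L (J.invMulKLattice L) := by
  rw [commens_iff]
  intro z w w' hw hw'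
  have h1 : (J.invMulKLattice L).Rep z w := by
    change Submodule.factor (J.le_invMul L.lat) (L.φ z) = _
    rw [hw]
    rfl
  exact Submodule.mem_sup_right (h1.sub_mem hw')

/-- If `L` is invertible and `L'` is commensurable with it, then `Λ ⊆ Λ'`. Put `M = Λ + Λ'` and
`B = M Λ'⁻¹ ⊇ A`. By invertibility `φ` maps the `B⁻¹`-torsion `B / A` of `K / A` onto the
`B⁻¹`-torsion `B Λ / Λ` of `K / Λ`, and `φ'` maps it into the `B⁻¹`-torsion `M / Λ'` of
`K / Λ'`. Since `φ` and `φ'` agree modulo `M`, it follows that `B Λ ⊆ M = B Λ'`. -/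
theorem IsInvertible.le_of_commens {L L' : KLattice Fq P} (hL : L.IsInvertible)
    (h : Commens L L') : L.lat.carrier ≤ L'.lat.carrier := by
  set Λ := L.lat.toFrac with hΛ
  set Λ' := L'.lat.toFrac with hΛ'
  have hΛ0 : Λ ≠ 0 := L.lat.toFrac_ne_zero
  have hΛ'0 : Λ' ≠ 0 := L'.lat.toFrac_ne_zero
  set M := Λ + Λ' with hM
  have hM0 : M ≠ 0 := fun h0 => hΛ0 (by
    have : Λ ≤ M := by rw [hM, ← FractionalIdeal.sup_eq_add]; exact le_sup_left
    rw [h0] at this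
    exact FractionalIdeal.le_zero_iff.1 this)
  have hΛ'M : Λ' ≤ M := by rw [hM, ← FractionalIdeal.sup_eq_add]; exact le_sup_right
  -- the fractional ideal `B` with `B Λ' = Λ + Λ'`
  set B := M * Λ'⁻¹ with hB
  have hB0 : B ≠ 0 := mul_ne_zero hM0 (inv_ne_zero hΛ'0)
  have hBΛ' : B * Λ' = M := by rw [hB, mul_assoc, inv_mul_cancel₀ hΛ'0, mul_one]
  have hB1 : B⁻¹ ≤ 1 := by
    rw [hB, mul_inv, inv_inv]
    calc M⁻¹ * Λ' ≤ M⁻¹ * M := mul_le_mul_right hΛ'M _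
      _ = 1 := inv_mul_cancel₀ hM0
  -- `w ∈ B Λ` as soon as `B⁻¹ w ⊆ Λ`
  have mem_of : ∀ (N : FractionalIdeal (ringA Fq P)⁰ K) (w : K),
      (∀ c : ringA Fq P, (c : K) ∈ B⁻¹ → (c : K) * w ∈ N) → w ∈ B * N := by
    intro N w hw
    have h1 : B⁻¹ * FractionalIdeal.spanSingleton _ w ≤ N := by
      rw [FractionalIdeal.mul_le]
      intro i hi j hj
      obtain ⟨a, rfl⟩ := (FractionalIdeal.mem_spanSingleton _).1 hj
      obtain ⟨c, rfl⟩ := (FractionalIdeal.mem_one_iff _).1 (hB1 hi)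
      rw [mul_smul_comm]
      exact (N : Submodule (ringA Fq P) K).smul_mem a (hw c hi)
    have h2 : FractionalIdeal.spanSingleton (ringA Fq P)⁰ w ≤ B * N := by
      calc _ = B * (B⁻¹ * FractionalIdeal.spanSingleton (ringA Fq P)⁰ w) := by
            rw [← mul_assoc, mul_inv_cancel₀ hB0, one_mul]
        _ ≤ B * N := mul_le_mul_right h1 _
    exact h2 (FractionalIdeal.mem_spanSingleton_self _ w)
  -- the image under `φ` of the `B⁻¹`-torsion of `K/A` is the `B⁻¹`-torsion of `K/Λ`
  have hBM : B * Λ ≤ M := by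
    intro w hw
    obtain ⟨z, hz⟩ := hL.2 (Submodule.Quotient.mk w)
    have hzw : L.Rep z w := hz
    have htors : ∀ c : ringA Fq P, (c : K) ∈ B⁻¹ → c • z = 0 := by
      intro c hc
      apply hL.1
      rw [map_zero, (hzw.smul c : L.φ (c • z) = _), Submodule.Quotient.mk_eq_zero]
      have : (c : K) * w ∈ B⁻¹ * (B * Λ) := FractionalIdeal.mul_mem_mul hc hw
      rwa [← mul_assoc, inv_mul_cancel₀ hB0, one_mul] at this
    obtain ⟨w', hw'⟩ := L'.exists_rep z
    have hw'M : w' ∈ M := by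
      rw [← hBΛ']
      refine mem_of Λ' w' fun c hc => ?_
      have h1 := hw'.smul c
      rw [htors c hc] at h1
      have h2 : L'.Rep 0 0 := map_zero L'.φ
      have h3 := h1.sub_mem h2
      rwa [sub_zero] at h3
    have h4 : w - w' ∈ M := by
      have := commens_iff.1 h z w w' hzw hw'
      rw [hM, ← FractionalIdeal.sup_eq_add]
      exact this
    have h5 : w = (w - w') + w' := by ring
    rw [h5]
    exact (M : Submodule (ringA Fq P) K).add_mem h4 hw'M
  have hfin : Λ ≤ Λ' := by
    calc Λ = B⁻¹ * (B * Λ) := by rw [← mul_assoc, inv_mul_cancel₀ hB0, one_mul]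
      _ ≤ B⁻¹ * M := mul_le_mul_right hBM _
      _ = Λ' := by rw [← hBΛ', ← mul_assoc, inv_mul_cancel₀ hB0, one_mul]
  exact hfin

/-- The commensurability class of an invertible `K`-lattice `L` consists of the `J⁻¹ L`. -/
theorem IsInvertible.exists_eq_invMul {L L' : KLattice Fq P} (hL : L.IsInvertible)
    (h : Commens L L') : ∃ J : NonzeroIdeal Fq P, L' = J.invMulKLattice L := by
  have hle : L.lat.toFrac ≤ L'.lat.toFrac := hL.le_of_commens h
  have h0 := L.lat.toFrac_ne_zero
  have h0' := L'.lat.toFrac_ne_zero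
  have h1 : L.lat.toFrac * L'.lat.toFrac⁻¹ ≤ 1 := by
    calc _ ≤ L'.lat.toFrac * L'.lat.toFrac⁻¹ := mul_le_mul_left hle _
      _ = 1 := mul_inv_cancel₀ h0'
  obtain ⟨J, hJ⟩ := FractionalIdeal.le_one_iff_exists_coeIdeal.1 h1
  have hJ0 : J ≠ ⊥ := by
    rintro rfl
    have h2 : L.lat.toFrac * L'.lat.toFrac⁻¹ ≠ 0 := mul_ne_zero h0 (inv_ne_zero h0')
    rw [← hJ] at h2
    exact h2 FractionalIdeal.coeIdeal_bot
  refine ⟨⟨J, hJ0⟩, Commens.eq_of_lat_eq h (commens_invMul _ L) ?_⟩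
  apply Lattice.toFrac_injective
  change _ = (NonzeroIdeal.invMul ⟨J, hJ0⟩ L.lat).toFrac
  rw [NonzeroIdeal.toFrac_invMul]
  change _ = (J : FractionalIdeal (ringA Fq P)⁰ K)⁻¹ * _
  rw [hJ, mul_inv, inv_inv, mul_right_comm, inv_mul_cancel₀ h0, one_mul]

/-- The ideals parametrize the commensurability class of an invertible `K`-lattice. -/
def IsInvertible.classEquiv {L L' : KLattice Fq P} (hL : L.IsInvertible) (h : Commens L L') :
    NonzeroIdeal Fq P ≃ {L'' : KLattice Fq P // Commens L' L''} :=
  Equiv.ofBijective (fun J => ⟨J.invMulKLattice L, h.symm.trans (commens_invMul J L)⟩) <| by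
    constructor
    · intro J J' hJ
      exact NonzeroIdeal.invMul_injective L.lat
        (congrArg (fun L'' => (L''.1 : KLattice Fq P).lat) hJ)
    · rintro ⟨L'', hL''⟩
      obtain ⟨J, rfl⟩ := hL.exists_eq_invMul (h.trans hL'')
      exact ⟨J, rfl⟩

end KLattice

end

/-! ### The topology on `K`-lattices -/

section

variable {Fq K : Type*} [Field Fq] [Finite Fq] [Field K] [Algebra Fq K] {P : Place K}

namespace KLattice

open Filter Topology

theorem isClopen_rep (z : K ⧸ (1 : Submodule (ringA Fq P) K)) (w : K) :
    IsClopen {L : KLattice Fq P | L.Rep z w} := by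
  have h : ∀ s : Set Prop, IsOpen {L : KLattice Fq P | L.Rep z w ∈ s} := by
    intro s
    rw [isOpen_iSup_iff]
    intro Λ
    rw [isOpen_coinduced]
    refine iInf_le (fun z => TopologicalSpace.induced
      (fun φ : (K ⧸ (1 : Submodule (ringA Fq P) K)) →ₗ[ringA Fq P] (K ⧸ Λ.carrier) => φ z) ⊥) z _ ?_
    exact ⟨{y | (y = Submodule.Quotient.mk w) ∈ s}, trivial, rfl⟩
  refine ⟨⟨?_⟩, ?_⟩
  · convert h {False} using 1
    ext L
    simp
  · convert h {True} using 1
    ext L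
    simp

theorem isOpen_lat (s : Set (Lattice Fq P)) : IsOpen {L : KLattice Fq P | L.lat ∈ s} := by
  rw [isOpen_iSup_iff]
  intro Λ
  rw [isOpen_coinduced]
  by_cases h : Λ ∈ s
  · convert isOpen_univ
    ext φ
    simpa using h
  · convert isOpen_empty
    ext φ
    simpa using h

theorem eventually_lat_eq (L : KLattice Fq P) : ∀ᶠ L' in 𝓝 L, L'.lat = L.lat :=
  (isOpen_lat {L.lat}).mem_nhds rfl

theorem Rep.eventually {L : KLattice Fq P} {z : K ⧸ (1 : Submodule (ringA Fq P) K)} {w : K}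
    (h : L.Rep z w) : ∀ᶠ L' in 𝓝 L, L'.Rep z w :=
  (isClopen_rep z w).2.mem_nhds h

/-- Convergence of `K`-lattices: the underlying lattices are eventually constant, and so is
every value of `φ`. -/
theorem le_nhds_iff {L : KLattice Fq P} {F : Filter (KLattice Fq P)} :
    F ≤ 𝓝 L ↔ (∀ᶠ L' in F, L'.lat = L.lat) ∧ ∀ z w, L.Rep z w → ∀ᶠ L' in F, L'.Rep z w := by
  constructor
  · exact fun h => ⟨h L.eventually_lat_eq, fun z w hw => h hw.eventually⟩
  · rintro ⟨h1, h2⟩ U hU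
    obtain ⟨V, hVU, hV, hLV⟩ := mem_nhds_iff.1 hU
    have h3 := (isOpen_coinduced.1 (isOpen_iSup_iff.1 hV L.lat))
    let τ : TopologicalSpace ((K ⧸ (1 : Submodule (ringA Fq P) K)) →ₗ[ringA Fq P]
      (K ⧸ L.lat.carrier)) := ⨅ z, TopologicalSpace.induced (fun φ => φ z) ⊥
    have h4 := h3.mem_nhds (x := L.φ) hLV
    rw [nhds_iInf] at h4
    simp only [nhds_induced] at h4
    rw [mem_iInf] at h4
    obtain ⟨I, hI, W, hW, hVW⟩ := h4
    choose w hw using L.exists_rep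
    have h5 : ∀ᶠ L' in F, ∀ z ∈ I, L'.Rep z (w z) :=
      (eventually_all_finite hI).2 fun z _ => h2 z (w z) (hw z)
    filter_upwards [h1, h5] with L' hlat hL'
    apply hVU
    obtain ⟨Λ, φ⟩ := L'
    obtain rfl : Λ = L.lat := hlat
    change φ ∈ _ ⁻¹' V
    rw [hVW]
    refine Set.mem_iInter.2 fun z => ?_
    obtain ⟨t, ht, htW⟩ := mem_comap.1 (hW z)
    apply htW
    change φ z ∈ t
    have : φ z = L.φ z := (hL' z z.2).trans (hw z).symm
    rw [this]
    let _ : TopologicalSpace (K ⧸ L.lat.carrier) := ⊥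
    exact mem_of_mem_nhds ht

/-! ### Compactness -/

variable [IsFractionRing (ringA Fq P) K]

/-- `K / A` is torsion. -/
theorem exists_smul_eq_zero (z : K ⧸ (1 : Submodule (ringA Fq P) K)) :
    ∃ a : ringA Fq P, a ≠ 0 ∧ a • z = 0 := by
  obtain ⟨w, rfl⟩ := Submodule.Quotient.mk_surjective _ z
  obtain ⟨⟨b, a⟩, h⟩ := IsLocalization.surj (ringA Fq P)⁰ w
  refine ⟨a, nonZeroDivisors.ne_zero a.2, ?_⟩
  rw [← Submodule.Quotient.mk_smul, Submodule.Quotient.mk_eq_zero]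
  refine Submodule.mem_one.2 ⟨b, ?_⟩
  rw [← h, Algebra.smul_def, mul_comm]

variable [IsDedekindDomain (ringA Fq P)] [Ring.HasFiniteQuotients (ringA Fq P)]

/-- A set of representatives of `Λ' / (Λ ∩ Λ')` is finite. -/
theorem _root_.FunctionFieldQSM.Lattice.exists_finite_reps (Λ Λ' : Lattice Fq P) :
    ∃ W : Set K, W.Finite ∧ ∀ x ∈ Λ'.carrier, ∃ w ∈ W, x - w ∈ Λ.carrier := by
  have h : Finite (Λ'.carrier ⧸ Λ.carrier.submoduleOf Λ'.carrier) :=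
    Nat.finite_of_card_ne_zero (Lattice.relIndex_ne_zero Λ Λ')
  refine ⟨Set.range fun y : Λ'.carrier ⧸ Λ.carrier.submoduleOf Λ'.carrier => (y.out : K),
    Set.finite_range _, fun x hx => ⟨_, ⟨Submodule.Quotient.mk ⟨x, hx⟩, rfl⟩, ?_⟩⟩
  have h1 : (Submodule.Quotient.mk ⟨x, hx⟩ : Λ'.carrier ⧸ Λ.carrier.submoduleOf Λ'.carrier) =
      Submodule.Quotient.mk (Quotient.out (Submodule.Quotient.mk ⟨x, hx⟩ :
        Λ'.carrier ⧸ Λ.carrier.submoduleOf Λ'.carrier)) :=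
    (Quotient.out_eq _).symm
  exact (Submodule.Quotient.eq (Λ.carrier.submoduleOf Λ'.carrier)).1 h1

/-- `φ(z)` takes finitely many values, `z` being torsion. -/
theorem exists_finite_rep (Λ : Lattice Fq P) (z : K ⧸ (1 : Submodule (ringA Fq P) K)) :
    ∃ W : Set K, W.Finite ∧ ∀ L : KLattice Fq P, L.lat = Λ → ∃ w ∈ W, L.Rep z w := by
  obtain ⟨a, ha0, ha⟩ := exists_smul_eq_zero z
  have ha' : (a : K) ≠ 0 := fun h => ha0 (Subtype.ext h)
  obtain ⟨W, hW, h⟩ := Lattice.exists_finite_reps Λ (Λ.scale (Units.mk0 (a : K) ha')⁻¹)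
  refine ⟨W, hW, ?_⟩
  rintro L rfl
  obtain ⟨x, hx⟩ := L.exists_rep z
  have h1 := hx.smul a
  rw [ha] at h1
  have h2 := h1.sub_mem (map_zero L.φ : L.Rep 0 0)
  obtain ⟨w, hw, hxw⟩ := h x (by
    rw [Lattice.mem_scale]
    rw [sub_zero] at h2
    simpa [Algebra.smul_def] using h2)
  exact ⟨w, hw, hx.congr hxw⟩

/-- The group `Hom(K/A, K/Λ)` is compact: along an ultrafilter every value of `φ` is eventually
constant, since it is restricted to a finite set. -/
theorem isCompact_lat (Λ : Lattice Fq P) : IsCompact {L : KLattice Fq P | L.lat = Λ} := by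
  rw [isCompact_iff_ultrafilter_le_nhds]
  intro U hU
  have hU' : ∀ᶠ L in (U : Filter (KLattice Fq P)), L.lat = Λ := le_principal_iff.1 hU
  have h1 : ∀ z, ∃ w, ∀ᶠ L in (U : Filter (KLattice Fq P)), L.Rep z w := by
    intro z
    obtain ⟨W, hW, h⟩ := exists_finite_rep Λ z
    have h2 : (⋃ w ∈ W, {L : KLattice Fq P | L.Rep z w}) ∈ U := by
      filter_upwards [hU'] with L hL
      obtain ⟨w, hw, hL⟩ := h L hL
      exact Set.mem_biUnion hw hL
    obtain ⟨w, _, hw⟩ := (Ultrafilter.finite_biUnion_mem_iff hW).1 h2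
    exact ⟨w, hw⟩
  choose w hw using h1
  let φ : (K ⧸ (1 : Submodule (ringA Fq P) K)) →ₗ[ringA Fq P] (K ⧸ Λ.carrier) :=
    { toFun := fun z => Submodule.Quotient.mk (w z)
      map_add' := fun z z' => by
        obtain ⟨L, rfl, h1, h2, h3⟩ :=
          (hU'.and ((hw (z + z')).and ((hw z).and (hw z')))).exists
        rw [← h1, ← h2, ← h3, map_add]
      map_smul' := fun a z => by
        obtain ⟨L, rfl, h1, h2⟩ := (hU'.and ((hw (a • z)).and (hw z))).exists
        rw [← h1, ← h2, map_smul, RingHom.id_apply] }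
  refine ⟨⟨Λ, φ⟩, rfl, le_nhds_iff.2 ⟨hU', fun z x hx => ?_⟩⟩
  have h2 : w z - x ∈ Λ.carrier := (Submodule.Quotient.eq _).1 hx
  filter_upwards [hU', hw z] with L hL hz
  exact hz.congr (hL ▸ h2)

omit [IsFractionRing (ringA Fq P) K] [IsDedekindDomain (ringA Fq P)]
  [Ring.HasFiniteQuotients (ringA Fq P)] in
theorem isClosed_commens : IsClosed {Q : KLattice Fq P × KLattice Fq P | Commens Q.1 Q.2} := by
  rw [← isOpen_compl_iff, isOpen_iff_mem_nhds]
  intro Q hQ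
  simp only [Set.mem_compl_iff, Set.mem_ofPred_eq, commens_iff, not_forall] at hQ
  obtain ⟨z, w, w', hw, hw', h⟩ := hQ
  have h1 : ∀ᶠ Q' in 𝓝 Q, Q'.1.lat = Q.1.lat ∧ Q'.1.Rep z w :=
    continuous_fst.continuousAt.eventually (Q.1.eventually_lat_eq.and hw.eventually)
  have h2 : ∀ᶠ Q' in 𝓝 Q, Q'.2.lat = Q.2.lat ∧ Q'.2.Rep z w' :=
    continuous_snd.continuousAt.eventually (Q.2.eventually_lat_eq.and hw'.eventually)
  filter_upwards [h1, h2] with Q' ⟨h1, h3⟩ ⟨h2, h4⟩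
  intro h5
  have := commens_iff.1 h5 z w w' h3 h4
  rw [h1, h2] at this
  exact h this

end KLattice

/-! ### Pairs of commensurable `K`-lattices -/

namespace CommPair

open Filter Topology KLattice

/-- The lattices underlying a pair of `K`-lattices. -/
def lats (Q : CommPair Fq P) : Lattice Fq P × Lattice Fq P := (Q.1.1.lat, Q.1.2.lat)

theorem isOpen_lats (s : Set (Lattice Fq P × Lattice Fq P)) :
    IsOpen {Q : CommPair Fq P | lats Q ∈ s} := by
  rw [isOpen_iff_mem_nhds]
  intro Q hQ
  have h1 : ∀ᶠ Q' : CommPair Fq P in 𝓝 Q, Q'.1.1.lat = Q.1.1.lat :=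
    (continuous_fst.comp continuous_subtype_val).continuousAt.eventually Q.1.1.eventually_lat_eq
  have h2 : ∀ᶠ Q' : CommPair Fq P in 𝓝 Q, Q'.1.2.lat = Q.1.2.lat :=
    (continuous_snd.comp continuous_subtype_val).continuousAt.eventually Q.1.2.eventually_lat_eq
  filter_upwards [h1, h2] with Q' h1 h2
  change (_, _) ∈ s
  rw [h1, h2]
  exact hQ

theorem isClopen_lats (s : Set (Lattice Fq P × Lattice Fq P)) :
    IsClopen {Q : CommPair Fq P | lats Q ∈ s} :=
  ⟨⟨isOpen_lats sᶜ⟩, isOpen_lats s⟩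

variable [IsFractionRing (ringA Fq P) K] [IsDedekindDomain (ringA Fq P)]

theorem isCompact_lats [Ring.HasFiniteQuotients (ringA Fq P)] (q : Lattice Fq P × Lattice Fq P) :
    IsCompact {Q : CommPair Fq P | lats Q = q} := by
  have h := (isClosed_commens (Fq := Fq) (P := P)).isClosedEmbedding_subtypeVal.isCompact_preimage
    ((isCompact_lat q.1).prod (isCompact_lat q.2))
  have h1 : {Q : CommPair Fq P | lats Q = q} = Subtype.val ⁻¹'
      ({L : KLattice Fq P | L.lat = q.1} ×ˢ {L : KLattice Fq P | L.lat = q.2}) := by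
    ext Q
    exact Prod.ext_iff
  rw [h1]
  exact h

/-- The pair `(γ L, γ L')`. -/
def scale (γ : Kˣ) (Q : CommPair Fq P) : CommPair Fq P :=
  ⟨(Q.1.1.scale γ, Q.1.2.scale γ), Q.2.scale γ⟩

theorem scale_scale (γ δ : Kˣ) (Q : CommPair Fq P) : scale γ (scale δ Q) = scale (γ * δ) Q :=
  Subtype.ext (Prod.ext (KLattice.scale_scale _ _ _) (KLattice.scale_scale _ _ _))

theorem scale_one (Q : CommPair Fq P) : scale 1 Q = Q :=
  Subtype.ext (Prod.ext (KLattice.scale_one _) (KLattice.scale_one _))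

/-- The simultaneous scalings of a pair of lattices. -/
def orbit (q : Lattice Fq P × Lattice Fq P) : Set (Lattice Fq P × Lattice Fq P) :=
  Set.range fun γ : Kˣ => (q.1.scale γ, q.2.scale γ)

theorem mem_orbit_self (q : Lattice Fq P × Lattice Fq P) : q ∈ orbit q :=
  ⟨1, Prod.ext (Lattice.scale_one _) (Lattice.scale_one _)⟩

theorem lats_scale_mem_orbit {γ : Kˣ} {Q : CommPair Fq P} {q : Lattice Fq P × Lattice Fq P} :
    lats (scale γ Q) ∈ orbit q ↔ lats Q ∈ orbit q := by
  have key : ∀ (γ : Kˣ) (Q : CommPair Fq P), lats Q ∈ orbit q → lats (scale γ Q) ∈ orbit q := by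
    rintro γ Q ⟨δ, hδ⟩
    refine ⟨γ * δ, ?_⟩
    have h1 := congrArg Prod.fst hδ
    have h2 := congrArg Prod.snd hδ
    refine Prod.ext ?_ ?_
    · exact (Lattice.scale_scale γ δ q.1).symm.trans (congrArg (Lattice.scale γ) h1)
    · exact (Lattice.scale_scale γ δ q.2).symm.trans (congrArg (Lattice.scale γ) h2)
  refine ⟨fun h => ?_, key γ Q⟩
  have := key γ⁻¹ _ h
  rwa [scale_scale, inv_mul_cancel, scale_one] at this

end CommPair

open CommPair KLattice

variable [IsFractionRing (ringA Fq P) K] [IsDedekindDomain (ringA Fq P)]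

theorem isScaling_commPair_iff {γ : Kˣ} {Q Q' : CommPair Fq P} :
    IsScaling γ Q.1.1 Q'.1.1 ∧ IsScaling γ Q.1.2 Q'.1.2 ↔ Q' = Q.scale γ := by
  rw [KLattice.isScaling_iff, KLattice.isScaling_iff, Subtype.ext_iff, Prod.ext_iff]
  rfl

/-- The set of points of the groupoid over the pairs of lattices in the orbit of `q`. -/
def orbitSet (q : Lattice Fq P × Lattice Fq P) : Set (CommGroupoid Fq P) :=
  {a | Quot.lift (fun Q => lats Q ∈ orbit q) (fun Q Q' ⟨γ, h⟩ => by
    rw [isScaling_commPair_iff.1 h]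
    exact propext lats_scale_mem_orbit.symm) a}

theorem isClopen_orbitSet (q : Lattice Fq P × Lattice Fq P) : IsClopen (orbitSet q) :=
  ⟨⟨isQuotientMap_quot_mk.isOpen_preimage.1 (isClopen_lats (orbit q)).compl.2⟩,
    isQuotientMap_quot_mk.isOpen_preimage.1 (isClopen_lats (orbit q)).2⟩

theorem isCompact_orbitSet [Ring.HasFiniteQuotients (ringA Fq P)]
    (q : Lattice Fq P × Lattice Fq P) : IsCompact (orbitSet q) := by
  have h := (isCompact_lats q).image (continuous_quot_mk (r := fun Q Q' : CommPair Fq P =>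
    ∃ γ : Kˣ, IsScaling γ Q.1.1 Q'.1.1 ∧ IsScaling γ Q.1.2 Q'.1.2))
  convert h using 1
  refine Set.Subset.antisymm ?_ ?_
  · intro a
    induction a using Quot.ind with | mk Q => ?_
    rintro ⟨γ, hγ⟩
    refine ⟨Q.scale γ⁻¹, ?_, Quot.sound ⟨γ, isScaling_commPair_iff.2 ?_⟩⟩
    · have h1 : q.1.scale γ = Q.1.1.lat := congrArg Prod.fst hγ
      have h2 : q.2.scale γ = Q.1.2.lat := congrArg Prod.snd hγ
      refine Prod.ext ?_ ?_
      · change Q.1.1.lat.scale γ⁻¹ = q.1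
        rw [← h1, Lattice.scale_scale, inv_mul_cancel, Lattice.scale_one]
      · change Q.1.2.lat.scale γ⁻¹ = q.2
        rw [← h2, Lattice.scale_scale, inv_mul_cancel, Lattice.scale_one]
    · rw [CommPair.scale_scale, mul_inv_cancel, CommPair.scale_one]
  · rintro _ ⟨Q, rfl, rfl⟩
    exact mem_orbit_self _

/-- The elements of the convolution algebra are the continuous scaling invariant functions on
pairs of commensurable `K`-lattices that are supported on finitely many orbits of pairs of
lattices. -/
theorem mem_algA_iff [Ring.HasFiniteQuotients (ringA Fq P)] {f : CommPair Fq P → CInf P} :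
    f ∈ algA Fq P ↔ Continuous f ∧ (∀ γ Q, f (CommPair.scale γ Q) = f Q) ∧
      ∃ F : Set (Lattice Fq P × Lattice Fq P), F.Finite ∧
        ∀ Q, f Q ≠ 0 → ∃ q ∈ F, lats Q ∈ orbit q := by
  constructor
  · rintro ⟨g, hg, hc, hfg⟩
    obtain rfl : f = fun Q => g (Quot.mk _ Q) := funext hfg
    refine ⟨hg.comp continuous_quot_mk, fun γ Q =>
      congrArg g (Quot.sound ⟨γ, isScaling_commPair_iff.2 rfl⟩).symm, ?_⟩
    obtain ⟨F, hF⟩ := hc.elim_finite_subcover (fun q => orbitSet q)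
      (fun q => (isClopen_orbitSet q).2) (fun a _ => by
        induction a using Quot.ind with | mk Q => ?_
        exact Set.mem_iUnion.2 ⟨lats Q, mem_orbit_self _⟩)
    refine ⟨F, F.finite_toSet, fun Q hQ => ?_⟩
    obtain ⟨q, hq, h⟩ := Set.mem_iUnion₂.1 (hF (subset_tsupport g hQ))
    exact ⟨q, hq, h⟩
  · rintro ⟨hf, hinv, F, hF, hsupp⟩
    have hwd : ∀ Q Q' : CommPair Fq P,
        (∃ γ : Kˣ, IsScaling γ Q.1.1 Q'.1.1 ∧ IsScaling γ Q.1.2 Q'.1.2) → f Q = f Q' := by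
      rintro Q Q' ⟨γ, h⟩
      rw [isScaling_commPair_iff.1 h, hinv]
    refine ⟨Quot.lift f hwd, continuous_quot_lift hwd hf, ?_, fun _ => rfl⟩
    refine HasCompactSupport.intro' (K := ⋃ q ∈ F, orbitSet q)
      (hF.isCompact_biUnion fun q _ => isCompact_orbitSet q)
      (hF.isClosed_biUnion fun q _ => (isClopen_orbitSet q).1) fun a => ?_
    induction a using Quot.ind with | mk Q => ?_
    intro ha
    by_contra h
    obtain ⟨q, hq, hQ⟩ := hsupp Q h
    exact ha (Set.mem_biUnion hq hQ)

end

/-! ### The convolution algebra -/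

section

variable {Fq K : Type*} [Field Fq] [Finite Fq] [Field K] [Algebra Fq K] {P : Place K}

namespace KLattice

open Filter Topology

theorem Rep.add {L : KLattice Fq P} {z z' : K ⧸ (1 : Submodule (ringA Fq P) K)} {w w' : K}
    (h : L.Rep z w) (h' : L.Rep z' w') : L.Rep (z + z') (w + w') := by
  rw [Rep, map_add, h, h', Submodule.Quotient.mk_add]

theorem Rep.sub {L : KLattice Fq P} {z z' : K ⧸ (1 : Submodule (ringA Fq P) K)} {w w' : K}
    (h : L.Rep z w) (h' : L.Rep z' w') : L.Rep (z - z') (w - w') := by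
  rw [Rep, map_sub, h, h', Submodule.Quotient.mk_sub]

theorem Commens.rep_smul {L L' : KLattice Fq P} (h : Commens L L') {a : ringA Fq P}
    (ha : ∀ x ∈ L'.lat.carrier ⊔ L.lat.carrier, a • x ∈ L'.lat.carrier)
    {z : K ⧸ (1 : Submodule (ringA Fq P) K)} {w : K} (hw : L.Rep z w) : L'.Rep (a • z) (a • w) := by
  obtain ⟨w', hw'⟩ := L'.exists_rep z
  refine (hw'.smul a).congr ?_
  rw [← smul_sub]
  exact ha _ (commens_iff.1 h.symm z w' w hw' hw)

/-- There is a `K`-lattice commensurable with `L` whose underlying lattice is `Λ`. -/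
def HasLift (Λ : Lattice Fq P) (L : KLattice Fq P) : Prop := ∃ L', Commens L L' ∧ L'.lat = Λ

open Classical in
/-- The `K`-lattice commensurable with `L` whose underlying lattice is `Λ`, or `L` itself if there
is none. -/
def lift (Λ : Lattice Fq P) (L : KLattice Fq P) : KLattice Fq P :=
  if h : HasLift Λ L then h.choose else L

theorem HasLift.commens {Λ : Lattice Fq P} {L : KLattice Fq P} (h : HasLift Λ L) :
    Commens L (lift Λ L) := by
  rw [lift, dif_pos h]
  exact h.choose_spec.1

theorem HasLift.lat {Λ : Lattice Fq P} {L : KLattice Fq P} (h : HasLift Λ L) :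
    (lift Λ L).lat = Λ := by
  rw [lift, dif_pos h]
  exact h.choose_spec.2

/-- If `a ≠ 0` multiplies `Λ + Λ_L` into `Λ`, then `φ` modulo `Λ + Λ_L` lifts to a homomorphism to
`K / Λ` if and only if `a φ` vanishes modulo `Λ` on the `a`-torsion; the lift is then
`a z ↦ a φ(z)`. -/
theorem hasLift_iff {Λ : Lattice Fq P} {L : KLattice Fq P} {a : ringA Fq P} (ha0 : a ≠ 0)
    (ha : ∀ x ∈ Λ.carrier ⊔ L.lat.carrier, a • x ∈ Λ.carrier)
    {w : K ⧸ (1 : Submodule (ringA Fq P) K) → K} (hw : ∀ z, a • z = 0 → L.Rep z (w z)) :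
    HasLift Λ L ↔ ∀ z, a • z = 0 → a • w z ∈ Λ.carrier := by
  constructor
  · rintro ⟨L', h, rfl⟩ z hz
    have h1 := h.rep_smul ha (hw z hz)
    rw [hz] at h1
    have h2 := h1.sub_mem (map_zero L'.φ : L'.Rep 0 0)
    rwa [sub_zero] at h2
  · intro h
    have htors : ∀ z v, a • z = 0 → L.Rep z v → a • v ∈ Λ.carrier := by
      intro z v hz hv
      have h1 : a • v = a • w z + a • (v - w z) := by rw [smul_sub]; abel
      rw [h1]
      exact add_mem (h z hz) (ha _ (Submodule.mem_sup_right (hv.sub_mem (hw z hz))))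
    choose s hs using exists_smul_eq (P := P) (Fq := Fq) ha0
    choose v hv using L.exists_rep
    have key : ∀ z y, L.Rep z y → (Submodule.Quotient.mk (a • v (s (a • z))) : K ⧸ Λ.carrier) =
        Submodule.Quotient.mk (a • y) := by
      intro z y hy
      rw [Submodule.Quotient.eq, ← smul_sub]
      refine htors (s (a • z) - z) _ ?_ ((hv _).sub hy)
      rw [smul_sub, hs, sub_self]
    let φ : (K ⧸ (1 : Submodule (ringA Fq P) K)) →ₗ[ringA Fq P] (K ⧸ Λ.carrier) :=
      { toFun := fun z => Submodule.Quotient.mk (a • v (s z))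
        map_add' := fun z z' => by
          have h1 := key (s z + s z') _ ((hv _).add (hv _))
          rw [smul_add, hs, hs, smul_add, Submodule.Quotient.mk_add] at h1
          exact h1
        map_smul' := fun b z => by
          have h1 := key (b • s z) _ ((hv _).smul b)
          rw [smul_comm a b, hs, smul_comm a b, Submodule.Quotient.mk_smul] at h1
          exact h1 }
    refine ⟨⟨Λ, φ⟩, commens_iff.2 fun z y y' hy hy' => ?_, rfl⟩
    have h1 : a • v (s z) - y' ∈ Λ.carrier := (Submodule.Quotient.eq _).1 hy'
    have h2 : L.Rep z (a • v (s z)) := by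
      have := (hv (s z)).smul a
      rwa [hs] at this
    have h3 : y - y' = (y - a • v (s z)) + (a • v (s z) - y') := by abel
    rw [h3]
    exact add_mem (Submodule.mem_sup_left (hy.sub_mem h2)) (Submodule.mem_sup_right h1)

variable [IsFractionRing (ringA Fq P) K] [IsDedekindDomain (ringA Fq P)]

theorem finite_torsion [Ring.HasFiniteQuotients (ringA Fq P)] {a : ringA Fq P} (ha0 : a ≠ 0) :
    {z : K ⧸ (1 : Submodule (ringA Fq P) K) | a • z = 0}.Finite := by
  have ha' : (a : K) ≠ 0 := fun h => ha0 (Subtype.ext h)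
  set O : Lattice Fq P := Lattice.ofFrac 1 one_ne_zero
  have hO : O.carrier = 1 := FractionalIdeal.coe_one (S := (ringA Fq P)⁰) (P := K)
  obtain ⟨W, hW, h⟩ := Lattice.exists_finite_reps O (O.scale (Units.mk0 (a : K) ha')⁻¹)
  refine (hW.image Submodule.Quotient.mk).subset fun z hz => ?_
  obtain ⟨x, rfl⟩ := Submodule.Quotient.mk_surjective _ z
  have hx : a • x ∈ (1 : Submodule (ringA Fq P) K) := by
    rw [← Submodule.Quotient.mk_eq_zero, Submodule.Quotient.mk_smul]
    exact hz
  obtain ⟨w, hw, hxw⟩ := h x (by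
    rw [Lattice.mem_scale, hO]
    simpa [Algebra.smul_def] using hx)
  rw [hO] at hxw
  exact ⟨w, hw, ((Submodule.Quotient.eq _).2 hxw).symm⟩

/-- Whether `L` has a lift to `Λ` depends on the values of `φ` on finitely many torsion elements
only, so it is a locally constant property. -/
theorem eventually_hasLift_iff [Ring.HasFiniteQuotients (ringA Fq P)] (Λ : Lattice Fq P)
    (L₀ : KLattice Fq P) : ∀ᶠ L in 𝓝 L₀, HasLift Λ L ↔ HasLift Λ L₀ := by
  obtain ⟨a, ha0, ha⟩ := Lattice.exists_smul_sup_mem Λ L₀.lat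
  choose w hw using L₀.exists_rep
  have h1 : ∀ᶠ L in 𝓝 L₀, ∀ z ∈ {z | a • z = 0}, L.Rep z (w z) :=
    (eventually_all_finite (finite_torsion ha0)).2 fun z _ => (hw z).eventually
  filter_upwards [h1, L₀.eventually_lat_eq] with L h2 h3
  rw [hasLift_iff ha0 ha fun z _ => hw z, hasLift_iff ha0 (h3 ▸ ha) h2]

theorem tendsto_lift {Λ : Lattice Fq P} {L₀ : KLattice Fq P} (h : HasLift Λ L₀)
    (h' : ∀ᶠ L in 𝓝 L₀, HasLift Λ L) : Tendsto (lift Λ) (𝓝 L₀) (𝓝 (lift Λ L₀)) := by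
  obtain ⟨a, ha0, ha⟩ := Lattice.exists_smul_sup_mem Λ L₀.lat
  refine le_nhds_iff.2 ⟨?_, fun z w hw => ?_⟩
  · rw [eventually_map]
    filter_upwards [h'] with L hL
    rw [hL.lat, h.lat]
  · rw [eventually_map]
    obtain ⟨z, rfl⟩ := exists_smul_eq ha0 z
    obtain ⟨v, hv⟩ := L₀.exists_rep z
    filter_upwards [h', L₀.eventually_lat_eq, hv.eventually] with L hL hlat hv'
    have h1 := h.commens.rep_smul (by rwa [h.lat]) hv
    have h2 := hL.commens.rep_smul (by rwa [hL.lat, hlat]) hv'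
    refine h2.congr ?_
    have := h1.sub_mem hw
    rwa [h.lat, ← hL.lat] at this

end KLattice

open CommPair KLattice Filter Topology

theorem ev_of_commens {f : CommPair Fq P → CInf P} {L L' : KLattice Fq P} (h : Commens L L') :
    ev f L L' = f ⟨(L, L'), h⟩ := dif_pos h

theorem commens_of_ev_ne_zero {f : CommPair Fq P → CInf P} {L L' : KLattice Fq P}
    (h : ev f L L' ≠ 0) : Commens L L' := by
  by_contra h'
  exact h (dif_neg h')

theorem continuousOn_ev {f : CommPair Fq P → CInf P} (hf : Continuous f) :
    ContinuousOn (fun Q : KLattice Fq P × KLattice Fq P => ev f Q.1 Q.2)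
      {Q | Commens Q.1 Q.2} := by
  rw [continuousOn_iff_continuous_domRestrict]
  exact hf.congr fun Q => (ev_of_commens Q.2).symm

theorem _root_.ContinuousOn.tendsto_comp_prodMk {X Y Z : Type*} [TopologicalSpace Y]
    [TopologicalSpace Z] {F : Filter X} {S : Set (Y × Y)} {f : Y × Y → Z} (hf : ContinuousOn f S)
    {l l' : X → Y} {L L' : Y} (hl : Tendsto l F (𝓝 L)) (hl' : Tendsto l' F (𝓝 L'))
    (h : (L, L') ∈ S) (hc : ∀ᶠ t in F, (l t, l' t) ∈ S) :
    Tendsto (fun t => f (l t, l' t)) F (𝓝 (f (L, L'))) := by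
  have h1 : Tendsto (fun t => (l t, l' t)) F (𝓝[S] (L, L')) :=
    tendsto_nhdsWithin_iff.2 ⟨hl.prodMk_nhds hl', hc⟩
  exact (hf (L, L') h).tendsto.comp h1

/-- Evaluation of a continuous function on commensurable pairs depending continuously on a
parameter. -/
theorem tendsto_ev {X : Type*} {F : Filter X} {f : CommPair Fq P → CInf P} (hf : Continuous f)
    {l l' : X → KLattice Fq P} {L L' : KLattice Fq P} (hl : Tendsto l F (𝓝 L))
    (hl' : Tendsto l' F (𝓝 L')) (h : Commens L L') (hc : ∀ᶠ t in F, Commens (l t) (l' t)) :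
    Tendsto (fun t => ev f (l t) (l' t)) F (𝓝 (ev f L L')) :=
  (continuousOn_ev hf).tendsto_comp_prodMk hl hl' h hc

variable [IsFractionRing (ringA Fq P) K] [IsDedekindDomain (ringA Fq P)]

theorem ev_scale {f : CommPair Fq P → CInf P} (hf : ∀ γ Q, f (CommPair.scale γ Q) = f Q) (γ : Kˣ)
    (L L' : KLattice Fq P) : ev f (L.scale γ) (L'.scale γ) = ev f L L' := by
  by_cases h : Commens L L'
  · rw [ev_of_commens h, ev_of_commens (h.scale γ)]
    exact hf γ ⟨(L, L'), h⟩
  · rw [ev, ev, dif_neg h, dif_neg fun h' => h (commens_scale_iff.1 h')]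

theorem conv_scale {f₁ f₂ : CommPair Fq P → CInf P} (h₁ : ∀ γ Q, f₁ (CommPair.scale γ Q) = f₁ Q)
    (h₂ : ∀ γ Q, f₂ (CommPair.scale γ Q) = f₂ Q) (γ : Kˣ) (Q : CommPair Fq P) :
    conv f₁ f₂ (CommPair.scale γ Q) = conv f₁ f₂ Q := by
  let e : {L'' : KLattice Fq P // Commens Q.1.1 L''} ≃
      {L'' : KLattice Fq P // Commens (Q.1.1.scale γ) L''} :=
    (scaleEquiv γ).subtypeEquiv fun L'' => commens_scale_iff.symm
  refine (finsum_comp_equiv e).symm.trans (finsum_congr fun L'' => ?_)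
  exact congrArg₂ (· * ·) (ev_scale h₁ γ _ _) (ev_scale h₂ γ _ _)

open Classical in
/-- The convolution product as a sum over lattices, a `K`-lattice in a given commensurability class
being determined by its underlying lattice. -/
theorem conv_eq_finsum (f₁ f₂ : CommPair Fq P → CInf P) (Q : CommPair Fq P) :
    conv f₁ f₂ Q = ∑ᶠ Λ : Lattice Fq P, if HasLift Λ Q.1.1 then
      ev f₁ Q.1.1 (lift Λ Q.1.1) * ev f₂ (lift Λ Q.1.1) Q.1.2 else 0 := by
  set k : Lattice Fq P → CInf P := fun Λ => if HasLift Λ Q.1.1 then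
      ev f₁ Q.1.1 (lift Λ Q.1.1) * ev f₂ (lift Λ Q.1.1) Q.1.2 else 0 with hk
  have hinj : Function.Injective
      (fun L'' : {L'' : KLattice Fq P // Commens Q.1.1 L''} => L''.1.lat) := fun L₁ L₂ h =>
    Subtype.ext (Commens.eq_of_lat_eq L₁.2 L₂.2 h)
  have h1 : ∀ L'' : {L'' : KLattice Fq P // Commens Q.1.1 L''},
      ev f₁ Q.1.1 L'' * ev f₂ L'' Q.1.2 = k L''.1.lat := by
    intro L''
    have h : HasLift L''.1.lat Q.1.1 := ⟨L''.1, L''.2, rfl⟩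
    have h2 : lift L''.1.lat Q.1.1 = L''.1 := Commens.eq_of_lat_eq h.commens L''.2 h.lat
    simp only [hk]
    rw [if_pos h, h2]
  rw [conv, finsum_congr h1, ← finsum_mem_range (f := k) hinj, finsum_mem_def]
  refine finsum_congr fun Λ => ?_
  by_cases h : HasLift Λ Q.1.1
  · rw [Set.indicator_of_mem]
    exact ⟨⟨_, h.commens⟩, h.lat⟩
  · rw [Set.indicator_apply_eq_self.2]
    intro _
    exact if_neg h

theorem subsingleton_orbit_right (q : Lattice Fq P × Lattice Fq P) (Λ : Lattice Fq P) :
    {Λ' | (Λ, Λ') ∈ orbit q}.Subsingleton := by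
  rintro Λ₁ ⟨γ, hγ⟩ Λ₂ ⟨δ, hδ⟩
  simp only [Prod.mk.injEq] at hγ hδ
  have h1 : q.1.scale (δ⁻¹ * γ) = q.1 := by
    rw [← Lattice.scale_scale, hγ.1, ← hδ.1, Lattice.scale_scale, inv_mul_cancel,
      Lattice.scale_one]
  have h2 := Lattice.scale_eq_self_of_scale_eq_self h1 q.2
  rw [← hγ.2, ← hδ.2]
  conv_rhs => rw [← h2]
  rw [Lattice.scale_scale, mul_inv_cancel_left]

theorem finite_orbit_right {F : Set (Lattice Fq P × Lattice Fq P)} (hF : F.Finite)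
    (Λ : Lattice Fq P) : {Λ' | ∃ q ∈ F, (Λ, Λ') ∈ orbit q}.Finite := by
  have h : {Λ' | ∃ q ∈ F, (Λ, Λ') ∈ orbit q} = ⋃ q ∈ F, {Λ' | (Λ, Λ') ∈ orbit q} := by
    ext Λ'
    simp
  rw [h]
  exact hF.biUnion fun q _ => (subsingleton_orbit_right q Λ).finite

variable [Ring.HasFiniteQuotients (ringA Fq P)]

/-- For a fixed lattice `Λ` an element of the algebra involves finitely many lattices `Λ'`. -/
theorem finite_lat_of_mem_algA {f : CommPair Fq P → CInf P} (hf : f ∈ algA Fq P)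
    (Λ : Lattice Fq P) : {Λ' | ∃ Q, f Q ≠ 0 ∧ lats Q = (Λ, Λ')}.Finite := by
  obtain ⟨-, -, F, hF, h⟩ := mem_algA_iff.1 hf
  refine (finite_orbit_right hF Λ).subset ?_
  rintro Λ' ⟨Q, hQ, hQ'⟩
  rw [Set.mem_ofPred_eq, ← hQ']
  exact h Q hQ

/-- Near a given point the convolution product is the sum over a fixed finite set of lattices, and
each term is continuous. -/
theorem continuous_conv {f₁ f₂ : CommPair Fq P → CInf P} (h₁ : f₁ ∈ algA Fq P)
    (h₂ : Continuous f₂) : Continuous (conv f₁ f₂) := by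
  classical
  have hc₁ := (mem_algA_iff.1 h₁).1
  rw [continuous_iff_continuousAt]
  intro Q₀
  have hT := finite_lat_of_mem_algA h₁ Q₀.1.1.lat
  have hfst : Tendsto (fun Q : CommPair Fq P => Q.1.1) (𝓝 Q₀) (𝓝 Q₀.1.1) :=
    (continuous_fst.comp continuous_subtype_val).tendsto Q₀
  have hsnd : Tendsto (fun Q : CommPair Fq P => Q.1.2) (𝓝 Q₀) (𝓝 Q₀.1.2) :=
    (continuous_snd.comp continuous_subtype_val).tendsto Q₀
  set k : CommPair Fq P → Lattice Fq P → CInf P := fun Q Λ => if HasLift Λ Q.1.1 then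
      ev f₁ Q.1.1 (lift Λ Q.1.1) * ev f₂ (lift Λ Q.1.1) Q.1.2 else 0 with hk
  have h3 : ∀ᶠ Q in 𝓝 Q₀, conv f₁ f₂ Q = ∑ Λ ∈ hT.toFinset, k Q Λ := by
    filter_upwards [hfst.eventually Q₀.1.1.eventually_lat_eq] with Q hQ
    rw [conv_eq_finsum]
    refine finsum_eq_sum_of_support_subset _ fun Λ hΛ => ?_
    rw [Function.mem_support, ite_ne_right_iff] at hΛ
    obtain ⟨hl, hne⟩ := hΛ
    rw [Set.Finite.coe_toFinset]
    refine ⟨⟨(Q.1.1, lift Λ Q.1.1), hl.commens⟩, ?_, Prod.ext hQ hl.lat⟩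
    rw [← ev_of_commens (f := f₁) hl.commens]
    exact left_ne_zero_of_mul hne
  have h4 : ∀ Λ, ContinuousAt (fun Q => k Q Λ) Q₀ := by
    intro Λ
    by_cases h : HasLift Λ Q₀.1.1
    · have h5 : ∀ᶠ L in 𝓝 Q₀.1.1, HasLift Λ L :=
        (eventually_hasLift_iff Λ Q₀.1.1).mono fun L hL => hL.2 h
      have h6 := hfst.eventually h5
      have hl := (tendsto_lift h h5).comp hfst
      have h7 : ∀ᶠ Q in 𝓝 Q₀, ev f₁ Q.1.1 (lift Λ Q.1.1) * ev f₂ (lift Λ Q.1.1) Q.1.2 = k Q Λ :=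
        h6.mono fun Q hQ => (if_pos hQ).symm
      refine ContinuousAt.congr ?_ h7
      have h8 := tendsto_ev hc₁ hfst hl h.commens (h6.mono fun Q hQ => hQ.commens)
      have h9 := tendsto_ev h₂ hl hsnd (h.commens.symm.trans Q₀.2)
        (h6.mono fun Q hQ => hQ.commens.symm.trans Q.2)
      exact h8.mul h9
    · have h5 : ∀ᶠ Q in 𝓝 Q₀, ¬ HasLift Λ Q.1.1 :=
        hfst.eventually ((eventually_hasLift_iff Λ Q₀.1.1).mono fun L hL => hL.not.2 h)
      exact continuousAt_const.congr (f := fun _ => (0 : CInf P))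
        (h5.mono fun Q hQ => (if_neg hQ).symm)
  have h5 : ContinuousAt (fun Q => ∑ Λ ∈ hT.toFinset, k Q Λ) Q₀ :=
    tendsto_finsetSum _ fun Λ _ => h4 Λ
  exact h5.congr (h3.mono fun Q hQ => hQ.symm)

theorem conv_mem_algA {f₁ f₂ : CommPair Fq P → CInf P} (h₁ : f₁ ∈ algA Fq P)
    (h₂ : f₂ ∈ algA Fq P) : conv f₁ f₂ ∈ algA Fq P := by
  obtain ⟨-, hi₁, F₁, hF₁, hs₁⟩ := mem_algA_iff.1 h₁
  obtain ⟨hc₂, hi₂, F₂, hF₂, hs₂⟩ := mem_algA_iff.1 h₂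
  refine mem_algA_iff.2 ⟨continuous_conv h₁ hc₂, conv_scale hi₁ hi₂,
    ⋃ q ∈ F₁, {q' | q'.1 = q.1 ∧ ∃ r ∈ F₂, (q.2, q'.2) ∈ orbit r}, ?_, fun Q hQ => ?_⟩
  · refine hF₁.biUnion fun q _ => ?_
    refine ((Set.finite_singleton q.1).prod (finite_orbit_right hF₂ q.2)).subset ?_
    rintro ⟨Λ, Λ'⟩ ⟨h1, h2⟩
    exact ⟨h1, h2⟩
  · obtain ⟨⟨L, hL⟩, hne⟩ : ∃ L'' : {L'' : KLattice Fq P // Commens Q.1.1 L''},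
        ev f₁ Q.1.1 L'' * ev f₂ L'' Q.1.2 ≠ 0 := by
      by_contra! h
      exact hQ ((finsum_congr h).trans finsum_zero)
    have hne₁ := left_ne_zero_of_mul hne
    have hne₂ := right_ne_zero_of_mul hne
    have hL' := commens_of_ev_ne_zero hne₂
    rw [ev_of_commens hL] at hne₁
    rw [ev_of_commens hL'] at hne₂
    obtain ⟨q, hq, γ, hγ⟩ := hs₁ _ hne₁
    obtain ⟨r, hr, hr'⟩ := hs₂ _ hne₂
    have h1 : q.1.scale γ = Q.1.1.lat := congrArg Prod.fst hγ
    have h2 : q.2.scale γ = L.lat := congrArg Prod.snd hγ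
    refine ⟨(q.1, Q.1.2.lat.scale γ⁻¹), Set.mem_biUnion hq ⟨rfl, r, hr, ?_⟩, γ, ?_⟩
    · have h3 := lats_scale_mem_orbit (γ := γ⁻¹).2 hr'
      have h4 : q.2 = L.lat.scale γ⁻¹ := by
        rw [← h2, Lattice.scale_scale, inv_mul_cancel, Lattice.scale_one]
      rw [h4]
      exact h3
    · refine Prod.ext h1 ?_
      change (Q.1.2.lat.scale γ⁻¹).scale γ = _
      rw [Lattice.scale_scale, mul_inv_cancel, Lattice.scale_one]
      rfl

/-- The diagonal is compact modulo scaling since the class number is finite. -/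
theorem convOne_mem_algA (hK : IsCurveFunctionField Fq K) : convOne Fq P ∈ algA Fq P := by
  classical
  have h : convOne Fq P = fun Q => if (lats Q).1 = (lats Q).2 then 1 else 0 := by
    ext Q
    rw [convOne]
    refine if_congr ⟨fun h => congrArg KLattice.lat h, fun h => ?_⟩ rfl rfl
    exact Commens.eq_of_lat_eq (Commens.refl _) Q.2 h
  obtain ⟨S, hS, hS'⟩ := hK.exists_finite_lattices (P := P)
  rw [h, mem_algA_iff]
  refine ⟨continuous_def.2 fun s _ => isOpen_lats ((fun q : Lattice Fq P × Lattice Fq P =>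
      if q.1 = q.2 then (1 : CInf P) else 0) ⁻¹' s), fun γ Q => ?_,
    (fun Λ => (Λ, Λ)) '' S, hS.image _, fun Q hQ => ?_⟩
  · refine if_congr ⟨fun h => Lattice.scale_injective γ h, fun h => ?_⟩ rfl rfl
    exact congrArg (Lattice.scale γ) h
  · have h1 : (lats Q).1 = (lats Q).2 := by
      by_contra h1
      exact hQ (if_neg h1)
    obtain ⟨Λ₀, hΛ₀, γ, hγ⟩ := hS' (lats Q).1
    exact ⟨_, ⟨Λ₀, hΛ₀, rfl⟩, γ, Prod.ext hγ.symm (hγ.symm.trans h1)⟩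

variable {p : ℕ} [Fact p.Prime]

omit [IsFractionRing (ringA Fq P) K] [IsDedekindDomain (ringA Fq P)]
  [Ring.HasFiniteQuotients (ringA Fq P)] [Finite Fq] in
theorem oneUnitPow_zero (w : CInf P) : oneUnitPow p w 0 = 1 := by
  have h : (1 : ZMod p).val = 1 := ZMod.val_one p
  rw [oneUnitPow, tsum_eq_single 0]
  · simp [h]
  · intro j hj
    rw [Ring.choose_zero_pos _ (Nat.pos_of_ne_zero hj)]
    simp

omit [IsFractionRing (ringA Fq P) K] [IsDedekindDomain (ringA Fq P)]
  [Ring.HasFiniteQuotients (ringA Fq P)] in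
theorem idealPow_zero (u : KInf P) (Λ : Lattice Fq P) (x : (CInf P)ˣ) :
    Λ.idealPow u (x, (0 : ℤ_[p])) = (x : CInf P) ^ Λ.deg := by
  rw [Lattice.idealPow, oneUnitPow_zero, mul_one]

omit [IsFractionRing (ringA Fq P) K] [IsDedekindDomain (ringA Fq P)]
  [Ring.HasFiniteQuotients (ringA Fq P)] in
theorem timeEvolution_apply (u : KInf P) (x : (CInf P)ˣ) (f : CommPair Fq P → CInf P)
    (Q : CommPair Fq P) : timeEvolution u (x, (0 : ℤ_[p])) f Q =
      (x : CInf P) ^ (Q.1.1.lat.deg - Q.1.2.lat.deg) * f Q := by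
  rw [timeEvolution, idealPow_zero, idealPow_zero, zpow_sub₀ x.ne_zero]

/-- The factor `x ^ (deg Λ - deg Λ')` depends only on the lattices and is invariant under
scaling. -/
theorem timeEvolution_mem_algA (u : KInf P) (x : (CInf P)ˣ) {f : CommPair Fq P → CInf P}
    (hf : f ∈ algA Fq P) : timeEvolution u (x, (0 : ℤ_[p])) f ∈ algA Fq P := by
  obtain ⟨hc, hi, F, hF, hs⟩ := mem_algA_iff.1 hf
  have h : timeEvolution u (x, (0 : ℤ_[p])) f = fun Q =>
      (x : CInf P) ^ ((lats Q).1.deg - (lats Q).2.deg) * f Q := funext (timeEvolution_apply u x f)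
  rw [h, mem_algA_iff]
  refine ⟨Continuous.mul (continuous_def.2 fun s _ => isOpen_lats
    ((fun q : Lattice Fq P × Lattice Fq P => (x : CInf P) ^ (q.1.deg - q.2.deg)) ⁻¹' s)) hc,
    fun γ Q => ?_, F, hF, fun Q hQ => hs Q (right_ne_zero_of_mul hQ)⟩
  rw [hi]
  congr 2
  exact Lattice.deg_scale_sub_deg_scale γ Q.1.2.lat Q.1.1.lat

end

/-! ### The operator norm -/

section

variable {Fq K : Type*} [Field Fq] [Finite Fq] [Field K] [Algebra Fq K] {P : Place K}

open CommPair KLattice Filter Topology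

omit [Finite Fq] [Field Fq] [Algebra Fq K] in
theorem isUltrametricDist_kInfBar (P : Place K) : IsUltrametricDist (KInfBar P) :=
  IsUltrametricDist.isUltrametricDist_of_isNonarchimedean_norm
    (isNonarchimedean_spectralNorm (K := KInf P) (L := KInfBar P))

instance isUltrametricDist_cInf (P : Place K) : IsUltrametricDist (CInf P) := by
  have := isUltrametricDist_kInfBar P
  refine IsUltrametricDist.isUltrametricDist_of_forall_norm_add_le_max_norm fun a b => ?_
  induction a, b using UniformSpace.Completion.induction_on₂ with
  | hp => exact isClosed_le (by fun_prop) (by fun_prop)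
  | ih a b =>
    rw [← UniformSpace.Completion.coe_add]
    simp only [UniformSpace.Completion.norm_coe]
    exact IsUltrametricDist.norm_add_le_max a b

theorem exists_bound_of_mem_algA {f : CommPair Fq P → CInf P} (hf : f ∈ algA Fq P) :
    ∃ C : ℝ≥0, ∀ L L', ‖ev f L L'‖₊ ≤ C := by
  obtain ⟨g, hg, hc, h⟩ := hf
  obtain ⟨C, hC⟩ := hc.exists_bound_of_continuous hg
  refine ⟨C.toNNReal, fun L L' => ?_⟩
  by_cases hL : Commens L L'
  · rw [ev_of_commens hL, h]
    exact NNReal.le_toNNReal_of_coe_le (hC _)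
  · rw [ev, dif_neg hL, nnnorm_zero]
    exact zero_le

/-- As the norm is nonarchimedean, the operator norm is at most the supremum norm of `f`. -/
theorem piNorm_lt_top (L : KLattice Fq P) {f : CommPair Fq P → CInf P} (hf : f ∈ algA Fq P) :
    piNorm L f < ⊤ := by
  obtain ⟨C, hC⟩ := exists_bound_of_mem_algA hf
  refine lt_of_le_of_lt (iSup₂_le fun ξ hξ => ?_) (ENNReal.coe_lt_top (r := C))
  refine ENNReal.div_le_of_le_mul (iSup_le fun L' => ?_)
  have h1 : ‖piRep L f ξ L'‖₊ ≤ C * ξ.support.sup fun L'' => ‖ξ L''‖₊ := by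
    refine IsUltrametricDist.nnnorm_sum_le_of_forall_le fun L'' hL'' => ?_
    rw [nnnorm_mul]
    exact mul_le_mul' (hC _ _) (Finset.le_sup (f := fun L'' => ‖ξ L''‖₊) hL'')
  have h2 : ((ξ.support.sup fun L'' => ‖ξ L''‖₊ : ℝ≥0) : ℝ≥0∞) ≤ ⨆ L'', ‖ξ L''‖ₑ := by
    obtain ⟨L₀, hL₀⟩ := Finsupp.support_nonempty_iff.2 hξ
    obtain ⟨L₁, -, h⟩ := Finset.exists_mem_eq_sup ξ.support ⟨L₀, hL₀⟩ fun L'' => ‖ξ L''‖₊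
    rw [h]
    exact le_iSup (fun L'' => ‖ξ L''‖ₑ) L₁
  calc ‖piRep L f ξ L'‖ₑ ≤ ((C * ξ.support.sup fun L'' => ‖ξ L''‖₊ : ℝ≥0) : ℝ≥0∞) :=
        ENNReal.coe_le_coe.2 h1
    _ ≤ C * ⨆ L'', ‖ξ L''‖ₑ := by
        rw [ENNReal.coe_mul]
        exact mul_le_mul_right h2 _

/-- A diagonal matrix entry is bounded by the operator norm. -/
theorem enorm_ev_le_piNorm {L L' : KLattice Fq P} (h : Commens L L') (f : CommPair Fq P → CInf P) :
    ‖ev f L' L'‖ₑ ≤ piNorm L f := by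
  classical
  let M : CommClass L := ⟨L', h⟩
  let ξ : CommClass L →₀ CInf P := Finsupp.single M 1
  have hξ : ξ ≠ 0 := Finsupp.single_ne_zero.2 one_ne_zero
  refine le_trans ?_ (le_iSup₂ (f := fun (ξ : CommClass L →₀ CInf P) (_ : ξ ≠ 0) =>
    (⨆ L', ‖piRep L f ξ L'‖ₑ) / (⨆ L', ‖ξ L'‖ₑ)) ξ hξ)
  have h1 : piRep L f ξ M = ev f L' L' := by
    rw [piRep, Finsupp.sum_single_index (mul_zero _), mul_one]
  have h2 : ⨆ L', ‖ξ L'‖ₑ ≤ 1 := iSup_le fun L'' => by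
    rw [Finsupp.single_apply]
    split_ifs
    · rw [enorm_one]
    · rw [enorm_zero]
      exact zero_le
  calc ‖ev f L' L'‖ₑ = ‖piRep L f ξ M‖ₑ / 1 := by rw [h1, div_one]
    _ ≤ _ := ENNReal.div_le_div (le_iSup (fun L' => ‖piRep L f ξ L'‖ₑ) M) h2

/-! ### The partition function -/

variable {p : ℕ} [Fact p.Prime] {x : (CInf P)ˣ}

theorem powNeg_eq (u : KInf P) (J : NonzeroIdeal Fq P) (x : (CInf P)ˣ) :
    J.powNeg p u x = (x : CInf P)⁻¹ ^ J.degree := by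
  rw [NonzeroIdeal.powNeg, idealPow_zero, NonzeroIdeal.deg_toLattice, zpow_natCast,
    Units.val_inv_eq_inv_val]

theorem ev_add (f g : CommPair Fq P → CInf P) (L L' : KLattice Fq P) :
    ev (f + g) L L' = ev f L L' + ev g L L' := by
  by_cases h : Commens L L'
  · rw [ev_of_commens h, ev_of_commens h, ev_of_commens h, Pi.add_apply]
  · rw [ev, ev, ev, dif_neg h, dif_neg h, dif_neg h, add_zero]

theorem ev_smul (c : CInf P) (f : CommPair Fq P → CInf P) (L L' : KLattice Fq P) :
    ev (c • f) L L' = c * ev f L L' := by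
  by_cases h : Commens L L'
  · rw [ev_of_commens h, ev_of_commens h, Pi.smul_apply, smul_eq_mul]
  · rw [ev, ev, dif_neg h, dif_neg h, mul_zero]

variable [IsFractionRing (ringA Fq P) K] [Ring.HasFiniteQuotients (ringA Fq P)]

theorem tendsto_degree : Tendsto (NonzeroIdeal.degree : NonzeroIdeal Fq P → ℕ) cofinite atTop :=
  tendsto_atTop.2 fun n => by
    refine (NonzeroIdeal.finite_degree_le n).subset fun J hJ => ?_
    exact (not_le.1 (show ¬ n ≤ J.degree from hJ)).le

theorem tendsto_pow_degree (hx : 1 < ‖(x : CInf P)‖) :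
    Tendsto (fun J : NonzeroIdeal Fq P => (x : CInf P)⁻¹ ^ J.degree) cofinite (𝓝 0) := by
  refine (tendsto_pow_atTop_nhds_zero_of_norm_lt_one ?_).comp tendsto_degree
  rw [norm_inv]
  exact inv_lt_one_of_one_lt₀ hx

theorem norm_inv_pow_le_one (hx : 1 < ‖(x : CInf P)‖) (n : ℕ) : ‖(x : CInf P)⁻¹ ^ n‖ ≤ 1 := by
  rw [norm_pow, norm_inv]
  exact pow_le_one₀ (by positivity) (inv_lt_one_of_one_lt₀ hx).le

theorem summable_mul_pow_degree (hx : 1 < ‖(x : CInf P)‖) {b : NonzeroIdeal Fq P → CInf P} {C : ℝ}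
    (hb : ∀ J, ‖b J‖ ≤ C) :
    Summable fun J : NonzeroIdeal Fq P => b J * (x : CInf P)⁻¹ ^ J.degree := by
  refine NonarchimedeanAddGroup.summable_of_tendsto_cofinite_zero ?_
  refine squeeze_zero_norm (a := fun J => C * ‖(x : CInf P)⁻¹ ^ J.degree‖) (fun J => ?_) ?_
  · rw [norm_mul]
    gcongr
    exact hb J
  · have h := (tendsto_pow_degree (Fq := Fq) hx).norm.const_mul C
    rwa [norm_zero, mul_zero] at h

theorem summable_pow_degree (hx : 1 < ‖(x : CInf P)‖) :
    Summable fun J : NonzeroIdeal Fq P => (x : CInf P)⁻¹ ^ J.degree :=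
  NonarchimedeanAddGroup.summable_of_tendsto_cofinite_zero (tendsto_pow_degree hx)

/-- The term for `J = A` is `1` and all the others have norm at most `|x|⁻¹`. -/
theorem tsum_pow_degree_ne_zero (hx : 1 < ‖(x : CInf P)‖) :
    ∑' J : NonzeroIdeal Fq P, (x : CInf P)⁻¹ ^ J.degree ≠ 0 := by
  classical
  intro h0
  have hx' := inv_lt_one_of_one_lt₀ hx
  let J₀ : NonzeroIdeal Fq P := ⟨⊤, top_ne_bot⟩
  have h1 := (summable_pow_degree (Fq := Fq) hx).hasSum.sub (hasSum_ite_eq J₀ (1 : CInf P))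
  rw [h0, zero_sub] at h1
  have h2 : ‖∑' J : NonzeroIdeal Fq P, ((x : CInf P)⁻¹ ^ J.degree - if J = J₀ then 1 else 0)‖ ≤
      ‖(x : CInf P)‖⁻¹ := by
    refine IsUltrametricDist.norm_tsum_le_of_forall_le_of_nonneg (by positivity) fun J => ?_
    split_ifs with hJ
    · rw [hJ, (J₀.degree_eq_zero_iff).2 rfl, pow_zero, sub_self, norm_zero]
      positivity
    · have hd : J.degree ≠ 0 := fun h => hJ (Subtype.ext ((J.degree_eq_zero_iff).1 h))
      rw [sub_zero, norm_pow, norm_inv]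
      exact pow_le_of_le_one (by positivity) hx'.le hd
  rw [h1.tsum_eq, norm_neg, norm_one] at h2
  exact absurd h2 (not_le.2 hx')

/-! ### The functional -/

theorem summable_ev (hx : 1 < ‖(x : CInf P)‖) (L : KLattice Fq P) {f : CommPair Fq P → CInf P}
    (hf : f ∈ algA Fq P) : Summable fun J : NonzeroIdeal Fq P =>
      ev f (J.invMulKLattice L) (J.invMulKLattice L) * (x : CInf P)⁻¹ ^ J.degree := by
  obtain ⟨C, hC⟩ := exists_bound_of_mem_algA hf
  exact summable_mul_pow_degree hx (C := C) fun J => hC _ _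

/-- The weighted trace `f ↦ Z⁻¹ ∑_J f(J⁻¹ L, J⁻¹ L) x ^ (- deg J)`. -/
def weightedTrace (hx : 1 < ‖(x : CInf P)‖) (L : KLattice Fq P) (Z : CInf P) :
    algA Fq P →ₗ[CInf P] CInf P where
  toFun f := Z⁻¹ * ∑' J : NonzeroIdeal Fq P,
    ev f (J.invMulKLattice L) (J.invMulKLattice L) * (x : CInf P)⁻¹ ^ J.degree
  map_add' f g := by
    rw [← mul_add, ← (summable_ev hx L f.2).tsum_add (summable_ev hx L g.2)]
    congr 1
    refine tsum_congr fun J => ?_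
    rw [Submodule.coe_add, ev_add, add_mul]
  map_smul' c f := by
    have h : ∑' J : NonzeroIdeal Fq P, ev (c • f : algA Fq P) (J.invMulKLattice L)
        (J.invMulKLattice L) * (x : CInf P)⁻¹ ^ J.degree = c * ∑' J : NonzeroIdeal Fq P,
        ev f (J.invMulKLattice L) (J.invMulKLattice L) * (x : CInf P)⁻¹ ^ J.degree := by
      rw [← tsum_mul_left]
      refine tsum_congr fun J => ?_
      rw [Submodule.coe_smul, ev_smul, mul_assoc]
    rw [h, RingHom.id_apply, smul_eq_mul, mul_left_comm]

theorem enorm_weightedTrace_le (hx : 1 < ‖(x : CInf P)‖) (L : KLattice Fq P) (Z : CInf P)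
    (f : algA Fq P) : ‖weightedTrace hx L Z f‖ₑ ≤ ‖Z⁻¹‖₊ * piNorm L f := by
  have hfin := (piNorm_lt_top L f.2).ne
  have h1 : ‖∑' J : NonzeroIdeal Fq P, ev f (J.invMulKLattice L) (J.invMulKLattice L) *
      (x : CInf P)⁻¹ ^ J.degree‖ ≤ (piNorm L f).toReal := by
    refine IsUltrametricDist.norm_tsum_le_of_forall_le_of_nonneg ENNReal.toReal_nonneg fun J => ?_
    rw [norm_mul]
    refine (mul_le_of_le_one_right (norm_nonneg _) (norm_inv_pow_le_one hx _)).trans ?_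
    rw [← toReal_enorm]
    exact ENNReal.toReal_mono hfin (enorm_ev_le_piNorm (commens_invMul J L) _)
  have h2 : weightedTrace hx L Z f = Z⁻¹ * ∑' J : NonzeroIdeal Fq P,
      ev f (J.invMulKLattice L) (J.invMulKLattice L) * (x : CInf P)⁻¹ ^ J.degree := rfl
  rw [h2, enorm_mul]
  refine mul_le_mul_right ?_ _
  rw [← ofReal_norm, ← ENNReal.ofReal_toReal hfin]
  exact ENNReal.ofReal_le_ofReal h1

variable [IsDedekindDomain (ringA Fq P)]

omit [Ring.HasFiniteQuotients (ringA Fq P)] in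
/-- Convolution on the commensurability class of an invertible `K`-lattice is multiplication of
matrices indexed by the nonzero ideals. -/
theorem ev_conv_invMul {L : KLattice Fq P} (hL : L.IsInvertible) (f₁ f₂ : CommPair Fq P → CInf P)
    (J : NonzeroIdeal Fq P) :
    ev (conv f₁ f₂) (J.invMulKLattice L) (J.invMulKLattice L) = ∑ᶠ J' : NonzeroIdeal Fq P,
      ev f₁ (J.invMulKLattice L) (J'.invMulKLattice L) *
        ev f₂ (J'.invMulKLattice L) (J.invMulKLattice L) := by
  rw [ev_of_commens (Commens.refl _)]
  exact (finsum_comp_equiv (hL.classEquiv (commens_invMul J L))).symm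

theorem finite_ev_invMul_ne_zero {f : CommPair Fq P → CInf P} (hf : f ∈ algA Fq P)
    (L L' : KLattice Fq P) : {J : NonzeroIdeal Fq P | ev f L' (J.invMulKLattice L) ≠ 0}.Finite := by
  refine Set.Finite.of_finite_image ((finite_lat_of_mem_algA hf L'.lat).subset ?_)
    (f := fun J : NonzeroIdeal Fq P => J.invMul L.lat)
    ((NonzeroIdeal.invMul_injective L.lat).injOn)
  rintro _ ⟨J, hJ, rfl⟩
  have h := commens_of_ev_ne_zero hJ
  refine ⟨⟨(L', J.invMulKLattice L), h⟩, ?_, rfl⟩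
  rw [← ev_of_commens (f := f) h]
  exact hJ

/-- Since `deg(J⁻¹ Λ) = deg Λ - deg J`, the time evolution moves the weight from `J` to `J'`. -/
theorem ev_timeEvolution_invMul (u : KInf P) (f : CommPair Fq P → CInf P) (L : KLattice Fq P)
    (J J' : NonzeroIdeal Fq P) :
    ev (timeEvolution u (x, (0 : ℤ_[p])) f) (J'.invMulKLattice L) (J.invMulKLattice L) *
      (x : CInf P)⁻¹ ^ J.degree =
    ev f (J'.invMulKLattice L) (J.invMulKLattice L) * (x : CInf P)⁻¹ ^ J'.degree := by
  have h : Commens (J'.invMulKLattice L) (J.invMulKLattice L) :=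
    (commens_invMul J' L).symm.trans (commens_invMul J L)
  have h1 : (J'.invMulKLattice L).lat.deg - (J.invMulKLattice L).lat.deg =
      (J.degree : ℤ) - J'.degree := by
    change (J'.invMul L.lat).deg - (J.invMul L.lat).deg = _
    rw [NonzeroIdeal.deg_invMul, NonzeroIdeal.deg_invMul]
    ring
  have hx0 := x.ne_zero
  rw [ev_of_commens h, ev_of_commens h, timeEvolution_apply]
  change (x : CInf P) ^ ((J'.invMulKLattice L).lat.deg - (J.invMulKLattice L).lat.deg) * _ * _ = _
  rw [h1, zpow_sub₀ hx0, zpow_natCast, zpow_natCast, inv_pow, inv_pow]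
  field_simp

/-- The trace property of the weighted trace, twisted by the time evolution: both sides are the sum
of `f₁(J⁻¹ L, J'⁻¹ L) f₂(J'⁻¹ L, J⁻¹ L) x ^ (- deg J')` over all pairs of ideals. -/
theorem tsum_conv_timeEvolution (hx : 1 < ‖(x : CInf P)‖) (u : KInf P) {L : KLattice Fq P}
    (hL : L.IsInvertible) {f₁ f₂ : CommPair Fq P → CInf P} (h₁ : f₁ ∈ algA Fq P)
    (h₂ : f₂ ∈ algA Fq P) :
    ∑' J : NonzeroIdeal Fq P, ev (conv f₁ (timeEvolution u (x, (0 : ℤ_[p])) f₂))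
      (J.invMulKLattice L) (J.invMulKLattice L) * (x : CInf P)⁻¹ ^ J.degree =
    ∑' J : NonzeroIdeal Fq P, ev (conv f₂ f₁)
      (J.invMulKLattice L) (J.invMulKLattice L) * (x : CInf P)⁻¹ ^ J.degree := by
  set k : NonzeroIdeal Fq P → NonzeroIdeal Fq P → CInf P := fun J J' =>
    ev f₁ (J.invMulKLattice L) (J'.invMulKLattice L) *
      ev f₂ (J'.invMulKLattice L) (J.invMulKLattice L) * (x : CInf P)⁻¹ ^ J'.degree with hk
  have hfin₁ : ∀ J : NonzeroIdeal Fq P, {J' : NonzeroIdeal Fq P |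
      ev f₁ (J.invMulKLattice L) (J'.invMulKLattice L) ≠ 0}.Finite := fun J =>
    finite_ev_invMul_ne_zero h₁ L _
  have hfin₂ : ∀ J : NonzeroIdeal Fq P, {J' : NonzeroIdeal Fq P |
      ev f₂ (J.invMulKLattice L) (J'.invMulKLattice L) ≠ 0}.Finite := fun J =>
    finite_ev_invMul_ne_zero h₂ L _
  have hsum : Summable (Function.uncurry k) := by
    refine NonarchimedeanAddGroup.summable_of_tendsto_cofinite_zero ?_
    obtain ⟨C₁, hC₁⟩ := exists_bound_of_mem_algA h₁
    obtain ⟨C₂, hC₂⟩ := exists_bound_of_mem_algA h₂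
    rw [Metric.tendsto_nhds]
    intro ε hε
    have hlim : Tendsto (fun J : NonzeroIdeal Fq P => (C₁ * C₂ : ℝ) * ‖(x : CInf P)⁻¹ ^ J.degree‖)
        cofinite (𝓝 0) := by
      simpa using (tendsto_pow_degree hx).norm.const_mul (C₁ * C₂ : ℝ)
    have hS : {J' : NonzeroIdeal Fq P |
        ¬ (C₁ * C₂ : ℝ) * ‖(x : CInf P)⁻¹ ^ J'.degree‖ < ε}.Finite :=
      hlim.eventually (gt_mem_nhds hε)
    refine (hS.biUnion fun J' _ => (hfin₂ J').image fun J : NonzeroIdeal Fq P => (J, J')).subset ?_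
    rintro ⟨J, J'⟩ hJ
    have hJ' : ¬ dist (k J J') 0 < ε := hJ
    rw [dist_zero_right] at hJ'
    have hb : ‖k J J'‖ ≤ (C₁ * C₂ : ℝ) * ‖(x : CInf P)⁻¹ ^ J'.degree‖ := by
      rw [hk, norm_mul, norm_mul]
      gcongr
      · exact hC₁ _ _
      · exact hC₂ _ _
    refine Set.mem_biUnion (x := J') (fun h => hJ' (hb.trans_lt h)) ⟨J, fun h => hJ' ?_, rfl⟩
    rw [hk]
    simp only
    rw [h, mul_zero, zero_mul, norm_zero]
    exact hε
  have hleft : ∀ J : NonzeroIdeal Fq P, ev (conv f₁ (timeEvolution u (x, (0 : ℤ_[p])) f₂))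
      (J.invMulKLattice L) (J.invMulKLattice L) * (x : CInf P)⁻¹ ^ J.degree = ∑' J', k J J' := by
    intro J
    rw [ev_conv_invMul hL,
      ← tsum_eq_finsum (L := .unconditional _) ((hfin₁ J).subset fun J' h => left_ne_zero_of_mul h),
      ← tsum_mul_right]
    refine tsum_congr fun J' => ?_
    rw [mul_assoc, ev_timeEvolution_invMul, ← mul_assoc]
  have hright : ∀ J' : NonzeroIdeal Fq P, ev (conv f₂ f₁)
      (J'.invMulKLattice L) (J'.invMulKLattice L) * (x : CInf P)⁻¹ ^ J'.degree = ∑' J, k J J' := by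
    intro J'
    rw [ev_conv_invMul hL,
      ← tsum_eq_finsum (L := .unconditional _) ((hfin₂ J').subset fun J h => left_ne_zero_of_mul h),
      ← tsum_mul_right]
    refine tsum_congr fun J => ?_
    rw [mul_comm (ev f₂ _ _)]
  rw [tsum_congr hleft, tsum_congr hright]
  exact hsum.tsum_comm.symm

end

end FunctionFieldQSM

end

open FunctionFieldQSM in
theorem theorem4p9 {p : ℕ} [Fact p.Prime] {Fq K : Type*} [Field Fq] [Finite Fq] [CharP Fq p]
    [Field K] [Algebra Fq K] (hK : IsCurveFunctionField Fq K)
    (P : Place K) (u : KInf P) (hu : IsUniformizer u)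
    (L : KLattice Fq P) (hL : L.IsInvertible)
    (x : (CInf P)ˣ) (hx : (Nat.card Fq : ℝ) < ‖(x : CInf P)‖) :
    (Summable fun J : NonzeroIdeal Fq P => J.powNeg p u x) ∧
    partitionZ Fq p u x ≠ 0 ∧
    (∀ f : algA Fq P, piNorm L f < ⊤) ∧
    (∀ f : algA Fq P, Summable fun J : NonzeroIdeal Fq P =>
      ev f (J.invMulKLattice L) (J.invMulKLattice L) * J.powNeg p u x) ∧
    ∃ Φ : algA Fq P →ₗ[CInf P] CInf P,
      (∀ f : algA Fq P, Φ f = (partitionZ Fq p u x)⁻¹ * ∑' J : NonzeroIdeal Fq P,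
        ev f (J.invMulKLattice L) (J.invMulKLattice L) * J.powNeg p u x) ∧
      IsKMSFunctional p u L x Φ := by
  have := hK.isFractionRing_ringA P
  have := hK.isDedekindDomain_ringA P
  have := hK.hasFiniteQuotients (ringA Fq P)
  have hx1 : 1 < ‖(x : CInf P)‖ :=
    lt_trans (by exact_mod_cast Finite.one_lt_card (α := Fq)) hx
  have hZ : partitionZ Fq p u x ≠ 0 := by
    rw [partitionZ, tsum_congr fun J => powNeg_eq u J x]
    exact tsum_pow_degree_ne_zero hx1
  simp only [powNeg_eq]
  refine ⟨summable_pow_degree hx1, hZ, fun f => piNorm_lt_top L f.2,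
    fun f => summable_ev hx1 L f.2, weightedTrace hx1 L (partitionZ Fq p u x), fun f => rfl,
    ⟨_, enorm_weightedTrace_le hx1 L _⟩, ⟨convOne_mem_algA hK, ?_⟩,
    fun f => timeEvolution_mem_algA u x f.2, fun f₁ f₂ =>
    ⟨conv_mem_algA f₁.2 (timeEvolution_mem_algA u x f₂.2), conv_mem_algA f₂.2 f₁.2,
      congrArg ((partitionZ Fq p u x)⁻¹ * ·) (tsum_conv_timeEvolution hx1 u hL f₁.2 f₂.2)⟩⟩
  change (partitionZ Fq p u x)⁻¹ * _ = 1
  convert inv_mul_cancel₀ hZ using 2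
  rw [partitionZ]
  refine tsum_congr fun J => ?_
  have h : ev (convOne Fq P) (J.invMulKLattice L) (J.invMulKLattice L) = 1 := by
    rw [ev_of_commens (KLattice.Commens.refl _)]
    exact if_pos rfl
  rw [powNeg_eq, h, one_mul]
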